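/- Let $k$ be a commutative ring, $n\ge 0$, $R_n=k[t]/(t^{n+1})$, and let $A$ be a dg algebra over $k$. Let $A_n$ be a cdg deformation of $A$ of order $n$, i.e. a cdg algebra over $R_n$ (a graded $R_n$-algebra with a derivation $d$ of degree $1$ and a curvature $c\in A_n^2$ such that $dc=0$ and $d^2=[c,-]$) whose underlying graded $R_n$-module is $A\otimes_k R_n$ and whose structure reduces modulo $t$ to that of $A$. A left (resp. right) $A_n$-module is a graded left (resp. right) module $M$ with a derivation $d_M$ of degree $1$ such that $d_M^2m=cm$ (resp. $d_M^2m=-mc$). Let $\mathrm{Hot}(A_n)$ be the homotopy category of left $A_n$-modules (closed morphisms of degree $0$ modulo homotopy, with its usual triangulated structure). A left module $M$ is $n$-acyclic if the complexes $t^iM/t^{i+1}M$, $0\le i\le n$, are acyclic; $D^n(A_n)$ is the Verdier quotient of $\mathrm{Hot}(A_n)$ by the full subcategory of $n$-acyclic modules; and $I$ is $n$-homotopy injective if $\mathrm{Hom}_{\mathrm{Hot}(A_n)}(N,I)=0$ for every $n$-acyclic $N$. Put $A_i=A_n/t^{i+1}A_n$ (so $A_{-1}=0$) and choose $\tfrac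 ct\in A_n^2$ with $t\,\tfrac ct=c$. For $0\le i\le n$ let $D_i$ be the right $A_n$-module $A_i\oplus A_{i-1}[1]$ with predifferential $d(\alpha,a)=\bigl(d\alpha+ta,\,-da-\pi(\tfrac ct\,\alpha)\bigr)$, where $\pi\colon A_i\to A_{i-1}$ is the projection, and let $\Gamma_i^*=\mathrm{Hom}_{\mathbb Z}(D_i,\mathbb Q/\mathbb Z)$ be its linear dual, a left $A_n$-module. A left $A_n$-module is $n$-cocell if it lies in the smallest triangulated subcategory of $\mathrm{Hot}(A_n)$ that contains $\Gamma_0^*,\dots,\Gamma_n^*$ and is closed under products. Then: 1. Every left $A_n$-module $M$ admits an $n$-cocell resolution: there are an $n$-cocell module $I$ and a closed morphism $M\to I$ of degree $0$ whose cone is $n$-acyclic. 2. The quotient functor $\mathrm{Hot}(A_n)\to D^n(A_n)$ has a fully faithful right adjoint, whose essential image consists exactly of the $n$-homotopy injective modules. -/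

import Mathlib

open CategoryTheory

universe w v u

namespace CurvedDG

/-- A cdg algebra over `R`: a predifferential `d` of degree `1` and a curvature element of
degree `2` on a (`ℤ`-)graded associative unital `R`-algebra `E = ⨁ ℰ i`. -/
structure CDGStructure {R : Type*} [CommRing R] {E : Type u} [Ring E] [Algebra R E]
    (ℰ : ℤ → Submodule R E) [GradedAlgebra ℰ] where
  /-- the predifferential -/
  d : E →ₗ[R] E
  d_mem : ∀ {i : ℤ} {a : E}, a ∈ ℰ i → d a ∈ ℰ (i + 1)
  leibniz : ∀ {i : ℤ} {a : E} (b : E), a ∈ ℰ i →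
    d (a * b) = d a * b + i.negOnePow • (a * d b)
  /-- the curvature -/
  curv : E
  curv_mem : curv ∈ ℰ 2
  d_curv : d curv = 0
  d_d : ∀ a : E, d (d a) = curv * a - a * curv

section Algebra

variable {R : Type*} [CommRing R] {E : Type u} [Ring E] [Algebra R E]
  {ℰ : ℤ → Submodule R E} [GradedAlgebra ℰ]

/-- Multiplication of homogeneous elements. -/
def gmul {i j l : ℤ} (h : i + j = l) (a : ℰ i) (b : ℰ j) : ℰ l :=
  ⟨a.1 * b.1, h ▸ SetLike.mul_mem_graded a.2 b.2⟩

variable (ℰ) in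
/-- The image of a scalar, as a homogeneous element of degree `0`. -/
def scalar (r : R) : ℰ 0 := ⟨algebraMap R E r, SetLike.algebraMap_mem_graded ℰ r⟩

variable (ℰ) in
/-- The unit, as a homogeneous element of degree `0`. -/
def gone : ℰ 0 := ⟨1, SetLike.one_mem_graded ℰ⟩

/-- The predifferential on homogeneous elements. -/
def CDGStructure.dEl (D : CDGStructure ℰ) {i j : ℤ} (h : i + 1 = j) : ℰ i →ₗ[R] ℰ j where
  toFun a := ⟨D.d a.1, h ▸ D.d_mem a.2⟩
  map_add' a b := Subtype.ext (by simp)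
  map_smul' r a := Subtype.ext (by simp)

/-- The curvature as a homogeneous element of degree `2`. -/
def CDGStructure.curvEl (D : CDGStructure ℰ) : ℰ 2 := ⟨D.curv, D.curv_mem⟩

end Algebra

/-! ### Left and right cdg modules -/

section Modules

variable {R : Type*} [CommRing R] {E : Type u} [Ring E] [Algebra R E]
  {ℰ : ℤ → Submodule R E} [GradedAlgebra ℰ]

/-- A left cdg module: a graded left module `X` with an action `act : ℰ i × X j → X (i + j)` and a
derivation `d` of degree `1` such that `d² m = c m`. (The `R`-linear structure is the one
obtained by restriction along `R → ℰ 0`, and `d` is automatically `R`-linear.) -/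
structure LeftCDGModule (D : CDGStructure ℰ) where
  X : ℤ → Type u
  [grp : ∀ i, AddCommGroup (X i)]
  act : ∀ {i j l : ℤ}, i + j = l → ℰ i → X j → X l
  add_act : ∀ {i j l : ℤ} (h : i + j = l) (a b : ℰ i) (m : X j),
    act h (a + b) m = act h a m + act h b m
  act_add : ∀ {i j l : ℤ} (h : i + j = l) (a : ℰ i) (m m' : X j),
    act h a (m + m') = act h a m + act h a m'
  one_act : ∀ {j : ℤ} (h : 0 + j = j) (m : X j), act h (gone ℰ) m = m
  mul_act : ∀ {i j l ij jl s : ℤ} (hij : i + j = ij) (hjl : j + l = jl) (h : ij + l = s)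
    (h' : i + jl = s) (a : ℰ i) (b : ℰ j) (m : X l),
    act h (gmul hij a b) m = act h' a (act hjl b m)
  d : ∀ {i j : ℤ}, i + 1 = j → (X i →+ X j)
  leibniz : ∀ {i j l i' j' l' : ℤ} (h : i + j = l) (hi : i + 1 = i') (hj : j + 1 = j')
    (hl : l + 1 = l') (h₁ : i' + j = l') (h₂ : i + j' = l') (a : ℰ i) (m : X j),
    d hl (act h a m) = act h₁ (D.dEl hi a) m + i.negOnePow • act h₂ a (d hj m)
  d_d : ∀ {i j l : ℤ} (hi : i + 1 = j) (hj : j + 1 = l) (h : 2 + i = l) (m : X i),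
    d hj (d hi m) = act h D.curvEl m

attribute [instance] LeftCDGModule.grp

/-- A right cdg module: a graded right module with a derivation `d` of degree `1` such that
`d² m = - m c`. -/
structure RightCDGModule (D : CDGStructure ℰ) where
  X : ℤ → Type u
  [grp : ∀ i, AddCommGroup (X i)]
  act : ∀ {i j l : ℤ}, i + j = l → X i → ℰ j → X l
  add_act : ∀ {i j l : ℤ} (h : i + j = l) (m m' : X i) (a : ℰ j),
    act h (m + m') a = act h m a + act h m' a
  act_add : ∀ {i j l : ℤ} (h : i + j = l) (m : X i) (a b : ℰ j),
    act h m (a + b) = act h m a + act h m b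
  act_one : ∀ {i : ℤ} (h : i + 0 = i) (m : X i), act h m (gone ℰ) = m
  act_mul : ∀ {i j l ij jl s : ℤ} (hij : i + j = ij) (hjl : j + l = jl) (h : i + jl = s)
    (h' : ij + l = s) (m : X i) (a : ℰ j) (b : ℰ l),
    act h m (gmul hjl a b) = act h' (act hij m a) b
  d : ∀ {i j : ℤ}, i + 1 = j → (X i →+ X j)
  leibniz : ∀ {i j l i' j' l' : ℤ} (h : i + j = l) (hi : i + 1 = i') (hj : j + 1 = j')
    (hl : l + 1 = l') (h₁ : i' + j = l') (h₂ : i + j' = l') (m : X i) (a : ℰ j),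
    d hl (act h m a) = act h₁ (d hi m) a + i.negOnePow • act h₂ m (D.dEl hj a)
  d_d : ∀ {i j l : ℤ} (hi : i + 1 = j) (hj : j + 1 = l) (h : i + 2 = l) (m : X i),
    d hj (d hi m) = - act h m D.curvEl

attribute [instance] RightCDGModule.grp

variable {D : CDGStructure ℰ}

namespace LeftCDGModule

/-- The action of a fixed homogeneous element, as an additive map. -/
def actHom (M : LeftCDGModule D) {i j l : ℤ} (h : i + j = l) (a : ℰ i) : M.X j →+ M.X l :=
  AddMonoidHom.mk' (M.act h a) (M.act_add h a)

lemma act_zsmul (M : LeftCDGModule D) {i j l : ℤ} (h : i + j = l) (a : ℰ i) (s : ℤˣ)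
    (m : M.X j) : M.act h a (s • m) = s • M.act h a m := by
  exact map_zsmul (M.actHom h a) (s : ℤ) m

lemma act_zero (M : LeftCDGModule D) {i j l : ℤ} (h : i + j = l) (a : ℰ i) :
    M.act h a (0 : M.X j) = 0 := map_zero (M.actHom h a)

lemma act_neg (M : LeftCDGModule D) {i j l : ℤ} (h : i + j = l) (a : ℰ i) (m : M.X j) :
    M.act h a (-m) = - M.act h a m := map_neg (M.actHom h a) m

lemma act_sub (M : LeftCDGModule D) {i j l : ℤ} (h : i + j = l) (a : ℰ i) (m m' : M.X j) :
    M.act h a (m - m') = M.act h a m - M.act h a m' := map_sub (M.actHom h a) m m'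

lemma d_zsmul (M : LeftCDGModule D) {i j : ℤ} (h : i + 1 = j) (s : ℤˣ) (m : M.X i) :
    M.d h (s • m) = s • M.d h m := by
  exact map_zsmul (M.d h) (s : ℤ) m

/-- The identification of equal degrees. -/
def castX (M : LeftCDGModule D) {i j : ℤ} (h : i = j) : M.X i →+ M.X j :=
  h ▸ AddMonoidHom.id (M.X i)

@[simp] lemma castX_rfl (M : LeftCDGModule D) {i : ℤ} (m : M.X i) : M.castX rfl m = m := rfl

/-- The action of a scalar `r : R` in a fixed degree. -/
def smulR (M : LeftCDGModule D) (r : R) (i : ℤ) : M.X i →+ M.X i :=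
  M.actHom (zero_add i) (scalar ℰ r)

/-- Closed morphisms of degree `0`. -/
@[ext]
structure Hom (M N : LeftCDGModule D) where
  f : ∀ i, M.X i →+ N.X i
  map_act : ∀ {i j l : ℤ} (h : i + j = l) (a : ℰ i) (m : M.X j),
    f l (M.act h a m) = N.act h a (f j m)
  map_d : ∀ {i j : ℤ} (h : i + 1 = j) (m : M.X i), f j (M.d h m) = N.d h (f i m)

/-- The underlying category of the dg category of left cdg modules: morphisms are the closed
morphisms of degree `0`. -/
instance : Category (LeftCDGModule D) where
  Hom := Hom
  id M := ⟨fun i => AddMonoidHom.id _, fun _ _ _ => rfl, fun _ _ => rfl⟩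
  comp f g := ⟨fun i => (g.f i).comp (f.f i), fun h a m => by simp [f.map_act, g.map_act],
    fun h m => by simp [f.map_d, g.map_d]⟩

variable {M N P : LeftCDGModule D}

@[ext]
lemma hom_ext {f g : M ⟶ N} (h : ∀ i m, Hom.f f i m = Hom.f g i m) : f = g :=
  Hom.ext (funext fun i => AddMonoidHom.ext (h i))

@[simp] lemma id_f (i : ℤ) (m : M.X i) : Hom.f (𝟙 M) i m = m := rfl

@[simp] lemma comp_f (f : M ⟶ N) (g : N ⟶ P) (i : ℤ) (m : M.X i) :
    Hom.f (f ≫ g) i m = Hom.f g i (Hom.f f i m) := rfl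

instance : Add (M ⟶ N) :=
  ⟨fun f g => ⟨fun i => Hom.f f i + Hom.f g i,
    fun h a m => by simp [f.map_act, g.map_act, N.act_add],
    fun h m => by simp [f.map_d, g.map_d]⟩⟩

instance : Zero (M ⟶ N) :=
  ⟨⟨fun i => 0, fun h a m => by simp [N.act_zero], fun h m => by simp⟩⟩

instance : Neg (M ⟶ N) :=
  ⟨fun f => ⟨fun i => - Hom.f f i, fun h a m => by simp [f.map_act, N.act_neg],
    fun h m => by simp [f.map_d]⟩⟩

@[simp] lemma add_f (f g : M ⟶ N) (i : ℤ) (m : M.X i) :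
    Hom.f (f + g) i m = Hom.f f i m + Hom.f g i m := rfl

@[simp] lemma zero_f (i : ℤ) (m : M.X i) : Hom.f (0 : M ⟶ N) i m = 0 := rfl

@[simp] lemma neg_f (f : M ⟶ N) (i : ℤ) (m : M.X i) : Hom.f (-f) i m = - Hom.f f i m := rfl

instance : AddCommGroup (M ⟶ N) where
  add_assoc f g h := by ext; simp [add_assoc]
  zero_add f := by ext; simp
  add_zero f := by ext; simp
  add_comm f g := by ext; simp [add_comm]
  neg_add_cancel f := by ext; simp
  nsmul := nsmulRec
  zsmul := zsmulRec

instance : Preadditive (LeftCDGModule D) where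
  add_comp _ _ _ f g h := by ext; simp
  comp_add _ _ _ f g h := by ext; simp

/-- Two closed morphisms are homotopic if their difference is the differential `d h + h d` of a
morphism `h` of degree `-1`, that is, `h (a m) = (-1)^|a| a h(m)`. -/
def Homotopic (f g : M ⟶ N) : Prop :=
  ∃ h : ∀ {i j : ℤ}, j + 1 = i → (M.X i →+ N.X j),
    (∀ {i j l j' l' : ℤ} (hl : i + j = l) (hj : j' + 1 = j) (hl' : l' + 1 = l) (e : i + j' = l')
      (a : ℰ i) (m : M.X j), h hl' (M.act hl a m) = i.negOnePow • N.act e a (h hj m)) ∧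
    ∀ {i j l : ℤ} (hi : i + 1 = j) (hj : l + 1 = i) (m : M.X i),
      Hom.f f i m - Hom.f g i m = N.d hj (h hj m) + h hi (M.d hi m)

variable (D) in
/-- The homotopy relation on closed morphisms. -/
def homotopyRel : HomRel (LeftCDGModule D) := fun _ _ f g => Homotopic f g

lemma Homotopic.refl (f : M ⟶ N) : Homotopic f f :=
  ⟨fun _ => 0, fun _ _ _ e a m => by simp [N.act_zero], fun _ _ m => by simp⟩

lemma Homotopic.symm {f g : M ⟶ N} : Homotopic f g → Homotopic g f := by
  rintro ⟨h, h₁, h₂⟩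
  refine ⟨fun e => - h e, fun hl hj hl' e a m => ?_, fun hi hj m => ?_⟩
  · simp [h₁ hl hj hl' e a m, N.act_neg]
  · rw [← neg_sub, h₂ hi hj m]
    simp [add_comm]

lemma Homotopic.add {f g f' g' : M ⟶ N} : Homotopic f g → Homotopic f' g' →
    Homotopic (f + f') (g + g') := by
  rintro ⟨h, h₁, h₂⟩ ⟨k, k₁, k₂⟩
  refine ⟨fun e => h e + k e, fun hl hj hl' e a m => ?_, fun hi hj m => ?_⟩
  · simp [h₁ hl hj hl' e a m, k₁ hl hj hl' e a m, N.act_add]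
  · simp only [add_f, AddMonoidHom.add_apply, map_add]
    rw [add_sub_add_comm, h₂ hi hj m, k₂ hi hj m]
    abel

lemma Homotopic.trans {f g k : M ⟶ N} (h₁ : Homotopic f g) (h₂ : Homotopic g k) :
    Homotopic f k := by
  have := (h₁.add h₂).add (Homotopic.refl (-g))
  rwa [show f + g + -g = f by abel, show g + k + -g = k by abel] at this

instance : Congruence (homotopyRel D) where
  equivalence := ⟨Homotopic.refl, Homotopic.symm, Homotopic.trans⟩
  comp_left := by
    rintro M N P f g g' ⟨h, h₁, h₂⟩
    refine ⟨fun e => (h e).comp (Hom.f f _), fun hl hj hl' e a m => ?_, fun hi hj m => ?_⟩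
    · simp [f.map_act, h₁ hl hj hl' e a]
    · simp [h₂ hi hj, f.map_d]
  comp_right := by
    rintro M N P f f' g ⟨h, h₁, h₂⟩
    refine ⟨fun e => (Hom.f g _).comp (h e), fun hl hj hl' e a m => ?_, fun hi hj m => ?_⟩
    · simp [h₁ hl hj hl' e a, Units.smul_def, g.map_act]
    · simp [← map_sub, h₂ hi hj, g.map_d]

variable (D) in
/-- The homotopy category: closed morphisms of degree `0` modulo homotopy. -/
abbrev Hot := Quotient (homotopyRel D)

/-- The image of a cdg module in the homotopy category. -/
abbrev toHot (M : LeftCDGModule D) : Hot D := (Quotient.functor (homotopyRel D)).obj M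

instance : Preadditive (Hot D) :=
  Quotient.preadditive _ (fun _ _ _ _ _ _ h h' => Homotopic.add h h')

/-- The shift `M[s]`: one has `M[s]^i = M^{i+s}`, with predifferential `(-1)^s d` and action
`(a, m) ↦ (-1)^(s|a|) a m`. -/
def shift (M : LeftCDGModule D) (s : ℤ) : LeftCDGModule D where
  X i := M.X (i + s)
  act {i j l} h a m := (s * i).negOnePow • M.act (by omega : i + (j + s) = l + s) a m
  add_act h a b m := by simp [M.add_act]
  act_add h a m m' := by simp [M.act_add]
  one_act h m := by simp [M.one_act]
  mul_act {i j l ij jl t} hij hjl h h' a b m := by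
    subst hij
    simp only [M.act_zsmul, smul_smul]
    rw [M.mul_act rfl (by omega : j + (l + s) = jl + s) (by omega) (by omega), mul_add,
      Int.negOnePow_add]
  d {i j} h := s.negOnePow • M.d (by omega : (i + s) + 1 = j + s)
  leibniz {i j l i' j' l'} h hi hj hl h₁ h₂ a m := by
    subst hi
    simp only [AddMonoidHom.smul_apply, M.d_zsmul, M.act_zsmul]
    rw [M.leibniz (by omega) rfl (by omega : j + s + 1 = j' + s) (by omega)
      (by omega : i + 1 + (j + s) = l' + s) (by omega : i + (j' + s) = l' + s)]
    simp only [smul_add, smul_smul, mul_add, mul_one, Int.negOnePow_add]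
    congr 2
    · exact mul_comm _ _
    · ac_rfl
  d_d {i j l} hi hj h m := by
    simp only [AddMonoidHom.smul_apply, M.d_zsmul, smul_smul, Int.units_mul_self, one_smul]
    rw [M.d_d _ _ (by omega), mul_comm s 2, Int.negOnePow_two_mul, one_smul]

/-- The cone of a closed morphism `f : M → N`: one has `Cone(f)^i = N^i ⊕ M^{i+1}`, with
predifferential `(n, m) ↦ (d n + f m, - d m)` and action `a (n, m) = (a n, (-1)^|a| a m)`. -/
def cone (f : M ⟶ N) : LeftCDGModule D where
  X i := N.X i × M.X (i + 1)
  act {i j l} h a m :=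
    (N.act h a m.1, i.negOnePow • M.act (by omega : i + (j + 1) = l + 1) a m.2)
  add_act h a b m := by simp [M.add_act, N.add_act]
  act_add h a m m' := by simp [M.act_add, N.act_add]
  one_act h m := by simp [M.one_act, N.one_act]
  mul_act {i j l ij jl t} hij hjl h h' a b m := by
    subst hij
    simp only [M.act_zsmul, smul_smul]
    rw [M.mul_act rfl (by omega : j + (l + 1) = jl + 1) (by omega) (by omega),
      Int.negOnePow_add, N.mul_act rfl hjl _ h']
  d {i j} h := AddMonoidHom.mk'
    (fun x => (N.d h x.1 + Hom.f f j (M.castX h x.2),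
      - M.d (by omega : (i + 1) + 1 = j + 1) x.2))
    (fun x y => by ext <;> simp <;> abel)
  leibniz {i j l i' j' l'} h hi hj hl h₁ h₂ a m := by
    subst h hi hj hl
    simp only [AddMonoidHom.mk'_apply]
    refine Prod.ext ?_ ?_
    · simp only [Prod.fst_add, Prod.smul_fst, N.act_add, smul_add]
      rw [N.leibniz rfl rfl rfl rfl h₁ h₂]
      simp only [castX_rfl, Units.smul_def, map_zsmul, f.map_act]
      abel
    · simp only [Prod.snd_add, Prod.smul_snd, M.act_neg, M.d_zsmul, smul_neg]
      rw [M.leibniz (by omega) rfl rfl (by omega) (by omega : i + 1 + (j + 1) = i + j + 1 + 1)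
        (by omega : i + (j + 1 + 1) = i + j + 1 + 1)]
      simp [Int.negOnePow_succ, smul_smul, add_comm]
  d_d {i j l} hi hj h m := by
    subst hi hj
    simp only [AddMonoidHom.mk'_apply]
    refine Prod.ext ?_ ?_
    · simp [N.d_d _ _ h, f.map_d]
    · simp only [map_neg, neg_neg]
      rw [M.d_d _ _ (by omega)]
      simp [Int.negOnePow_even 2 (by decide)]

/-- The product of a family of cdg modules, taken degreewise. -/
def prod {ι : Type u} (M : ι → LeftCDGModule D) : LeftCDGModule D where
  X i := ∀ k, (M k).X i
  act h a m := fun k => (M k).act h a (m k)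
  add_act h a b m := by funext k; exact (M k).add_act h a b _
  act_add h a m m' := by funext k; exact (M k).act_add h a _ _
  one_act h m := by funext k; exact (M k).one_act h _
  mul_act hij hjl h h' a b m := by funext k; exact (M k).mul_act hij hjl h h' a b _
  d h := AddMonoidHom.mk' (fun m k => (M k).d h (m k)) (fun m m' => by funext k; simp)
  leibniz h hi hj hl h₁ h₂ a m := by funext k; exact (M k).leibniz h hi hj hl h₁ h₂ a _
  d_d hi hj h m := by funext k; exact (M k).d_d hi hj h _

end LeftCDGModule

namespace RightCDGModule

/-- The action of a fixed homogeneous element, as an additive map. -/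
def actHom (M : RightCDGModule D) {i j l : ℤ} (h : i + j = l) (a : ℰ j) : M.X i →+ M.X l :=
  AddMonoidHom.mk' (fun m => M.act h m a) (fun m m' => M.add_act h m m' a)

/-- Precomposition of a character with an additive map, up to a sign. -/
def dualMap {X Y : Type u} [AddCommGroup X] [AddCommGroup Y] (s : ℤˣ) (f : X →+ Y) :
    CharacterModule Y →+ CharacterModule X where
  toFun η := s • AddMonoidHom.comp η f
  map_zero' := by ext m; exact smul_zero s
  map_add' η η' := by ext m; exact smul_add s _ _

lemma dualMap_apply {X Y : Type u} [AddCommGroup X] [AddCommGroup Y] (s : ℤˣ) (f : X →+ Y)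
    (η : CharacterModule Y) (m : X) : dualMap s f η m = s • η (f m) := rfl

lemma character_zsmul {X : Type u} [AddCommGroup X] (η : CharacterModule X) (s : ℤˣ) (m : X) :
    η (s • m) = s • η m := map_zsmul η (s : ℤ) m

lemma smul_character {X : Type u} [AddCommGroup X] (η : CharacterModule X) (s : ℤˣ) (m : X) :
    (s • η) m = s • η m := rfl

lemma add_character {X : Type u} [AddCommGroup X] (η η' : CharacterModule X) (m : X) :
    (η + η') m = η m + η' m := rfl

/-- The linear dual `M^∨ = Hom_ℤ(M, ℚ/ℤ)` of a right cdg module: `(M^∨)^i = Hom_ℤ(M^{-i}, ℚ/ℤ)`,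
with predifferential `(d η)(m) = -(-1)^|η| η(d m)` and action `(a η)(m) = (-1)^|a| η(m a)` (the
Koszul sign `(-1)^{|a| (|η| + |m|)}`, where `|a| + |η| + |m| = 0`). -/
def dual (M : RightCDGModule D) : LeftCDGModule D where
  X i := CharacterModule (M.X (-i))
  act {i j l} h a η := dualMap i.negOnePow (M.actHom (by omega : -l + i = -j) a) η
  add_act h a b η := by
    ext m
    simp only [dualMap_apply, add_character, ← smul_add, ← map_add]
    exact congrArg (fun x => _ • η x) (M.act_add _ m a b)
  act_add h a m m' := map_add _ _ _
  one_act h η := by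
    ext m
    simp only [dualMap_apply, Int.negOnePow_zero, one_smul]
    exact congrArg η (M.act_one _ m)
  mul_act {i j l ij jl s} hij hjl h h' a b η := by
    subst hij
    ext m
    simp only [dualMap_apply, smul_smul, Int.negOnePow_add]
    exact congrArg (fun x => _ • η x)
      (M.act_mul (by omega : -s + i = -jl) rfl (by omega) (by omega) m a b)
  d {i j} h := dualMap (-i.negOnePow) (M.d (by omega : -j + 1 = -i))
  leibniz {i j l i' j' l'} h hi hj hl h₁ h₂ a η := by
    subst hi
    ext m
    simp only [dualMap_apply, add_character, smul_character, actHom, AddMonoidHom.mk'_apply]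
    rw [M.leibniz (by omega : -l' + i = -j') (by omega : -l' + 1 = -l) rfl (by omega)
      (by omega) (by omega), map_add, character_zsmul]
    obtain rfl : l' = i + j + 1 := by omega
    obtain rfl : l = i + j := by omega
    simp only [smul_add, smul_smul, Int.negOnePow_neg, Int.negOnePow_add]
    rcases Int.units_eq_one_or i.negOnePow with hi' | hi' <;>
      rcases Int.units_eq_one_or j.negOnePow with hj' | hj' <;>
      simp [hi', hj']
  d_d {i j l} hi hj h η := by
    subst hi
    ext m
    simp only [dualMap_apply, actHom, AddMonoidHom.mk'_apply]
    rw [M.d_d (by omega) (by omega) (by omega : -l + 2 = -i), map_neg]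
    simp [Int.negOnePow_succ, smul_smul, Int.negOnePow_even 2 (by decide)]

end RightCDGModule

end Modules

/-! ### The right modules `D_i` -/

section Generators

variable {R : Type*} [CommRing R] {E : Type u} [Ring E] [Algebra R E]
  {ℰ : ℤ → Submodule R E} [GradedAlgebra ℰ]

variable (ℰ) in
/-- The degree `j` part of the graded module `E / r E`. -/
abbrev quo (r : R) (j : ℤ) : Type u := ℰ j ⧸ LinearMap.range (LinearMap.lsmul R (ℰ j) r)

/-- The class in `E / r E` of a homogeneous element. -/
abbrev quoMk (r : R) {j : ℤ} (a : ℰ j) : quo ℰ r j := Submodule.Quotient.mk a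

/-- The map `E / r E → E / s E` induced by `a ↦ q (f a)` for a linear map `f` and a scalar `q` with
`s ∣ q r`. -/
def quoMap {r s : R} (q : R) (h : s ∣ q * r) {i j : ℤ} (f : ℰ i →ₗ[R] ℰ j) :
    quo ℰ r i →ₗ[R] quo ℰ s j :=
  Submodule.mapQ _ _ (q • f) (by
    rintro _ ⟨x, rfl⟩
    obtain ⟨p, hp⟩ := h
    refine ⟨p • f x, ?_⟩
    simp [smul_smul, mul_comm r q, hp, mul_comm p s])

/-- Right multiplication by a homogeneous element. -/
def rmul {i j l : ℤ} (h : i + j = l) (b : ℰ j) : ℰ i →ₗ[R] ℰ l where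
  toFun a := gmul h a b
  map_add' a a' := Subtype.ext (by simp [gmul, add_mul])
  map_smul' r a := Subtype.ext (by simp [gmul])

/-- Left multiplication by a homogeneous element. -/
def lmul {i j l : ℤ} (h : i + j = l) (a : ℰ i) : ℰ j →ₗ[R] ℰ l where
  toFun b := gmul h a b
  map_add' b b' := Subtype.ext (by simp [gmul, mul_add])
  map_smul' r b := Subtype.ext (by simp [gmul])

/-- The identification of equal degrees. -/
def castEl {i j : ℤ} (h : i = j) : ℰ i →ₗ[R] ℰ j where
  toFun a := ⟨a.1, h ▸ a.2⟩
  map_add' _ _ := rfl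
  map_smul' _ _ := rfl

/-- Let `c = t c'`, with `d c'` divisible by `t^m`, and `A_i = E / t^{i+1} E`. This is the right cdg
module `A_m ⊕ A_{m-1}[1]` twisted by the matrix with entries `t : A_{m-1} → A_m` and
`α ↦ - π(c' α) : A_m → A_{m-1}`, that is, with predifferential
`d (α, a) = (d α + t a, - d a - π(c' α))`. -/
def twistedRight (D : CDGStructure ℰ) (t : R) (c' : ℰ 2) (hc : t • (c' : E) = D.curv) (m : ℕ)
    (hd : ∃ y : ℰ 3, D.d c' = t ^ m • (y : E)) : RightCDGModule D where
  X j := quo ℰ (t ^ (m + 1)) j × quo ℰ (t ^ m) (j + 1)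
  act {i j l} h x b :=
    (quoMap 1 (by simp) (rmul h b) x.1,
      quoMap 1 (by simp) (rmul (by omega : i + 1 + j = l + 1) b) x.2)
  add_act h x y b := by simp
  act_add {i j l} h x a b := by
    obtain ⟨⟨x⟩, ⟨y⟩⟩ := x
    exact Prod.ext (congrArg (quoMk _) (Subtype.ext (by simp [rmul, gmul, mul_add])))
      (congrArg (quoMk _) (Subtype.ext (by simp [rmul, gmul, mul_add])))
  act_one {i} h x := by
    obtain ⟨⟨x⟩, ⟨y⟩⟩ := x
    exact Prod.ext (congrArg (quoMk _) (Subtype.ext (by simp [rmul, gmul, gone])))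
      (congrArg (quoMk _) (Subtype.ext (by simp [rmul, gmul, gone])))
  act_mul {i j l ij jl s} hij hjl h h' x a b := by
    obtain ⟨⟨x⟩, ⟨y⟩⟩ := x
    exact Prod.ext (congrArg (quoMk _) (Subtype.ext (by simp [rmul, gmul, mul_assoc])))
      (congrArg (quoMk _) (Subtype.ext (by simp [rmul, gmul, mul_assoc])))
  d {i j} h := AddMonoidHom.mk'
    (fun x => (quoMap 1 (by simp) (D.dEl h) x.1 + quoMap t (by rw [pow_succ']) (castEl h) x.2,
      - quoMap 1 (by simp) (D.dEl (by omega : i + 1 + 1 = j + 1)) x.2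
        - quoMap 1 (by simp [pow_succ]) (lmul (by omega : 2 + i = j + 1) c') x.1))
    (fun x y => by ext <;> simp <;> abel)
  leibniz {i j l i' j' l'} h hi hj hl h₁ h₂ x a := by
    obtain ⟨⟨x⟩, ⟨y⟩⟩ := x
    refine Prod.ext (congrArg (quoMk _) (Subtype.ext ?_)) (congrArg (quoMk _) (Subtype.ext ?_))
    · rcases Int.units_eq_one_or i.negOnePow with e | e <;>
        simp [rmul, gmul, castEl, CDGStructure.dEl, D.leibniz _ x.2, add_mul, e] <;> abel
    · rcases Int.units_eq_one_or i.negOnePow with e | e <;>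
        simp [rmul, gmul, lmul, CDGStructure.dEl, D.leibniz _ y.2, Int.negOnePow_succ, sub_mul,
          mul_assoc, e] <;> abel
  d_d {i j l} hi hj h x := by
    obtain ⟨⟨x⟩, ⟨y⟩⟩ := x
    refine Prod.ext (congrArg (quoMk _) (Subtype.ext ?_)) ?_
    · simp [rmul, gmul, lmul, castEl, CDGStructure.dEl, CDGStructure.curvEl, D.d_d, smul_sub, ← hc]
      abel
    · obtain ⟨z, hz⟩ := hd
      refine (Submodule.Quotient.eq _).2 ⟨gmul (by omega) z x, Subtype.ext ?_⟩
      simp [rmul, gmul, lmul, castEl, CDGStructure.dEl, CDGStructure.curvEl, D.d_d, D.leibniz _ c'.2, Int.negOnePow_even 2 (by decide), ← hc, hz, mul_add]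
      abel

end Generators

/-! ### Acyclicity of the associated graded -/

namespace LeftCDGModule

variable {R : Type*} [CommRing R] {E : Type u} [Ring E] [Algebra R E]
  {ℰ : ℤ → Submodule R E} [GradedAlgebra ℰ] {D : CDGStructure ℰ}

lemma d_smulR (M : LeftCDGModule D) (r : R) {i j : ℤ} (h : i + 1 = j) (m : M.X i) :
    M.d h (M.smulR r i m) = M.smulR r j (M.d h m) := by
  have h1 : D.d 1 = 0 := by
    have := D.leibniz 1 (SetLike.one_mem_graded ℰ)
    simpa using this
  have h0 : D.dEl rfl (scalar ℰ r) = 0 :=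
    Subtype.ext (by simp [CDGStructure.dEl, scalar, Algebra.algebraMap_eq_smul_one, h1])
  have hz : M.act (by omega : 0 + 1 + i = j) (0 : ℰ (0 + 1)) m = 0 := by
    have := M.add_act (by omega : 0 + 1 + i = j) 0 0 m
    simpa using this
  have := M.leibniz (zero_add i) rfl h h (by omega) (zero_add j) (scalar ℰ r) m
  rw [h0, hz] at this
  simpa [smulR, actHom] using this

/-- The degree `j` part of the submodule `r M`, for a scalar `r`. -/
def smulRange (M : LeftCDGModule D) (r : R) (j : ℤ) : AddSubgroup (M.X j) := (M.smulR r j).range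

/-- The predifferential of the submodule `r M`. -/
def smulRangeD (M : LeftCDGModule D) (r : R) {j l : ℤ} (h : j + 1 = l) :
    M.smulRange r j →+ M.smulRange r l :=
  ((M.d h).comp (M.smulRange r j).subtype).codRestrict (M.smulRange r l) (by
    rintro ⟨_, x, rfl⟩
    exact ⟨M.d h x, (M.d_smulR r h x).symm⟩)

/-- The degree `j` part of `Gr_t^i(M) = t^i M / t^{i+1} M`. -/
abbrev gr (M : LeftCDGModule D) (t : R) (i : ℕ) (j : ℤ) : Type u :=
  M.smulRange (t ^ i) j ⧸ (M.smulRange (t ^ (i + 1)) j).addSubgroupOf (M.smulRange (t ^ i) j)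

/-- The differential of `Gr_t^i(M) = t^i M / t^{i+1} M`. -/
def grD (M : LeftCDGModule D) (t : R) (i : ℕ) {j l : ℤ} (h : j + 1 = l) :
    M.gr t i j →+ M.gr t i l :=
  QuotientAddGroup.map _ _ (M.smulRangeD (t ^ i) h) (by
    rintro ⟨x, hx⟩ ⟨y, hy⟩
    exact ⟨M.d h y, by rw [← M.d_smulR, hy]; rfl⟩)

/-- `M` is `n`-acyclic (with respect to `t`) if `Gr_t^0(M), …, Gr_t^n(M)` are acyclic. -/
def IsNAcyclic (t : R) (n : ℕ) (M : LeftCDGModule D) : Prop :=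
  ∀ i : ℕ, i ≤ n → ∀ {j l s : ℤ} (h : j + 1 = l) (h' : l + 1 = s),
    Function.Exact (M.grD t i h) (M.grD t i h')

variable (D) in
/-- The full subcategory `Ac^n` of the homotopy category, consisting of the `n`-acyclic modules. -/
def acyclic (t : R) (n : ℕ) : ObjectProperty (Hot D) := fun M => M.as.IsNAcyclic t n

variable (D) in
/-- The class of the morphisms in the homotopy category whose cone is `n`-acyclic. -/
def quasiIso (t : R) (n : ℕ) : MorphismProperty (Hot D) := fun M N f =>
  ∃ φ : M.as ⟶ N.as, (Quotient.functor (homotopyRel D)).map φ = f ∧ (cone φ).IsNAcyclic t n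

/-- A full subcategory of the homotopy category is (strictly full) triangulated if it contains `0`
and is closed under isomorphisms, shifts, and cones. -/
structure IsTriangulatedSubcategory (P : ObjectProperty (Hot D)) : Prop where
  zero : ∀ M : Hot D, Limits.IsZero M → P M
  iso : ∀ {M N : Hot D}, (M ≅ N) → P M → P N
  shift : ∀ (M : LeftCDGModule D) (s : ℤ), P (toHot M) → P (toHot (M.shift s))
  cone : ∀ {M N : LeftCDGModule D} (f : M ⟶ N), P (toHot M) → P (toHot N) → P (toHot (cone f))

/-- Closure under small products. -/
def IsClosedUnderProd (P : ObjectProperty (Hot D)) : Prop :=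
  ∀ (ι : Type u) (M : ι → LeftCDGModule D), (∀ k, P (toHot (M k))) → P (toHot (prod M))

end LeftCDGModule

/-! ### Deformations -/

/-- The ring `R_n = k[t]/(t^{n+1})`. -/
abbrev TruncPoly (k : Type w) [CommRing k] (n : ℕ) : Type w :=
  AdjoinRoot ((Polynomial.X : Polynomial k) ^ (n + 1))

/-- The class of `t` in `k[t]/(t^{n+1})`. -/
noncomputable abbrev tt (k : Type w) [CommRing k] (n : ℕ) : TruncPoly k n :=
  AdjoinRoot.root ((Polynomial.X : Polynomial k) ^ (n + 1))

open TensorProduct in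
/-- Let `A = ⨁ 𝒜 i` be a dg algebra over `k`. A cdg deformation of order `n` of `A` is a cdg algebra
`E = ⨁ ℰ i` over `R_n = k[t]/(t^{n+1})` whose underlying graded `R_n`-module is identified, by `e`,
with `R_n ⊗ A`, and whose structure (product, unit, predifferential, curvature) reduces to that of
`A` modulo `t`. -/
structure CDGDeformation {k : Type w} [CommRing k] {A : Type v} [Ring A] [Algebra k A]
    {𝒜 : ℤ → Submodule k A} [GradedAlgebra 𝒜] (DA : CDGStructure 𝒜) (n : ℕ)
    {E : Type u} [Ring E] [Algebra (TruncPoly k n) E] {ℰ : ℤ → Submodule (TruncPoly k n) E}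
    [GradedAlgebra ℰ] (DE : CDGStructure ℰ) where
  e : (TruncPoly k n ⊗[k] A) ≃ₗ[TruncPoly k n] E
  map_mem : ∀ {i : ℤ} {a : A}, a ∈ 𝒜 i → e (1 ⊗ₜ a) ∈ ℰ i
  red_mul : ∀ a b : A, ∃ y : E, e (1 ⊗ₜ a) * e (1 ⊗ₜ b) = e (1 ⊗ₜ (a * b)) + tt k n • y
  red_one : ∃ y : E, 1 = e (1 ⊗ₜ 1) + tt k n • y
  red_d : ∀ a : A, ∃ y : E, DE.d (e (1 ⊗ₜ a)) = e (1 ⊗ₜ (DA.d a)) + tt k n • y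
  red_curv : ∃ y : E, DE.curv = e (1 ⊗ₜ DA.curv) + tt k n • y

namespace CDGDeformation

variable {k : Type w} [CommRing k] {A : Type v} [Ring A] [Algebra k A]
    {𝒜 : ℤ → Submodule k A} [GradedAlgebra 𝒜] {DA : CDGStructure 𝒜} {n : ℕ}
    {E : Type u} [Ring E] [Algebra (TruncPoly k n) E] {ℰ : ℤ → Submodule (TruncPoly k n) E}
    [GradedAlgebra ℰ] {DE : CDGStructure ℰ}

open TensorProduct Polynomial in
lemma exists_contraction (k : Type w) [CommRing k] (n : ℕ) :
    ∃ φ s : TruncPoly k n →ₗ[k] TruncPoly k n,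
      ∀ r : TruncPoly k n, r = tt k n ^ n * φ r + s (tt k n * r) := by
  have hm : (X ^ (n + 1) : k[X]).Monic := monic_X_pow _
  cases subsingleton_or_nontrivial k with
  | inl h =>
    have : Subsingleton (AdjoinRoot ((X : k[X]) ^ (n + 1))) :=
      (AdjoinRoot.mk_surjective (g := (X : k[X]) ^ (n + 1))).subsingleton
    exact ⟨0, 0, fun r => Subsingleton.elim _ _⟩
  | inr h =>
    let D : k[X] →ₗ[k] k[X] :=
      { toFun := divX
        map_add' := fun _ _ => divX_add
        map_smul' := fun a p => by
          rw [smul_eq_C_mul, divX_C_mul, RingHom.id_apply, smul_eq_C_mul] }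
    let π : k[X] →ₗ[k] AdjoinRoot ((X : k[X]) ^ (n + 1)) :=
      ((AdjoinRoot.mkₐ ((X : k[X]) ^ (n + 1))).restrictScalars k).toLinearMap
    refine ⟨π ∘ₗ monomial 0 ∘ₗ lcoeff k n ∘ₗ AdjoinRoot.modByMonicHom hm,
      π ∘ₗ D ∘ₗ AdjoinRoot.modByMonicHom hm, fun r => ?_⟩
    obtain ⟨p, rfl, hp⟩ : ∃ p : k[X], AdjoinRoot.mk _ p = r ∧ p.degree < (n + 1 : ℕ) :=
      ⟨_, AdjoinRoot.mk_leftInverse hm r, by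
        obtain ⟨q, rfl⟩ := AdjoinRoot.mk_surjective r
        simpa using degree_modByMonic_lt q hm⟩
    have h1 : p %ₘ X ^ (n + 1) = p := (modByMonic_eq_self_iff hm).2 (by simpa using hp)
    have h2 : (X * p) %ₘ X ^ (n + 1) = X * p - X ^ (n + 1) * C (p.coeff n) := by
      refine (div_modByMonic_unique (C (p.coeff n)) _ hm ⟨by ring, ?_⟩).2
      rw [degree_X_pow, degree_lt_iff_coeff_zero]
      intro m hm'
      obtain ⟨m, rfl⟩ : ∃ l, m = l + 1 := ⟨m - 1, by omega⟩
      rw [degree_lt_iff_coeff_zero] at hp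
      rw [coeff_sub, coeff_X_mul, coeff_mul_C, coeff_X_pow]
      by_cases e : m = n
      · simp [e]
      · simp [e, hp m (by omega)]
    have h3 : divX (X * p - X ^ (n + 1) * C (p.coeff n)) = p - X ^ n * C (p.coeff n) := by
      ext m
      simp [coeff_divX, coeff_X_pow]
    have h4 : AdjoinRoot.root ((X : k[X]) ^ (n + 1)) * AdjoinRoot.mk _ p =
        AdjoinRoot.mk ((X : k[X]) ^ (n + 1)) (X * p) := by simp
    rw [h4]
    simp only [LinearMap.comp_apply, AdjoinRoot.modByMonicHom_mk, h1, h2]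
    change _ = _ * AdjoinRoot.mk _ (monomial 0 (p.coeff n)) + AdjoinRoot.mk _ (divX _)
    rw [h3, map_sub, map_mul, map_pow, AdjoinRoot.mk_X, monomial_zero_left]
    ring

open TensorProduct in
lemma exists_of_smul_eq_zero (B : CDGDeformation DA n DE) {y : E} (hy : tt k n • y = 0) :
    ∃ z : E, y = tt k n ^ n • z := by
  obtain ⟨φ, s, h⟩ := exists_contraction k n
  have key : ∀ y : TruncPoly k n ⊗[k] A,
      y = tt k n ^ n • (φ.rTensor A y) + s.rTensor A (tt k n • y) := by
    intro y
    induction y with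
    | zero => simp
    | tmul r a =>
      simp only [LinearMap.rTensor_tmul, TensorProduct.smul_tmul', smul_eq_mul,
        ← TensorProduct.add_tmul, ← h]
    | add x y hx hy =>
      rw [map_add, smul_add, smul_add, map_add, add_add_add_comm, ← hx, ← hy]
  refine ⟨B.e (φ.rTensor A (B.e.symm y)), ?_⟩
  have hk := key (B.e.symm y)
  rw [← map_smul B.e.symm, hy, map_zero, map_zero, add_zero] at hk
  rw [← map_smul, ← hk, LinearEquiv.apply_symm_apply]

lemma exists_curv_div (B : CDGDeformation DA n DE) (hA : DA.curv = 0) :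
    ∃ c' : ℰ 2, tt k n • (c' : E) = DE.curv := by
  obtain ⟨y, hy⟩ := B.red_curv
  refine ⟨⟨GradedAlgebra.proj ℰ 2 y, SetLike.coe_mem _⟩, ?_⟩
  have : DE.curv = tt k n • y := by simpa [hA] using hy
  have h := congrArg (GradedAlgebra.proj ℰ 2) this
  rw [map_smul] at h
  rw [← h]
  simp [DirectSum.decompose_of_mem_same ℰ DE.curv_mem]

/-- A homogeneous element `c/t` of degree `2` with `t (c/t) = c`. -/
noncomputable def curvDiv (B : CDGDeformation DA n DE) (hA : DA.curv = 0) : ℰ 2 :=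
  (B.exists_curv_div hA).choose

lemma smul_curvDiv (B : CDGDeformation DA n DE) (hA : DA.curv = 0) :
    tt k n • (B.curvDiv hA : E) = DE.curv := (B.exists_curv_div hA).choose_spec

lemma exists_d_curvDiv (B : CDGDeformation DA n DE) (hA : DA.curv = 0) (i : Fin (n + 1)) :
    ∃ y : ℰ 3, DE.d (B.curvDiv hA) = tt k n ^ (i : ℕ) • (y : E) := by
  have h0 : tt k n • DE.d (B.curvDiv hA) = 0 := by
    rw [← map_smul, B.smul_curvDiv, DE.d_curv]
  obtain ⟨z, hz⟩ := B.exists_of_smul_eq_zero h0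
  refine ⟨⟨tt k n ^ (n - i) • GradedAlgebra.proj ℰ 3 z,
    Submodule.smul_mem _ _ (SetLike.coe_mem _)⟩, ?_⟩
  have h := congrArg (GradedAlgebra.proj ℰ 3) hz
  rw [map_smul] at h
  rw [smul_smul, ← pow_add, Nat.add_sub_cancel' (by omega), ← h]
  exact (DirectSum.decompose_of_mem_same ℰ (DE.d_mem (B.curvDiv hA).2)).symm

/-- The right cdg modules `D_0, …, D_n`: here `D_i` is `A_i ⊕ A_{i-1}[1]`, `A_i = E / t^{i+1} E`,
twisted by `t : A_{i-1} → A_i` and (up to sign) left multiplication by `c/t`. -/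
noncomputable def rightGen (B : CDGDeformation DA n DE) (hA : DA.curv = 0) (i : Fin (n + 1)) :
    RightCDGModule DE :=
  twistedRight DE (tt k n) (B.curvDiv hA) (B.smul_curvDiv hA) i (B.exists_d_curvDiv hA i)

/-- The left cdg modules `Γ_i^* = D_i^∨ = Hom_ℤ(D_i, ℚ/ℤ)`. -/
noncomputable def cogen (B : CDGDeformation DA n DE) (hA : DA.curv = 0) (i : Fin (n + 1)) :
    LeftCDGModule DE :=
  (B.rightGen hA i).dual

/-- A left cdg module is `n`-cocell if it lies in the smallest triangulated subcategory of the
homotopy category that contains `Γ_0^*, …, Γ_n^*` and is closed under products. -/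
def IsNCocell (B : CDGDeformation DA n DE) (hA : DA.curv = 0) (M : LeftCDGModule DE) : Prop :=
  ∀ P : ObjectProperty (LeftCDGModule.Hot DE),
    LeftCDGModule.IsTriangulatedSubcategory P → LeftCDGModule.IsClosedUnderProd P →
    (∀ i, P (LeftCDGModule.toHot (B.cogen hA i))) → P (LeftCDGModule.toHot M)

end CDGDeformation

/-- The `n`-derived category: the Verdier quotient of the homotopy category by `Ac^n`, that is, its
localization at the morphisms with `n`-acyclic cone. -/
abbrev NDerived {k : Type w} [CommRing k] {n : ℕ} {E : Type u} [Ring E]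
    [Algebra (TruncPoly k n) E] {ℰ : ℤ → Submodule (TruncPoly k n) E} [GradedAlgebra ℰ]
    (DE : CDGStructure ℰ) :=
  (LeftCDGModule.quasiIso DE (tt k n) n).Localization

/-- The quotient functor from the homotopy category to the `n`-derived category. -/
noncomputable abbrev NDerived.quotientFunctor {k : Type w} [CommRing k] {n : ℕ} {E : Type u} [Ring E]
    [Algebra (TruncPoly k n) E] {ℰ : ℤ → Submodule (TruncPoly k n) E} [GradedAlgebra ℰ]
    (DE : CDGStructure ℰ) : LeftCDGModule.Hot DE ⥤ NDerived DE :=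
  (LeftCDGModule.quasiIso DE (tt k n) n).Q

/-- A cdg module `I` is `n`-homotopy injective if `Hom(N, I) = 0` in the homotopy category for all
`n`-acyclic `N`. -/
abbrev nHomotopyInjective {k : Type w} [CommRing k] {n : ℕ} {E : Type u} [Ring E]
    [Algebra (TruncPoly k n) E] {ℰ : ℤ → Submodule (TruncPoly k n) E} [GradedAlgebra ℰ]
    (DE : CDGStructure ℰ) : ObjectProperty (LeftCDGModule.Hot DE) :=
  (LeftCDGModule.acyclic DE (tt k n) n).rightOrthogonal

end CurvedDG

/-! ### The complex of graded maps between two cdg modules. -/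

namespace CurvedDG

namespace LeftCDGModule

variable {R : Type*} [CommRing R] {E : Type u} [Ring E] [Algebra R E]
  {ℰ : ℤ → Submodule R E} [GradedAlgebra ℰ] {D : CDGStructure ℰ}

/-! Write `TX t i M` for the complex `D_i ⊗ M`: it consists of pairs `(x, y)` with `x` modulo
`t^{i+1}` and `y` modulo `t^i`, and it is a genuine complex because `c = t c'` and `d c'` is
divisible by `t^i`. The proof rests on two facts about it.

The first is that `M` is `n`-acyclic exactly when `D_0 ⊗ M, …, D_n ⊗ M` are all acyclic
(`tExact_of_grExact`, `grExact_of_tExact`). Once `M / tM` is acyclic, every cocycle can be moved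
into the second summand. The acyclicity of `D_i ⊗ M` then amounts to that of `(ker t + t^i M) / t^i
M` (`KerExact`), on which the curvature vanishes because `c z = c' (t z)`. The latter complexes and
the graded pieces `t^i M / t^{i+1} M` control each other by induction on `i`.

The second is tensor-hom duality. Graded maps of degree `s` from `N` to `Γ_i^*` are characters of
the degree `-s` part of `D_i ⊗ N`, and differentials correspond up to sign (`toChar_diff`,
`exists_toChar_eq`). Since `ℚ/ℤ` is an injective cogenerator, closed maps modulo null-homotopic ones
are the dual of the cohomology of `D_i ⊗ N`. Hence the `Γ_i^*` are orthogonal to all `n`-acyclic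
modules, and so are all cocell modules, because orthogonality passes to shifts, cones and products.
Also, a morphism on which every closed map to `Γ_i^*` becomes null-homotopic induces zero on the
cohomology of `D_i ⊗ -`.

Resolutions come from a tower of Adams type. Starting from `F_0 = M` (up to a zero summand), let
`F_{p+1}` be the extension of `F_p` by a product of shifts of the `Γ_i^*` that kills all closed maps
from `F_p` to the `Γ_i^*`. Then `F_p` is the extension of `M` twisted by a degree one map from `M`
to a cocell module `K_p`, and `F_{p+1} → F_p` is zero on the cohomology of every `D_i ⊗ -`.
Therefore `M → K_p` is injective on cohomology for `p ≥ 1`, and `K_{p+1} → K_p` has its image inside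
that of `M`. So the derived limit vanishes, and the homotopy limit `K` of the tower has the
cohomology of `M`, in degrees shifted by one (`tExact_twist_towerLift`). The extension of `M`
twisted by `M → K` is thus `n`-acyclic, and it is, up to a shift, the cone of `M → K[1]`.

The second assertion is then formal: homotopy injective modules are local for the morphisms with
`n`-acyclic cone, and every object has such a morphism to one of them, so the localization is
equivalent to the full subcategory of local objects (`exists_rightAdjoint_of_resolutions`). -/

lemma castX_act (M : LeftCDGModule D) {i j l l' : ℤ} (h : i + j = l) (e : l = l') (a : ℰ i)
    (m : M.X j) : M.castX e (M.act h a m) = M.act (h.trans e) a m := by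
  subst e; rfl

lemma act_castX (M : LeftCDGModule D) {i j j' l : ℤ} (h : i + j' = l) (e : j = j') (a : ℰ i)
    (m : M.X j) : M.act h a (M.castX e m) = M.act (e ▸ h) a m := by
  subst e; rfl

lemma castX_d (M : LeftCDGModule D) {i j j' : ℤ} (h : i + 1 = j) (e : j = j') (m : M.X i) :
    M.castX e (M.d h m) = M.d (h.trans e) m := by
  subst e; rfl

lemma d_castX (M : LeftCDGModule D) {i i' j : ℤ} (h : i' + 1 = j) (e : i = i') (m : M.X i) :
    M.d h (M.castX e m) = M.d (e ▸ h) m := by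
  subst e; rfl

lemma castX_castX (M : LeftCDGModule D) {i j l : ℤ} (e : i = j) (e' : j = l) (m : M.X i) :
    M.castX e' (M.castX e m) = M.castX (e.trans e') m := by
  subst e e'; rfl

lemma castX_self (M : LeftCDGModule D) {i : ℤ} (e : i = i) (m : M.X i) : M.castX e m = m := rfl

lemma negOnePow_smul_smul {X : Type*} [AddCommGroup X] (i : ℤ) (m : X) :
    i.negOnePow • i.negOnePow • m = m := by
  rw [smul_smul, Int.units_mul_self, one_smul]

lemma map_negOnePow_smul {X Y : Type*} [AddCommGroup X] [AddCommGroup Y] (f : X →+ Y) (s : ℤˣ)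
    (m : X) : f (s • m) = s • f m := map_zsmul f (s : ℤ) m

/-- Graded maps of degree `s` commuting, up to the Koszul sign, with the action. -/
structure GMap (M N : LeftCDGModule D) (s : ℤ) where
  f : ∀ {i j : ℤ}, i + s = j → (M.X i →+ N.X j)
  map_act : ∀ {i j l j' l' : ℤ} (hl : i + j = l) (hj : j + s = j') (hl' : l + s = l')
    (e : i + j' = l') (a : ℰ i) (m : M.X j),
    f hl' (M.act hl a m) = (s * i).negOnePow • N.act e a (f hj m)

namespace GMap

variable {M N P Q : LeftCDGModule D} {s r q : ℤ}

lemma ext {φ ψ : GMap M N s} (h : ∀ {i j : ℤ} (e : i + s = j) (m : M.X i), φ.f e m = ψ.f e m) :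
    φ = ψ := by
  obtain ⟨f, _⟩ := φ
  obtain ⟨g, _⟩ := ψ
  have : @f = @g := by
    funext i j e
    exact AddMonoidHom.ext (h e)
  subst this
  rfl

instance : Add (GMap M N s) :=
  ⟨fun φ ψ => ⟨fun h => φ.f h + ψ.f h, fun hl hj hl' e a m => by
    simp [φ.map_act hl hj hl' e, ψ.map_act hl hj hl' e, N.act_add]⟩⟩

instance : Zero (GMap M N s) := ⟨⟨fun _ => 0, fun _ _ _ e a m => by simp [N.act_zero]⟩⟩

instance : Neg (GMap M N s) :=
  ⟨fun φ => ⟨fun h => - φ.f h, fun hl hj hl' e a m => by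
    simp [φ.map_act hl hj hl' e, N.act_neg]⟩⟩

@[simp] lemma add_app (φ ψ : GMap M N s) {i j : ℤ} (e : i + s = j) (m : M.X i) :
    (φ + ψ).f e m = φ.f e m + ψ.f e m := rfl

@[simp] lemma zero_app {i j : ℤ} (e : i + s = j) (m : M.X i) : (0 : GMap M N s).f e m = 0 := rfl

@[simp] lemma neg_app (φ : GMap M N s) {i j : ℤ} (e : i + s = j) (m : M.X i) :
    (-φ).f e m = - φ.f e m := rfl

instance : AddCommGroup (GMap M N s) where
  add_assoc f g h := by apply ext; simp [add_assoc]
  zero_add f := by apply ext; simp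
  add_zero f := by apply ext; simp
  add_comm f g := by apply ext; simp [add_comm]
  neg_add_cancel f := by apply ext; simp
  nsmul := nsmulRec
  zsmul := zsmulRec

@[simp] lemma sub_app (φ ψ : GMap M N s) {i j : ℤ} (e : i + s = j) (m : M.X i) :
    (φ - ψ).f e m = φ.f e m - ψ.f e m := by
  rw [sub_eq_add_neg, add_app, neg_app, sub_eq_add_neg]

@[simp] lemma smul_app (x : ℤˣ) (φ : GMap M N s) {i j : ℤ} (e : i + s = j) (m : M.X i) :
    (x • φ).f e m = x • φ.f e m := by
  rcases Int.units_eq_one_or x with rfl | rfl <;> simp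

lemma castX_f (φ : GMap M N s) {i i' j : ℤ} (e : i' + s = j) (h : i = i') (m : M.X i) :
    φ.f e (M.castX h m) = φ.f (h ▸ e) m := by
  subst h; rfl

/-- Composition, in diagrammatic order. -/
def comp (φ : GMap M N s) (ψ : GMap N P r) (h : s + r = q) : GMap M P q where
  f {i j} e := (ψ.f (by omega : i + s + r = j)).comp (φ.f rfl)
  map_act {i j l j' l'} hl hj hl' e a m := by
    subst h
    simp only [AddMonoidHom.comp_apply]
    rw [φ.map_act hl rfl rfl (by omega), map_negOnePow_smul,
      ψ.map_act _ (by omega : j + s + r = j') _ e, smul_smul, add_mul, Int.negOnePow_add]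

lemma comp_app (φ : GMap M N s) (ψ : GMap N P r) (h : s + r = q) {i k j : ℤ} (e : i + q = j)
    (e₁ : i + s = k) (e₂ : k + r = j) (m : M.X i) :
    (φ.comp ψ h).f e m = ψ.f e₂ (φ.f e₁ m) := by
  subst e₁; rfl

/-- The differential of the complex of graded maps. -/
def diff (h : r + 1 = s) (φ : GMap M N r) : GMap M N s where
  f {i j} e := (N.d (by omega : i + r + 1 = j)).comp (φ.f rfl) -
    r.negOnePow • (φ.f (by omega : i + 1 + r = j)).comp (M.d rfl)
  map_act {i j l j' l'} hl hj hl' e a m := by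
    subst h
    simp only [AddMonoidHom.sub_apply, AddMonoidHom.smul_apply, AddMonoidHom.comp_apply]
    rw [φ.map_act hl rfl rfl (by omega), N.d_zsmul,
      N.leibniz (by omega) rfl (by omega : j + r + 1 = j') _ (by omega) e,
      M.leibniz hl rfl rfl rfl (by omega) (by omega), map_add,
      φ.map_act _ rfl _ (by omega), map_negOnePow_smul,
      φ.map_act _ (by omega : j + 1 + r = j') _ e, N.act_sub, N.act_zsmul]
    simp only [Int.negOnePow_add, add_mul, mul_add, mul_one, one_mul]
    rcases Int.units_eq_one_or r.negOnePow with h₁ | h₁ <;>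
    rcases Int.units_eq_one_or i.negOnePow with h₂ | h₂ <;>
    rcases Int.units_eq_one_or (r * i).negOnePow with h₃ | h₃ <;>
    simp [h₁, h₂, h₃] <;> abel

lemma diff_f (h : r + 1 = s) (φ : GMap M N r) {i i' j j' : ℤ} (e : i + s = j) (e₁ : i + r = j')
    (e₂ : j' + 1 = j) (e₃ : i + 1 = i') (e₄ : i' + r = j) (m : M.X i) :
    (φ.diff h).f e m = N.d e₂ (φ.f e₁ m) - r.negOnePow • φ.f e₄ (M.d e₃ m) := by
  subst e₁ e₃; rfl

lemma diff_add (h : r + 1 = s) (φ ψ : GMap M N r) : (φ + ψ).diff h = φ.diff h + ψ.diff h := by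
  apply ext
  intro i j e m
  simp only [add_app, diff_f h _ e rfl (by omega) rfl (by omega), map_add, smul_add]
  abel

/-- The differential, as an additive map. -/
def diffHom (h : r + 1 = s) : GMap M N r →+ GMap M N s := AddMonoidHom.mk' (diff h) (diff_add h)

lemma diff_neg (h : r + 1 = s) (φ : GMap M N r) : (-φ).diff h = -φ.diff h :=
  map_neg (diffHom h) φ

lemma diff_zero (h : r + 1 = s) : (0 : GMap M N r).diff h = 0 := map_zero (diffHom h)

lemma diff_sub (h : r + 1 = s) (φ ψ : GMap M N r) : (φ - ψ).diff h = φ.diff h - ψ.diff h :=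
  map_sub (diffHom h) φ ψ

lemma diff_smul (h : r + 1 = s) (x : ℤˣ) (φ : GMap M N r) : (x • φ).diff h = x • φ.diff h :=
  map_negOnePow_smul (diffHom h) x φ

/-- The predifferentials square to multiplication by the curvature. As the curvature has even
degree, graded maps commute with it without a sign, and the two contributions cancel. -/
lemma diff_diff (h : r + 1 = s) (h' : s + 1 = q) (φ : GMap M N r) :
    (φ.diff h).diff h' = 0 := by
  subst h h'
  apply ext
  intro i j e m
  rw [diff_f rfl _ e rfl (by omega) rfl (by omega),
    diff_f rfl _ rfl rfl (by omega) rfl (by omega),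
    diff_f rfl _ _ (by omega : i + 1 + r = i + (r + 1)) (by omega) rfl (by omega),
    map_sub, N.d_zsmul, N.d_d _ _ (by omega), M.d_d _ _ (by omega : 2 + i = i + 1 + 1),
    φ.map_act _ rfl _ (by omega), Int.negOnePow_succ]
  rw [mul_comm, Int.negOnePow_two_mul]
  rcases Int.units_eq_one_or r.negOnePow with h₁ | h₁ <;> simp [h₁, add_comm]

/-- The Leibniz rule; the Koszul sign falls on the first term because composition is written in
diagrammatic order while maps act on the left. -/
lemma diff_comp {s' r' q' : ℤ} (φ : GMap M N s) (ψ : GMap N P r) (h : s + r = q) (hs : s + 1 = s')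
    (hr : r + 1 = r') (hq : q + 1 = q') :
    (φ.comp ψ h).diff hq = r.negOnePow • (φ.diff hs).comp ψ (by omega) +
      φ.comp (ψ.diff hr) (by omega) := by
  subst hs hr h
  apply ext
  intro i j e m
  rw [diff_f _ _ e rfl (by omega) rfl (by omega), add_app, smul_app,
    comp_app _ _ _ _ rfl (by omega), comp_app _ _ _ _ rfl (by omega),
    comp_app _ _ _ _ rfl (by omega), comp_app _ _ _ _ rfl (by omega),
    diff_f _ _ _ rfl (by omega) rfl (by omega),
    diff_f rfl ψ _ (by omega : i + s + r = i + (s + r)) (by omega) rfl (by omega)]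
  simp only [map_sub, map_negOnePow_smul, smul_sub, smul_smul, Int.negOnePow_add]
  have h₁ : ∀ {a b : ℤ} (ha : i + 1 + s = a) (ha' : a + r = j) (hb : i + 1 + s = b)
    (hb' : b + r = j), ψ.f ha' (φ.f ha (M.d rfl m)) = ψ.f hb' (φ.f hb (M.d rfl m)) := by
    intro a b ha _ hb _; subst ha hb; rfl
  rw [h₁ rfl (by omega) (by omega : _ = i + (s + 1)) (by omega), mul_comm]
  have h₂ : ∀ {a b : ℤ} (ha : i + s + 1 = a) (ha' : a + r = j) (hb : i + s + 1 = b)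
    (hb' : b + r = j), ψ.f ha' (N.d ha (φ.f rfl m)) = ψ.f hb' (N.d hb (φ.f rfl m)) := by
    intro a b ha _ hb _; subst ha hb; rfl
  rw [h₂ rfl (by omega) (by omega : _ = i + (s + 1)) (by omega)]
  abel

lemma comp_assoc {x y z : ℤ} (φ : GMap M N s) (ψ : GMap N P r) (χ : GMap P Q q) (h : s + r = x)
    (h' : x + q = y) (h'' : r + q = z) (h''' : s + z = y) :
    (φ.comp ψ h).comp χ h' = φ.comp (ψ.comp χ h'') h''' := by
  apply ext; intro i j e m
  rw [comp_app _ _ _ _ rfl (by omega), comp_app _ _ _ _ rfl (by omega), comp_app _ _ _ _ rfl (by omega),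
    comp_app _ _ _ _ rfl (by omega)]
  have : ∀ {a b : ℤ} (ha : i + s + r = a) (ha' : a + q = j) (hb : i + s + r = b)
    (hb' : b + q = j), χ.f ha' (ψ.f ha (φ.f rfl m)) = χ.f hb' (ψ.f hb (φ.f rfl m)) := by
    intro a b ha _ hb _; subst ha hb; rfl
  exact this _ _ _ _

lemma add_comp (φ φ' : GMap M N s) (ψ : GMap N P r) (h : s + r = q) :
    (φ + φ').comp ψ h = φ.comp ψ h + φ'.comp ψ h := by
  apply ext; intro i j e m; simp [comp_app _ _ _ e rfl (by omega : i + s + r = j)]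

lemma comp_add (φ : GMap M N s) (ψ ψ' : GMap N P r) (h : s + r = q) :
    φ.comp (ψ + ψ') h = φ.comp ψ h + φ.comp ψ' h := by
  apply ext; intro i j e m; simp [comp_app _ _ _ e rfl (by omega : i + s + r = j)]

lemma neg_comp (φ : GMap M N s) (ψ : GMap N P r) (h : s + r = q) :
    (-φ).comp ψ h = -φ.comp ψ h := by
  apply ext; intro i j e m; simp [comp_app _ _ _ e rfl (by omega : i + s + r = j)]

lemma comp_neg (φ : GMap M N s) (ψ : GMap N P r) (h : s + r = q) :
    φ.comp (-ψ) h = -φ.comp ψ h := by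
  apply ext; intro i j e m; simp [comp_app _ _ _ e rfl (by omega : i + s + r = j)]

/-- A graded map is closed if its differential vanishes. -/
def IsClosed (φ : GMap M N s) : Prop := φ.diff rfl = 0

/-- A graded map is null-homotopic if it is the differential of a graded map. -/
def IsNull (φ : GMap M N s) : Prop := ∃ (r : ℤ) (h : r + 1 = s) (η : GMap M N r), η.diff h = φ

lemma isClosed_iff (φ : GMap M N s) : φ.IsClosed ↔ ∀ {i i' j j' : ℤ} (e : i + s = j)
    (e₁ : i + 1 = i') (e₂ : j + 1 = j') (e₃ : i' + s = j') (m : M.X i),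
    φ.f e₃ (M.d e₁ m) = s.negOnePow • N.d e₂ (φ.f e m) := by
  constructor
  · intro h i i' j j' e e₁ e₂ e₃ m
    have := congrArg (fun ψ : GMap M N (s + 1) => ψ.f (by omega : i + (s + 1) = j') m) h
    simp only [zero_app] at this
    rw [diff_f rfl φ _ e e₂ e₁ e₃, sub_eq_zero] at this
    rw [this, negOnePow_smul_smul]
  · intro h
    apply ext
    intro i j e m
    rw [diff_f rfl φ _ rfl (by omega) rfl (by omega), h rfl rfl (by omega) (by omega),
      negOnePow_smul_smul, sub_self, zero_app]

lemma IsClosed.diff_eq_zero {φ : GMap M N s} (h : φ.IsClosed) (e : s + 1 = q) :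
    φ.diff e = 0 := by subst e; exact h

lemma IsClosed.map_d {φ : GMap M N s} (h : φ.IsClosed) {i i' j j' : ℤ} (e : i + s = j)
    (e₁ : i + 1 = i') (e₂ : j + 1 = j') (e₃ : i' + s = j') (m : M.X i) :
    φ.f e₃ (M.d e₁ m) = s.negOnePow • N.d e₂ (φ.f e m) :=
  (isClosed_iff φ).1 h e e₁ e₂ e₃ m

lemma zero_comp (ψ : GMap N P r) (h : s + r = q) : (0 : GMap M N s).comp ψ h = 0 := by
  apply ext; intro i j e m; rw [comp_app _ _ _ _ rfl (by omega)]; simp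

lemma comp_zero (φ : GMap M N s) (h : s + r = q) : φ.comp (0 : GMap N P r) h = 0 := by
  apply ext; intro i j e m; rw [comp_app _ _ _ _ rfl (by omega)]; simp

lemma IsClosed.comp {φ : GMap M N s} {ψ : GMap N P r} (hφ : φ.IsClosed) (hψ : ψ.IsClosed)
    (h : s + r = q) : (φ.comp ψ h).IsClosed := by
  refine (diff_comp φ ψ h rfl rfl rfl).trans ?_
  rw [hφ.diff_eq_zero, hψ.diff_eq_zero, zero_comp, comp_zero, smul_zero, add_zero]

lemma IsClosed.neg {φ : GMap M N s} (hφ : φ.IsClosed) : (-φ).IsClosed := by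
  rw [IsClosed, diff_neg, hφ.diff_eq_zero]; simp

lemma IsClosed.sub {φ ψ : GMap M N s} (hφ : φ.IsClosed) (hψ : ψ.IsClosed) :
    (φ - ψ).IsClosed := by
  rw [IsClosed, diff_sub, hφ.diff_eq_zero, hψ.diff_eq_zero]; simp

lemma IsNull.add {φ ψ : GMap M N s} (h : φ.IsNull) (h' : ψ.IsNull) : (φ + ψ).IsNull := by
  obtain ⟨r, hr, η, rfl⟩ := h
  obtain ⟨r', hr', η', rfl⟩ := h'
  obtain rfl : r = r' := by omega
  exact ⟨r, hr, η + η', diff_add _ _ _⟩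

lemma IsNull.neg {φ : GMap M N s} (h : φ.IsNull) : (-φ).IsNull := by
  obtain ⟨r, hr, η, rfl⟩ := h
  exact ⟨r, hr, -η, diff_neg _ _⟩

lemma isNull_diff (h : r + 1 = s) (η : GMap M N r) : (η.diff h).IsNull := ⟨r, h, η, rfl⟩

lemma isClosed_zero : (0 : GMap M N s).IsClosed := diff_zero _

lemma IsNull.comp_right {φ : GMap M N s} {ψ : GMap N P r} (hφ : φ.IsNull) (hψ : ψ.IsClosed)
    (h : s + r = q) : (φ.comp ψ h).IsNull := by
  obtain ⟨s', rfl, η, rfl⟩ := hφ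
  refine ⟨q - 1, by omega, r.negOnePow • η.comp ψ (by omega), ?_⟩
  rw [diff_smul, diff_comp η ψ _ rfl rfl, hψ.diff_eq_zero, comp_zero, add_zero,
    smul_smul, Int.units_mul_self, one_smul]

lemma IsNull.comp_left {φ : GMap M N s} {ψ : GMap N P r} (hφ : φ.IsClosed) (hψ : ψ.IsNull)
    (h : s + r = q) : (φ.comp ψ h).IsNull := by
  obtain ⟨r', rfl, η, rfl⟩ := hψ
  refine ⟨q - 1, by omega, φ.comp η (by omega), ?_⟩
  rw [diff_comp φ η _ rfl rfl, hφ.diff_eq_zero, zero_comp, smul_zero, zero_add]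

/-- A graded map of degree `0` given by its components. -/
def ofDegZero (f : ∀ i, M.X i →+ N.X i) (hf : ∀ {i j l : ℤ} (h : i + j = l) (a : ℰ i) (m : M.X j),
    f l (M.act h a m) = N.act h a (f j m)) : GMap M N 0 where
  f {i j} e := (f j).comp (M.castX (by omega))
  map_act {i j l j' l'} hl hj hl' e a m := by
    obtain rfl : j = j' := by omega
    obtain rfl : l = l' := by omega
    simp [hf e]

lemma ext_zero {φ ψ : GMap M N 0}
    (h : ∀ (i : ℤ) (m : M.X i), φ.f (add_zero i) m = ψ.f (add_zero i) m) : φ = ψ := by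
  apply ext
  intro i j e m
  obtain rfl : i = j := by omega
  exact h i m

/-- A closed morphism as a graded map of degree `0`. -/
def ofHom (f : M ⟶ N) : GMap M N 0 := ofDegZero (Hom.f f) f.map_act

lemma ofHom_f (f : M ⟶ N) {i : ℤ} (e : i + 0 = i) (m : M.X i) : (ofHom f).f e m = Hom.f f i m :=
  rfl

lemma ofHom_neg (f : M ⟶ N) : ofHom (-f) = -ofHom f := ext_zero fun _ _ => rfl

lemma ofHom_zero : ofHom (0 : M ⟶ N) = 0 := ext_zero fun _ _ => rfl

lemma ofHom_comp (f : M ⟶ N) (g : N ⟶ P) :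
    ofHom (f ≫ g) = (ofHom f).comp (ofHom g) (add_zero 0) := ext_zero fun i m => by
  rw [comp_app _ _ _ _ (add_zero i) (add_zero i)]; rfl

lemma ofHom_id_comp (φ : GMap M N s) (h : 0 + s = s) : (ofHom (𝟙 M)).comp φ h = φ := by
  apply ext; intro i j e m
  rw [comp_app _ _ _ _ (add_zero i) e]; rfl

lemma comp_ofHom_id (φ : GMap M N s) (h : s + 0 = s) : φ.comp (ofHom (𝟙 N)) h = φ := by
  apply ext; intro i j e m
  rw [comp_app _ _ _ _ e (add_zero j)]; rfl

lemma ofHom_isClosed (f : M ⟶ N) : (ofHom f).IsClosed := by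
  rw [isClosed_iff]
  intro i i' j j' e e₁ e₂ e₃ m
  obtain rfl : i = j := by omega
  obtain rfl : i' = j' := by omega
  simp [ofHom_f, f.map_d]

/-- The closed morphism given by a closed graded map of degree `0`. -/
def IsClosed.toHom {φ : GMap M N 0} (h : φ.IsClosed) : M ⟶ N :=
  { f := fun i => φ.f (add_zero i)
    map_act := fun e a m => by rw [φ.map_act _ (add_zero _) _ e]; simp
    map_d := fun e m => by rw [h.map_d (add_zero _) e e]; simp : Hom M N }

lemma ofHom_toHom {φ : GMap M N 0} (h : φ.IsClosed) : ofHom h.toHom = φ := by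
  apply ext
  intro i j e m
  obtain rfl : i = j := by omega
  rfl

/-- In degree `-1` the sign in `diff` turns the graded commutator into `d h + h d`. -/
lemma homotopic_iff (f g : M ⟶ N) : Homotopic f g ↔ (ofHom f - ofHom g).IsNull := by
  constructor
  · rintro ⟨h, h₁, h₂⟩
    refine ⟨-1, rfl, ⟨fun {i j} e => h (by omega), fun {i j l j' l'} hl hj hl' e a m => ?_⟩, ?_⟩
    · rw [h₁ hl (by omega : j' + 1 = j) (by omega) e, neg_one_mul, Int.negOnePow_neg]
    · apply ext
      intro i j e m
      obtain rfl : i = j := by omega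
      rw [diff_f _ _ _ rfl (by omega) rfl (by omega), sub_app, ofHom_f, ofHom_f,
        h₂ rfl (by omega : i + -1 + 1 = i)]
      simp
  · rintro ⟨r, hr, η, hη⟩
    obtain rfl : r = -1 := by omega
    refine ⟨fun {i j} e => η.f (by omega), fun {i j l j' l'} hl hj hl' e a m => ?_,
      fun {i j l} hi hj m => ?_⟩
    · rw [η.map_act hl (by omega : j + -1 = j') _ e, neg_one_mul, Int.negOnePow_neg]
    · have := congrArg (fun ψ : GMap M N 0 => ψ.f (add_zero i) m) hη
      simp only [sub_app, ofHom_f] at this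
      rw [← this, diff_f _ _ _ (by omega : i + -1 = l) hj hi (by omega)]
      simp

/-- The canonical closed graded map from a shift. -/
def unshift (M : LeftCDGModule D) (s : ℤ) : GMap (M.shift s) M s where
  f {i j} e := M.castX e
  map_act {i j l j' l'} hl hj hl' e a m := by
    have key : ∀ m : M.X (j + s), M.castX hl' ((s * i).negOnePow • M.act (by omega) a m) =
        (s * i).negOnePow • M.act e a (M.castX hj m) := fun m => by
      rw [map_negOnePow_smul, act_castX, castX_act]
    exact key m

/-- The canonical closed graded map to a shift. -/
def toShift (M : LeftCDGModule D) (s : ℤ) {r : ℤ} (h : r + s = 0) : GMap M (M.shift s) r where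
  f {i j} e := M.castX (by omega : i = j + s)
  map_act {i j l j' l'} hl hj hl' e a m := by
    obtain rfl : s = -r := by omega
    have key : M.castX (by omega : l = l' + -r) (M.act hl a m) = (r * i).negOnePow •
        (-r * i).negOnePow • M.act (by omega : i + (j' + -r) = l' + -r) a
          (M.castX (by omega) m) := by
      rw [act_castX, castX_act, smul_smul, ← Int.negOnePow_add]
      simp
    exact key

lemma unshift_isClosed (M : LeftCDGModule D) (s : ℤ) : (unshift M s).IsClosed := by
  rw [isClosed_iff]
  intro i i' j j' e e₁ e₂ e₃ m
  have key : ∀ m : M.X (i + s), M.castX e₃ (s.negOnePow • M.d (by omega) m) =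
      s.negOnePow • M.d e₂ (M.castX e m) := fun m => by
    rw [map_negOnePow_smul, d_castX, castX_d]
  exact key m

lemma toShift_isClosed (M : LeftCDGModule D) (h : r + s = 0) : (toShift M s h).IsClosed := by
  rw [isClosed_iff]
  intro i i' j j' e e₁ e₂ e₃ m
  obtain rfl : s = -r := by omega
  have key : M.castX (by omega : i' = j' + -r) (M.d e₁ m) = r.negOnePow • (-r).negOnePow •
      M.d (by omega : j + -r + 1 = j' + -r) (M.castX (by omega) m) := by
    rw [d_castX, castX_d, smul_smul, Int.negOnePow_neg, Int.units_mul_self, one_smul]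
  exact key

lemma comp_toShift_unshift (φ : GMap M N r) (h : q + s = 0) (h' : r + q = r + q) :
    ((φ.comp (toShift N s h) h').comp (unshift N s) (by omega : r + q + s = r)) = φ := by
  apply ext
  intro i j e m
  rw [comp_app _ _ _ _ rfl (by omega), comp_app _ _ _ _ e (by omega)]
  exact N.castX_castX _ _ _

end GMap

end LeftCDGModule
end CurvedDG

/-! ### Cones, products and orthogonality. -/

namespace CurvedDG

namespace LeftCDGModule

variable {R : Type*} [CommRing R] {E : Type u} [Ring E] [Algebra R E]
  {ℰ : ℤ → Submodule R E} [GradedAlgebra ℰ] {D : CDGStructure ℰ}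

variable {M N P K : LeftCDGModule D}

open GMap

lemma comp_toShift_unshift_of_eq {q r s : ℤ} (φ : GMap M N r) (h : q + s = 0) {x : ℤ}
    (h' : r + q = x) (h'' : x + s = r) :
    (φ.comp (toShift N s h) h').comp (unshift N s) h'' = φ := by
  subst h'; exact comp_toShift_unshift φ h rfl

lemma toShift_unshift {q s : ℤ} (h : q + s = 0) :
    (toShift N s h).comp (unshift N s) h = ofHom (𝟙 N) := by
  refine ext_zero fun i m => ?_
  rw [comp_app _ _ _ _ rfl (by omega)]
  exact N.castX_castX _ _ _

lemma unshift_toShift {q s : ℤ} (h : q + s = 0) (h' : s + q = 0) :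
    (unshift N s).comp (toShift N s h) h' = ofHom (𝟙 _) := by
  refine ext_zero fun i m => ?_
  rw [comp_app _ _ _ _ rfl (by omega)]
  exact N.castX_castX rfl rfl m

section Cone

variable (f : M ⟶ N)

/-- The inclusion of the target in the cone. -/
def coneInl : N ⟶ cone f :=
  { f := fun i => AddMonoidHom.inl (N.X i) (M.X (i + 1))
    map_act := fun {i j l} h a m => Prod.ext rfl
      (by change (0 : M.X (l + 1)) = _ • M.act _ a 0; rw [M.act_zero, smul_zero])
    map_d := fun {i j} h m => Prod.ext
      (by change N.d h m = N.d h m + Hom.f f j (M.castX h 0); simp)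
      (by change (0 : M.X (j + 1)) = - M.d _ 0; simp) : Hom N (cone f) }

/-- The graded projection of the cone to the target. -/
def coneFst : GMap (cone f) N 0 :=
  ofDegZero (fun i => AddMonoidHom.fst (N.X i) (M.X (i + 1))) fun _ _ _ => rfl

/-- The projection of the cone to the (shifted) source. -/
def coneSnd : GMap (cone f) M 1 where
  f {i j} e := (M.castX e).comp (AddMonoidHom.snd (N.X i) (M.X (i + 1)))
  map_act {i j l j' l'} hl hj hl' e a m := by
    change M.castX hl' (i.negOnePow • M.act (by omega) a m.2) =
      (1 * i).negOnePow • M.act e a (M.castX hj m.2)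
    rw [map_negOnePow_smul, castX_act, act_castX, one_mul]

/-- The graded inclusion of the (shifted) source in the cone. -/
def coneInr : GMap M (cone f) (-1) where
  f {i j} e := (AddMonoidHom.inr (N.X j) (M.X (j + 1))).comp (M.castX (by omega))
  map_act {i j l j' l'} hl hj hl' e a m := by
    refine Prod.ext ?_ ?_
    · change (0 : N.X l') = (-1 * i).negOnePow • N.act (by omega) a 0
      rw [N.act_zero, smul_zero]
    · change M.castX (by omega : l = l' + 1) (M.act hl a m) = (-1 * i).negOnePow •
        i.negOnePow • M.act _ a (M.castX (by omega) m)
      rw [act_castX, castX_act, neg_one_mul, Int.negOnePow_neg, negOnePow_smul_smul]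

lemma coneInl_fst : (ofHom (coneInl f)).comp (coneFst f) (add_zero 0) = ofHom (𝟙 N) :=
  ext_zero fun i m => by rw [comp_app _ _ _ _ (add_zero i) (add_zero i)]; rfl

lemma coneInl_snd : (ofHom (coneInl f)).comp (coneSnd f) (zero_add 1) = 0 := by
  apply GMap.ext; intro i j e m
  rw [comp_app _ _ _ _ (add_zero i) e]
  exact map_zero (M.castX e)

lemma coneInr_snd : (coneInr f).comp (coneSnd f) (by norm_num) = ofHom (𝟙 M) := by
  refine ext_zero fun i m => ?_
  rw [comp_app _ _ _ _ rfl (by omega)]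
  exact M.castX_castX _ _ m

lemma cone_decomp : (coneFst f).comp (ofHom (coneInl f)) (add_zero 0) +
    (coneSnd f).comp (coneInr f) (by norm_num) = ofHom (𝟙 _) := by
  refine ext_zero fun i m => ?_
  rw [add_app, comp_app _ _ _ _ (add_zero i) (add_zero i), comp_app _ _ _ _ rfl (by omega)]
  refine Prod.ext ?_ ?_
  · exact add_zero m.1
  · exact (zero_add _).trans (M.castX_castX rfl rfl m.2)

lemma coneSnd_isClosed : (coneSnd f).IsClosed := by
  rw [isClosed_iff]
  intro i i' j j' e e₁ e₂ e₃ m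
  change M.castX e₃ (- M.d _ m.2) = Int.negOnePow 1 • M.d e₂ (M.castX e m.2)
  rw [map_neg, castX_d, d_castX, Int.negOnePow_one, Units.neg_smul, one_smul]

/-- As a graded module the cone is a direct sum; this formula and `diff_coneInr` record how far the
splitting is from being closed, and so replace the explicit predifferential from here on. -/
lemma diff_coneFst : (coneFst f).diff (zero_add 1) =
    -(coneSnd f).comp (ofHom f) (by norm_num) := by
  apply GMap.ext; intro i j e m
  rw [diff_f _ _ e (add_zero i) e e (add_zero j), neg_app, comp_app _ _ _ _ e (add_zero j)]
  change N.d e m.1 - Int.negOnePow 0 • (N.d e m.1 + Hom.f f j (M.castX e m.2)) =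
    - Hom.f f j (M.castX e m.2)
  simp

lemma diff_coneInr : (coneInr f).diff (by norm_num) =
    (ofHom f).comp (ofHom (coneInl f)) (add_zero 0) := by
  refine ext_zero fun i m => ?_
  rw [diff_f _ _ _ rfl (by omega) rfl (by omega), comp_app _ _ _ _ (add_zero i) (add_zero i)]
  refine Prod.ext ?_ ?_
  · change N.d _ 0 + Hom.f f i (M.castX (by omega : i + -1 + 1 = i)
      (M.castX (by omega) m)) - Int.negOnePow (-1) • (0 : N.X i) = Hom.f f i m
    rw [castX_castX, castX_self]
    simp
  · change - M.d _ (M.castX (by omega : i = i + -1 + 1) m) -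
      Int.negOnePow (-1) • M.castX (by omega) (M.d rfl m) = 0
    rw [d_castX, castX_d]
    simp

end Cone

section Orthogonal

/-- `I` is orthogonal to a class of modules if all closed graded maps from a module in the class
to `I` are null-homotopic. -/
def Orth (S : LeftCDGModule D → Prop) (I : LeftCDGModule D) : Prop :=
  ∀ N, S N → ∀ (s : ℤ) (φ : GMap N I s), φ.IsClosed → φ.IsNull

variable {S : LeftCDGModule D → Prop}

lemma map_eq_zero_iff (f : M ⟶ N) :
    (Quotient.functor (homotopyRel D)).map f = 0 ↔ (ofHom f).IsNull := by
  have h : (ofHom f).IsNull ↔ Homotopic f 0 := by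
    rw [homotopic_iff, ofHom_zero, sub_zero]
  rw [h]
  exact Quotient.functor_map_eq_iff (homotopyRel D) f 0

/-- A closed map of degree `s` is traded for a closed morphism of degree `0` from the shift of its
source by `-s`; this is why the class has to be stable under shifts. -/
lemma isNull_of_toHot (hS : ∀ N s, S N → S (N.shift s)) {I : LeftCDGModule D}
    (h : ∀ N, S N → ∀ f : toHot N ⟶ toHot I, f = 0) : Orth S I := by
  intro N hN s φ hφ
  have hc : ((unshift N (-s)).comp φ (by omega : -s + s = 0)).IsClosed :=
    (unshift_isClosed N (-s)).comp hφ (by omega : -s + s = 0)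
  have := (map_eq_zero_iff _).1 (h _ (hS N (-s) hN)
    ((Quotient.functor (homotopyRel D)).map hc.toHom))
  rw [ofHom_toHom] at this
  have := this.comp_left (toShift_isClosed N (by omega : s + -s = 0)) (add_zero s)
  rwa [← comp_assoc _ _ _ (by omega : s + -s = 0) (zero_add s), toShift_unshift,
    ofHom_id_comp] at this

lemma Orth.eq_zero {I : LeftCDGModule D} (h : Orth S I) (hN : S N) (f : toHot N ⟶ toHot I) :
    f = 0 := by
  obtain ⟨f, rfl⟩ := (Quotient.functor (homotopyRel D)).map_surjective f
  exact (map_eq_zero_iff f).2 (h N hN 0 _ (ofHom_isClosed f))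

lemma Orth.shift {I : LeftCDGModule D} (h : Orth S I) (r : ℤ) : Orth S (I.shift r) := by
  intro N hN s φ hφ
  have := (h N hN _ _ (hφ.comp (unshift_isClosed I r) rfl)).comp_right
    (toShift_isClosed I (by omega : -r + r = 0)) (by omega : s + r + -r = s)
  rwa [comp_assoc _ _ _ _ _ (by omega : r + -r = 0) (by omega), unshift_toShift,
    comp_ofHom_id] at this

/-- The component of a closed map in the shifted source is null-homotopic. Correcting the map by
that homotopy leaves a closed map into the target, which is null-homotopic in turn. -/
lemma Orth.cone (hM : Orth S M) (hN : Orth S N) (f : M ⟶ N) : Orth S (LeftCDGModule.cone f) := by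
  intro L hL s φ hφ
  obtain ⟨r, hr, η, hη⟩ := hM L hL _ _ (hφ.comp (coneSnd_isClosed f) rfl)
  obtain rfl : r = s := by omega
  -- The first summand of this differential cancels the component of `φ` in `M`; the second lies in
  -- `N`.
  have hθ : (η.comp (coneInr f) rfl).diff (by omega) =
      -φ.comp ((coneSnd f).comp (coneInr f) (by norm_num : (1 : ℤ) + -1 = 0)) (add_zero r) +
        η.comp ((ofHom f).comp (ofHom (coneInl f)) (add_zero 0)) (add_zero r) := by
    rw [diff_comp η (coneInr f) rfl rfl (by norm_num : (-1 : ℤ) + 1 = 0), diff_coneInr, hη,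
      comp_assoc _ _ _ _ _ (by norm_num : (1 : ℤ) + -1 = 0) (by omega)]
    simp
  set θ := η.comp (coneInr f) rfl
  set φ' := φ + θ.diff (by omega) with hφ'
  have hc : φ'.IsClosed := by
    rw [GMap.IsClosed, hφ', diff_add, diff_diff, hφ.diff_eq_zero, add_zero]
  have h₁ : φ'.comp (coneSnd f) rfl = 0 := by
    rw [hφ', hθ, add_comp, add_comp, neg_comp,
      comp_assoc _ _ _ _ _ (by norm_num : (0 : ℤ) + 1 = 1) (by omega),
      comp_assoc _ _ _ _ _ (by norm_num : (-1 : ℤ) + 1 = 0) (by omega), coneInr_snd,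
      comp_ofHom_id,
      comp_assoc _ _ _ _ _ (by norm_num : (0 : ℤ) + 1 = 1) (by omega),
      comp_assoc _ _ _ _ _ (by norm_num : (0 : ℤ) + 1 = 1) (by omega), coneInl_snd,
      comp_zero, comp_zero]
    abel
  have h₂ : (φ'.comp (coneFst f) (add_zero r)).IsClosed := by
    rw [GMap.IsClosed, diff_comp _ _ _ rfl (zero_add 1) rfl, hc.diff_eq_zero, zero_comp, diff_coneFst,
      comp_neg, ← comp_assoc _ _ _ rfl (add_zero (r + 1)), h₁, zero_comp]
    simp
  have h₃ : φ' = (φ'.comp (coneFst f) (add_zero r)).comp (ofHom (coneInl f)) (add_zero r) := by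
    have := congrArg (fun ψ => φ'.comp ψ (add_zero r)) (cone_decomp f)
    simp only [comp_add, comp_ofHom_id] at this
    rw [← comp_assoc _ _ _ (add_zero r) (add_zero r), ← comp_assoc _ _ _ rfl (by omega), h₁,
      zero_comp, add_zero] at this
    exact this.symm
  have h₄ := (hN L hL _ _ h₂).comp_right (ofHom_isClosed (coneInl f)) (add_zero r)
  rw [← h₃] at h₄
  have := h₄.add (isNull_diff (by omega) θ).neg
  rwa [hφ', add_neg_cancel_right] at this

/-- The map to a product given by its components. -/
def prodLift {ι : Type u} {M : ι → LeftCDGModule D} {s : ℤ} (φ : ∀ k, GMap N (M k) s) :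
    GMap N (prod M) s where
  f e := AddMonoidHom.mk' (fun m k => (φ k).f e m) fun m m' => by funext k; exact map_add _ _ _
  map_act hl hj hl' e a m := by
    funext k; exact (φ k).map_act hl hj hl' e a m

/-- The projections of a product. -/
def prodProj {ι : Type u} (M : ι → LeftCDGModule D) (k : ι) : prod M ⟶ M k :=
  { f := fun i => Pi.evalAddMonoidHom (fun k => (M k).X i) k
    map_act := fun _ _ _ => rfl
    map_d := fun _ _ => rfl : Hom (prod M) (M k) }

lemma prodLift_proj {ι : Type u} {M : ι → LeftCDGModule D} {s : ℤ} (φ : ∀ k, GMap N (M k) s)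
    (k : ι) : (prodLift φ).comp (ofHom (prodProj M k)) (add_zero s) = φ k := by
  apply GMap.ext; intro i j e m
  rw [comp_app _ _ _ _ e (add_zero j)]; rfl

lemma prodLift_diff {ι : Type u} {M : ι → LeftCDGModule D} {s r : ℤ} (φ : ∀ k, GMap N (M k) s)
    (h : s + 1 = r) : (prodLift φ).diff h = prodLift fun k => (φ k).diff h := by
  apply GMap.ext; intro i j e m
  rw [diff_f _ _ e rfl (by omega) rfl (by omega)]
  funext k
  refine Eq.trans ?_ (diff_f h (φ k) e rfl (by omega) rfl (by omega) m).symm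
  rcases Int.units_eq_one_or s.negOnePow with h | h <;> rw [h] <;> simp <;> rfl

lemma prodLift_isClosed {ι : Type u} {M : ι → LeftCDGModule D} {s : ℤ}
    {φ : ∀ k, GMap N (M k) s} (h : ∀ k, (φ k).IsClosed) : (prodLift φ).IsClosed := by
  rw [GMap.IsClosed, prodLift_diff]
  apply GMap.ext; intro i j e m
  funext k
  exact congrArg (fun ψ : GMap N (M k) (s + 1) => ψ.f e m) (h k)

lemma Orth.prod {ι : Type u} {M : ι → LeftCDGModule D} (h : ∀ k, Orth S (M k)) :
    Orth S (LeftCDGModule.prod M) := by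
  intro N hN s φ hφ
  have := fun k => h k N hN s _ (hφ.comp (ofHom_isClosed (prodProj M k)) (add_zero s))
  -- The homotopies are put in one common degree, so that the chosen family can be assembled into a
  -- map to the product.
  have : ∀ k, ∃ η : GMap N (M k) (s - 1),
      η.diff (by omega) = φ.comp (ofHom (prodProj M k)) (add_zero s) := fun k => by
    obtain ⟨r, hr, η, h⟩ := this k
    obtain rfl : r = s - 1 := by omega
    exact ⟨η, h⟩
  choose η hη using this
  refine ⟨s - 1, by omega, prodLift η, ?_⟩
  rw [prodLift_diff]
  apply GMap.ext; intro i j e m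
  funext k
  refine (congrArg (fun ψ : GMap N (M k) s => ψ.f e m) (hη k)).trans ?_
  exact comp_app _ _ _ _ e (add_zero j) m

/-- The map `g` together with a null-homotopy `η` of `f ≫ g` is a closed map on the cone. It is
null-homotopic, and restricting to the target of `f` recovers `g`. -/
lemma Orth.precomp_injective {I : LeftCDGModule D} (hI : Orth S I) (f : M ⟶ N)
    (hf : S (LeftCDGModule.cone f))
    (g : N ⟶ I) (h : (ofHom (f ≫ g)).IsNull) : (ofHom g).IsNull := by
  obtain ⟨r, hr, η, hη⟩ := h
  obtain rfl : r = -1 := by omega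
  have hc : ((coneFst f).comp (ofHom g) (add_zero 0) +
      (coneSnd f).comp η (by norm_num)).IsClosed := by
    rw [GMap.IsClosed, diff_add, diff_comp _ _ _ (zero_add 1) (zero_add 1),
      diff_comp _ _ _ rfl (by norm_num : -1 + 1 = (0 : ℤ)), hη,
      (coneSnd_isClosed f).diff_eq_zero, (ofHom_isClosed g).diff_eq_zero, diff_coneFst, zero_comp,
      comp_zero, ofHom_comp, neg_comp, comp_assoc _ _ _ _ _ (add_zero 0) (by norm_num)]
    simp
  have := (hI _ hf _ _ hc).comp_left (ofHom_isClosed (coneInl f)) (add_zero 0)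
  rwa [comp_add, ← comp_assoc _ _ _ (add_zero 0) (by norm_num), coneInl_fst, ofHom_id_comp,
    ← comp_assoc _ _ _ (zero_add 1) (by norm_num), coneInl_snd, zero_comp, add_zero] at this

/-- The composite of the cone projection with `g` is a differential, say of `H`. The restriction of
`H` to the target of `f` is closed, and minus it extends `g` up to the homotopy given by `H` on the
other summand. -/
lemma Orth.precomp_surjective {I : LeftCDGModule D} (hI : Orth S I) (f : M ⟶ N)
    (hf : S (LeftCDGModule.cone f)) (g : M ⟶ I) : ∃ k : N ⟶ I, Homotopic (f ≫ k) g := by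
  obtain ⟨r, hr, H, hH⟩ := hI _ hf _ _
    ((coneSnd_isClosed f).comp (ofHom_isClosed g) (add_zero 1))
  obtain rfl : r = 0 := by omega
  have hc : ((ofHom (coneInl f)).comp H (add_zero 0)).IsClosed := by
    rw [GMap.IsClosed, diff_comp _ _ _ rfl hr, (ofHom_isClosed _).diff_eq_zero, hH, zero_comp,
      ← comp_assoc _ _ _ (zero_add 1) (by norm_num), coneInl_snd, zero_comp]
    simp
  refine ⟨-hc.toHom, ?_⟩
  rw [homotopic_iff, ofHom_comp, ofHom_neg, ofHom_toHom, comp_neg]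
  have := (isNull_diff (by norm_num : -1 + 1 = (0 : ℤ)) ((coneInr f).comp H (by norm_num))).neg
  rw [diff_comp _ _ _ (by norm_num : (-1 : ℤ) + 1 = 0) hr, hH, diff_coneInr,
    ← comp_assoc (coneInr f) _ _ (by norm_num : -1 + 1 = (0 : ℤ)) (by norm_num), coneInr_snd,
    ofHom_id_comp, comp_assoc _ _ _ _ _ (add_zero 0) (by norm_num)] at this
  convert this using 1
  simp
  abel

end Orthogonal

end LeftCDGModule
end CurvedDG

/-! ### Scalars, and the complexes `D_m ⊗ M` with their cohomology. -/

namespace CurvedDG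

namespace LeftCDGModule

variable {R : Type*} [CommRing R] {E : Type u} [Ring E] [Algebra R E]
  {ℰ : ℤ → Submodule R E} [GradedAlgebra ℰ] {D : CDGStructure ℰ}

variable {M N P K : LeftCDGModule D}

open GMap

section Scalars

lemma smul_act (M : LeftCDGModule D) {i j l : ℤ} (h : i + j = l) (r : R) (a : ℰ i) (m : M.X j) :
    M.act h (r • a) m = M.smulR r l (M.act h a m) := by
  refine (congrArg (fun b => M.act h b m) ?_).trans
    (M.mul_act (zero_add i) h h (zero_add l) (scalar ℰ r) a m)
  exact Subtype.ext (Algebra.smul_def r (a : E))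

lemma act_smulR (M : LeftCDGModule D) {i j l : ℤ} (h : i + j = l) (r : R) (a : ℰ i) (m : M.X j) :
    M.act h a (M.smulR r j m) = M.smulR r l (M.act h a m) := by
  rw [← smul_act]
  refine (M.mul_act (add_zero i) (zero_add j) h h a (scalar ℰ r) m).symm.trans
    (congrArg (fun b => M.act h b m) ?_)
  exact Subtype.ext ((Algebra.commutes r (a : E)).symm.trans (Algebra.smul_def r (a : E)).symm)

lemma smulR_mul (M : LeftCDGModule D) (r s : R) (j : ℤ) (m : M.X j) :
    M.smulR (r * s) j m = M.smulR r j (M.smulR s j m) := by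
  refine (congrArg (fun b => M.act (zero_add j) b m) ?_).trans
    (M.mul_act (zero_add 0) (zero_add j) (zero_add j) (zero_add j) (scalar ℰ r) (scalar ℰ s) m)
  exact Subtype.ext (map_mul (algebraMap R E) r s)

lemma smulR_one (M : LeftCDGModule D) (j : ℤ) (m : M.X j) : M.smulR 1 j m = m := by
  refine (congrArg (fun b => M.act (zero_add j) b m) ?_).trans (M.one_act (zero_add j) m)
  exact Subtype.ext (map_one (algebraMap R E))

lemma GMap.map_smulR {s : ℤ} (φ : GMap M N s) (r : R) {i j : ℤ} (e : i + s = j) (m : M.X i) :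
    φ.f e (M.smulR r i m) = N.smulR r j (φ.f e m) := by
  refine (φ.map_act (zero_add i) e e (zero_add j) (scalar ℰ r) m).trans ?_
  rw [mul_zero, Int.negOnePow_zero, one_smul]; rfl

lemma smulR_mem (M : LeftCDGModule D) (r : R) {j : ℤ} (m : M.X j) :
    M.smulR r j m ∈ M.smulRange r j := ⟨m, rfl⟩

lemma map_mem_smulRange {s : ℤ} (φ : GMap M N s) (r : R) {i j : ℤ} (e : i + s = j) {m : M.X i}
    (h : m ∈ M.smulRange r i) : φ.f e m ∈ N.smulRange r j := by
  obtain ⟨m, rfl⟩ := h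
  rw [φ.map_smulR]; exact N.smulR_mem _ _

lemma d_mem_smulRange (M : LeftCDGModule D) (r : R) {i j : ℤ} (e : i + 1 = j) {m : M.X i}
    (h : m ∈ M.smulRange r i) : M.d e m ∈ M.smulRange r j := by
  obtain ⟨m, rfl⟩ := h
  rw [M.d_smulR]; exact M.smulR_mem _ _

lemma act_mem_smulRange (M : LeftCDGModule D) (r : R) {i j l : ℤ} (e : i + j = l) (a : ℰ i)
    {m : M.X j} (h : m ∈ M.smulRange r j) : M.act e a m ∈ M.smulRange r l := by
  obtain ⟨m, rfl⟩ := h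
  rw [act_smulR]; exact M.smulR_mem _ _

lemma smulR_mem_pow_succ (M : LeftCDGModule D) (t : R) (m : ℕ) {j : ℤ} {x : M.X j}
    (h : x ∈ M.smulRange (t ^ m) j) : M.smulR t j x ∈ M.smulRange (t ^ (m + 1)) j := by
  obtain ⟨x, rfl⟩ := h
  exact ⟨x, by rw [pow_succ', smulR_mul]⟩

lemma exists_of_mem_pow_succ (M : LeftCDGModule D) (t : R) (m : ℕ) {j : ℤ} {x : M.X j}
    (h : x ∈ M.smulRange (t ^ (m + 1)) j) : ∃ y ∈ M.smulRange (t ^ m) j, M.smulR t j y = x := by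
  obtain ⟨x, rfl⟩ := h
  exact ⟨_, ⟨x, rfl⟩, by rw [pow_succ', smulR_mul]⟩

lemma smulRange_antitone (M : LeftCDGModule D) (t : R) {m m' : ℕ} (hm : m ≤ m') {j : ℤ} {x : M.X j}
    (h : x ∈ M.smulRange (t ^ m') j) : x ∈ M.smulRange (t ^ m) j := by
  obtain ⟨x, rfl⟩ := h
  exact ⟨M.smulR (t ^ (m' - m)) j x, by rw [← smulR_mul, ← pow_add, Nat.add_sub_cancel' hm]⟩

lemma castX_mem_smulRange (M : LeftCDGModule D) (r : R) {i j : ℤ} (h : i = j) {x : M.X i}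
    (hx : x ∈ M.smulRange r i) : M.castX h x ∈ M.smulRange r j := by
  subst h; exact hx

end Scalars

section Twisted

variable (t : R) (m : ℕ)

/-- The subgroup `t^{m+1} M^j ⊕ t^m M^{j+1}`. -/
def tSub (M : LeftCDGModule D) (j : ℤ) : AddSubgroup (M.X j × M.X (j + 1)) :=
  (M.smulRange (t ^ (m + 1)) j).prod (M.smulRange (t ^ m) (j + 1))

/-- The degree `j` part of the complex `M / t^{m+1} M ⊕ M / t^m M [1]`, which is the tensor product of
the right module `twistedRight` with `M`. -/
abbrev TX (M : LeftCDGModule D) (j : ℤ) : Type u := (M.X j × M.X (j + 1)) ⧸ tSub t m M j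

/-- The class of a pair. -/
def tmk {M : LeftCDGModule D} {j : ℤ} : M.X j × M.X (j + 1) →+ TX t m M j := QuotientAddGroup.mk' _

variable {t m} in
lemma tmk_surjective {j : ℤ} (z : TX t m M j) : ∃ x, tmk t m x = z :=
  QuotientAddGroup.mk'_surjective _ z

lemma tmk_eq_zero {j : ℤ} {x : M.X j × M.X (j + 1)} : tmk t m x = 0 ↔
    x.1 ∈ M.smulRange (t ^ (m + 1)) j ∧ x.2 ∈ M.smulRange (t ^ m) (j + 1) :=
  QuotientAddGroup.eq_zero_iff x

/-- The map induced by a graded map. -/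
def tMap {s : ℤ} (φ : GMap M N s) {i j : ℤ} (e : i + s = j) : TX t m M i →+ TX t m N j :=
  QuotientAddGroup.map _ _ ((φ.f e).prodMap (s.negOnePow • φ.f (by omega : i + 1 + s = j + 1)))
    (fun _ hx => ⟨map_mem_smulRange φ _ e hx.1, by
      have := map_mem_smulRange φ _ (by omega : i + 1 + s = j + 1) hx.2
      change s.negOnePow • φ.f _ _ ∈ _
      rcases Int.units_eq_one_or s.negOnePow with h | h <;> rw [h] <;> simpa using this⟩)

lemma tMap_tmk {s : ℤ} (φ : GMap M N s) {i j : ℤ} (e : i + s = j) (x : M.X i × M.X (i + 1)) :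
    tMap t m φ e (tmk t m x) =
      tmk t m (φ.f e x.1, s.negOnePow • φ.f (by omega : i + 1 + s = j + 1) x.2) := rfl

lemma tMap_comp {s r q : ℤ} (φ : GMap M N s) (ψ : GMap N P r) (h : s + r = q) {i k j : ℤ}
    (e : i + q = j) (e₁ : i + s = k) (e₂ : k + r = j) (z : TX t m M i) :
    tMap t m (φ.comp ψ h) e z = tMap t m ψ e₂ (tMap t m φ e₁ z) := by
  obtain ⟨x, rfl⟩ := tmk_surjective z
  rw [tMap_tmk, tMap_tmk, tMap_tmk, comp_app _ _ _ _ e₁ e₂,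
    comp_app _ _ _ _ (by omega : i + 1 + s = k + 1) (by omega)]
  simp only [map_negOnePow_smul, smul_smul, ← h, Int.negOnePow_add]
  rw [mul_comm]

lemma tMap_add {s : ℤ} (φ ψ : GMap M N s) {i j : ℤ} (e : i + s = j) (z : TX t m M i) :
    tMap t m (φ + ψ) e z = tMap t m φ e z + tMap t m ψ e z := by
  obtain ⟨x, rfl⟩ := tmk_surjective z
  rw [tMap_tmk, tMap_tmk, tMap_tmk, ← map_add]
  simp

lemma tMap_neg {s : ℤ} (φ : GMap M N s) {i j : ℤ} (e : i + s = j) (z : TX t m M i) :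
    tMap t m (-φ) e z = -tMap t m φ e z := by
  obtain ⟨x, rfl⟩ := tmk_surjective z
  rw [tMap_tmk, tMap_tmk, ← map_neg]
  simp

lemma tMap_zero {s : ℤ} {i j : ℤ} (e : i + s = j) (z : TX t m M i) :
    tMap t m (0 : GMap M N s) e z = 0 := by
  obtain ⟨x, rfl⟩ := tmk_surjective z
  rw [tMap_tmk]
  simp [tmk_eq_zero]

lemma tMap_id {i : ℤ} (z : TX t m M i) : tMap t m (ofHom (𝟙 M)) (add_zero i) z = z := by
  obtain ⟨x, rfl⟩ := tmk_surjective z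
  rw [tMap_tmk]
  simp [ofHom_f]

variable (c' : ℰ 2)

/-- The differential `(x, y) ↦ (d x + t y, - d y - c' x)`. -/
def tD (M : LeftCDGModule D) {i j : ℤ} (h : i + 1 = j) : TX t m M i →+ TX t m M j :=
  QuotientAddGroup.map _ _
    (AddMonoidHom.mk' (fun x => (M.d h x.1 + M.smulR t j (M.castX h x.2),
      - M.d (by omega : i + 1 + 1 = j + 1) x.2 - M.act (by omega : 2 + i = j + 1) c' x.1))
      (fun x y => by
        refine Prod.ext ?_ ?_
        · simp; abel
        · simp [M.act_add]; abel))
    (fun x hx => ⟨add_mem (M.d_mem_smulRange _ h hx.1)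
        (M.smulR_mem_pow_succ t m (M.castX_mem_smulRange _ h hx.2)),
      AddSubgroup.sub_mem (M.smulRange (t ^ m) (j + 1)) (AddSubgroup.neg_mem _ (M.d_mem_smulRange _ _ hx.2)) (M.act_mem_smulRange _ _ c'
        (M.smulRange_antitone t (Nat.le_succ m) hx.1))⟩)

lemma tD_tmk {i j : ℤ} (h : i + 1 = j) (x : M.X i × M.X (i + 1)) :
    tD t m c' M h (tmk t m x) = tmk t m (M.d h x.1 + M.smulR t j (M.castX h x.2),
      - M.d (by omega : i + 1 + 1 = j + 1) x.2 - M.act (by omega : 2 + i = j + 1) c' x.1) := rfl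

/-- All curvature terms cancel because `c = t c'`. What is left is `(d c') x` in the second
component, which lies in `t^m M` by the divisibility of `d c'`. -/
lemma tD_tD (hc : t • (c' : E) = D.curv) (hd : ∃ y : ℰ 3, D.d c' = t ^ m • (y : E)) {i j l : ℤ}
    (h : i + 1 = j) (h' : j + 1 = l) (z : TX t m M i) : tD t m c' M h' (tD t m c' M h z) = 0 := by
  subst h h'
  obtain ⟨⟨x, y⟩, rfl⟩ := tmk_surjective z
  have hc' : D.curvEl = t • c' := Subtype.ext hc.symm
  obtain ⟨b, hb⟩ := hd
  have hb' : D.dEl (by norm_num) c' = t ^ m • b := Subtype.ext hb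
  rw [tD_tmk, tD_tmk, tmk_eq_zero]
  simp only [castX_self, map_add, map_sub, map_neg, M.d_smulR]
  rw [M.d_d _ _ (by omega : 2 + i = i + 1 + 1), M.d_d _ _ (by omega : 2 + (i + 1) = i + 1 + 1 + 1),
    M.leibniz (by omega) (by norm_num : (2 : ℤ) + 1 = 3) rfl _ (by omega) (by omega) c' x, hc', hb',
    smul_act, smul_act, smul_act, M.act_add, act_smulR]
  constructor
  · convert AddSubgroup.zero_mem _ using 1
    abel
  · convert M.smulR_mem (t ^ m) (M.act (by omega : 3 + i = i + 1 + 1 + 1) b x) using 1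
    simp [Int.negOnePow_even 2 (by decide)]

/-- The functor `D_m ⊗ -` takes the differential of a graded map to a graded commutator, whether or
not the map is closed. The non-closed case is needed for the retraction and section of a twisted
extension. -/
lemma tMap_diff {r s : ℤ} (φ : GMap M N r) (h : r + 1 = s) {i i' j j' : ℤ} (e : i + s = j)
    (e₁ : i + r = j') (e₂ : j' + 1 = j) (e₃ : i + 1 = i') (e₄ : i' + r = j) (z : TX t m M i) :
    tMap t m (φ.diff h) e z = tD t m c' N e₂ (tMap t m φ e₁ z) -
      r.negOnePow • tMap t m φ e₄ (tD t m c' M e₃ z) := by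
  subst e₁ e₂ e₃ h
  obtain ⟨⟨x, y⟩, rfl⟩ := tmk_surjective z
  rw [tMap_tmk, tMap_tmk, tD_tmk, tD_tmk, tMap_tmk, ← map_negOnePow_smul (tmk t m), ← map_sub]
  refine congrArg _ (Prod.ext ?_ ?_)
  · simp only [Prod.fst_sub, Prod.smul_fst, castX_self, map_add, map_smulR]
    rw [diff_f _ _ e rfl rfl rfl e₄, map_negOnePow_smul, smul_add]
    abel
  · simp only [Prod.snd_sub, Prod.smul_snd, map_sub, map_neg]
    rw [diff_f _ _ _ (by omega : i + 1 + r = i + r + 1) rfl rfl (by omega),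
      φ.map_act _ rfl _ (by omega), map_negOnePow_smul, mul_comm r 2, Int.negOnePow_two_mul,
      Int.negOnePow_succ]
    rcases Int.units_eq_one_or r.negOnePow with h | h <;> simp [h] <;> abel

lemma tMap_tD {s : ℤ} {φ : GMap M N s} (hφ : φ.IsClosed) {i i' j j' : ℤ}
    (e₁ : i + s = j') (e₂ : j' + 1 = j) (e₃ : i + 1 = i') (e₄ : i' + s = j) (z : TX t m M i) :
    tMap t m φ e₄ (tD t m c' M e₃ z) = s.negOnePow • tD t m c' N e₂ (tMap t m φ e₁ z) := by
  have := tMap_diff t m c' φ rfl (by omega) e₁ e₂ e₃ e₄ z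
  rw [hφ.diff_eq_zero, tMap_zero, eq_comm, sub_eq_zero] at this
  rw [this, negOnePow_smul_smul]

/-- Acyclicity of the complex `TX`. -/
def TExact (M : LeftCDGModule D) : Prop := ∀ {i j l : ℤ} (h : i + 1 = j) (h' : j + 1 = l)
  (z : TX t m M j), tD t m c' M h' z = 0 → ∃ w, tD t m c' M h w = z

/-! ### Cohomology -/

/-- The cocycles of the complex `TX`. -/
def tCyc (M : LeftCDGModule D) (j : ℤ) : AddSubgroup (TX t m M j) := (tD t m c' M rfl).ker

/-- The coboundaries of the complex `TX`. -/
def tBd (M : LeftCDGModule D) (j : ℤ) : AddSubgroup (TX t m M j) :=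
  (tD t m c' M (sub_add_cancel j 1)).range

/-- The cohomology of the complex `TX`. -/
abbrev TH (M : LeftCDGModule D) (j : ℤ) : Type u :=
  tCyc t m c' M j ⧸ (tBd t m c' M j).addSubgroupOf (tCyc t m c' M j)

/-- The cohomology class of a cocycle. -/
def hcls {M : LeftCDGModule D} {j : ℤ} (z : TX t m M j) (hz : tD t m c' M rfl z = 0) :
    TH t m c' M j := QuotientAddGroup.mk ⟨z, hz⟩

variable {t m c'}

lemma hcls_surjective {j : ℤ} (x : TH t m c' M j) : ∃ z hz, hcls t m c' z hz = x := by
  obtain ⟨⟨z, hz⟩, rfl⟩ := QuotientAddGroup.mk_surjective x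
  exact ⟨z, hz, rfl⟩

lemma hcls_eq_zero {i j : ℤ} (h : i + 1 = j) {z : TX t m M j} (hz : tD t m c' M rfl z = 0) :
    hcls t m c' z hz = 0 ↔ ∃ w, tD t m c' M h w = z := by
  obtain rfl : i = j - 1 := by omega
  exact QuotientAddGroup.eq_zero_iff _

lemma hcls_sub {j : ℤ} {z z' : TX t m M j} (hz : tD t m c' M rfl z = 0)
    (hz' : tD t m c' M rfl z' = 0) : hcls t m c' z hz - hcls t m c' z' hz' =
      hcls t m c' (z - z') (by rw [map_sub, hz, hz', sub_zero]) := rfl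

lemma hcls_eq {i j : ℤ} (h : i + 1 = j) {z z' : TX t m M j} (hz : tD t m c' M rfl z = 0)
    (hz' : tD t m c' M rfl z' = 0) :
    hcls t m c' z hz = hcls t m c' z' hz' ↔ ∃ w, tD t m c' M h w = z - z' := by
  rw [← sub_eq_zero, hcls_sub, hcls_eq_zero h]

lemma tD_tMap_eq_zero {s : ℤ} {φ : GMap M N s} (hφ : φ.IsClosed) {i j : ℤ} (e : i + s = j)
    {z : TX t m M i} (hz : tD t m c' M rfl z = 0) : tD t m c' N rfl (tMap t m φ e z) = 0 := by
  have := tMap_tD t m c' hφ e rfl rfl (by omega) z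
  rw [hz, map_zero] at this
  rw [← negOnePow_smul_smul s (tD t m c' N rfl (tMap t m φ e z)), ← this, smul_zero]

variable (t m c') in
/-- The map induced in cohomology by a closed graded map. -/
def hMap {s : ℤ} {φ : GMap M N s} (hφ : φ.IsClosed) {i j : ℤ} (e : i + s = j) :
    TH t m c' M i →+ TH t m c' N j :=
  QuotientAddGroup.map _ _
    (((tMap t m φ e).comp (tCyc t m c' M i).subtype).codRestrict _
      fun z => tD_tMap_eq_zero hφ e z.2) (by
      rintro ⟨_, hz⟩ ⟨w, rfl⟩
      refine ⟨s.negOnePow • tMap t m φ (by omega : i - 1 + s = j - 1) w, ?_⟩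
      rw [map_negOnePow_smul]
      exact (tMap_tD t m c' hφ _ _ _ _ w).symm)

lemma hMap_hcls {s : ℤ} {φ : GMap M N s} (hφ : φ.IsClosed) {i j : ℤ} (e : i + s = j)
    (z : TX t m M i) (hz : tD t m c' M rfl z = 0) :
    hMap t m c' hφ e (hcls t m c' z hz) = hcls t m c' (tMap t m φ e z) (tD_tMap_eq_zero hφ e hz) :=
  rfl

lemma hcls_congr {j : ℤ} {z z' : TX t m M j} (h : z = z') (hz : tD t m c' M rfl z = 0) :
    hcls t m c' z hz = hcls t m c' z' (h ▸ hz) := by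
  subst h; rfl

lemma hMap_comp {s r q : ℤ} {φ : GMap M N s} {ψ : GMap N P r} (hφ : φ.IsClosed) (hψ : ψ.IsClosed)
    {h : s + r = q} (hc : (φ.comp ψ h).IsClosed) {i k j : ℤ} (e : i + q = j) (e₁ : i + s = k)
    (e₂ : k + r = j) (x : TH t m c' M i) :
    hMap t m c' hc e x = hMap t m c' hψ e₂ (hMap t m c' hφ e₁ x) := by
  obtain ⟨z, hz, rfl⟩ := hcls_surjective x
  rw [hMap_hcls, hMap_hcls, hMap_hcls]
  exact hcls_congr (tMap_comp t m φ ψ h e e₁ e₂ z) _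

lemma hMap_congr {s : ℤ} {φ ψ : GMap M N s} (h : φ = ψ) (hφ : φ.IsClosed) (hψ : ψ.IsClosed)
    {i j : ℤ} (e : i + s = j) (x : TH t m c' M i) : hMap t m c' hφ e x = hMap t m c' hψ e x := by
  subst h; rfl

lemma hMap_id (h : (ofHom (𝟙 M)).IsClosed) {i : ℤ} (x : TH t m c' M i) :
    hMap t m c' h (add_zero i) x = x := by
  obtain ⟨z, hz, rfl⟩ := hcls_surjective x
  rw [hMap_hcls]
  exact hcls_congr (tMap_id t m z) _

lemma hMap_sub {s : ℤ} {φ ψ : GMap M N s} (hφ : φ.IsClosed) (hψ : ψ.IsClosed)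
    (h : (φ - ψ).IsClosed) {i j : ℤ} (e : i + s = j) (x : TH t m c' M i) :
    hMap t m c' h e x = hMap t m c' hφ e x - hMap t m c' hψ e x := by
  obtain ⟨z, hz, rfl⟩ := hcls_surjective x
  rw [hMap_hcls, hMap_hcls, hMap_hcls, hcls_sub]
  refine hcls_congr ?_ _
  rw [sub_eq_add_neg, tMap_add, tMap_neg, sub_eq_add_neg]

lemma tExact_of_forall_eq_zero (h : ∀ (j : ℤ) (x : TH t m c' M j), x = 0) : TExact t m c' M := by
  intro i j l e e' z hz
  subst e'
  exact (hcls_eq_zero e hz).1 (h j _)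

/-! ### Products -/

/-- With `eq_zero_of_tMap_proj` this says that `D_m ⊗ -` commutes with products. The point is that a
family of multiples of a scalar `r` is `r` times a family, by choice. -/
lemma exists_tMap_proj {ι : Type u} {M : ι → LeftCDGModule D} {j : ℤ}
    (z : ∀ k, TX t m (M k) j) : ∃ w : TX t m (prod M) j,
      ∀ k, tMap t m (ofHom (prodProj M k)) (add_zero j) w = z k := by
  choose x hx using fun k => tmk_surjective (z k)
  refine ⟨tmk t m (M := prod M) (j := j) (fun k => (x k).1, fun k => (x k).2), fun k => ?_⟩
  rw [tMap_tmk, ← hx]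
  refine congrArg _ (Prod.ext rfl ?_)
  rw [Int.negOnePow_zero, one_smul]
  rfl

lemma eq_zero_of_tMap_proj {ι : Type u} {M : ι → LeftCDGModule D} {j : ℤ} (z : TX t m (prod M) j)
    (h : ∀ k, tMap t m (ofHom (prodProj M k)) (add_zero j) z = 0) : z = 0 := by
  obtain ⟨x, rfl⟩ := tmk_surjective z
  simp only [tMap_tmk, tmk_eq_zero, Int.negOnePow_zero, one_smul] at h
  choose y hy using fun k => (h k).1
  choose y' hy' using fun k => (h k).2
  rw [tmk_eq_zero]
  exact ⟨⟨y, funext hy⟩, ⟨y', funext hy'⟩⟩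

lemma exists_hMap_proj {ι : Type u} {M : ι → LeftCDGModule D} {j : ℤ}
    (x : ∀ k, TH t m c' (M k) j) : ∃ w : TH t m c' (prod M) j,
      ∀ k, hMap t m c' (ofHom_isClosed (prodProj M k)) (add_zero j) w = x k := by
  choose z hz hx using fun k => hcls_surjective (x k)
  obtain ⟨w, hw⟩ := exists_tMap_proj z
  have hw' : tD t m c' (prod M) rfl w = 0 := by
    refine eq_zero_of_tMap_proj _ fun k => ?_
    rw [tMap_tD t m c' (ofHom_isClosed (prodProj M k)) (add_zero j) rfl rfl, hw, hz, smul_zero]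
  refine ⟨hcls t m c' w hw', fun k => ?_⟩
  rw [hMap_hcls, ← hx]
  exact hcls_congr (hw k) _

/-- Primitives chosen in each factor assemble to a primitive in the product. -/
lemma eq_zero_of_hMap_proj {ι : Type u} {M : ι → LeftCDGModule D} {j : ℤ}
    (x : TH t m c' (prod M) j)
    (h : ∀ k, hMap t m c' (ofHom_isClosed (prodProj M k)) (add_zero j) x = 0) : x = 0 := by
  obtain ⟨z, hz, rfl⟩ := hcls_surjective x
  simp only [hMap_hcls, hcls_eq_zero (sub_add_cancel j 1)] at h
  choose w hw using h
  obtain ⟨y, hy⟩ := exists_tMap_proj w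
  refine (hcls_eq_zero (sub_add_cancel j 1) _).2 ⟨y, ?_⟩
  rw [← sub_eq_zero]
  refine eq_zero_of_tMap_proj _ fun k => ?_
  rw [map_sub, tMap_tD t m c' (ofHom_isClosed (prodProj M k)) (add_zero _)
    (sub_add_cancel j 1) _ _, hy, hw, Int.negOnePow_zero, one_smul, sub_self]

end Twisted

end LeftCDGModule
end CurvedDG

/-! ### The long exact cohomology sequence of a twisted extension. -/

namespace CurvedDG

namespace LeftCDGModule

variable {R : Type*} [CommRing R] {E : Type u} [Ring E] [Algebra R E]
  {ℰ : ℤ → Submodule R E} [GradedAlgebra ℰ] {D : CDGStructure ℰ}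

variable {M N P K : LeftCDGModule D}

open GMap

/-! ### Twisted extensions -/

section Twist

variable {δ : GMap M K 1} (hδ : δ.IsClosed)

/-- The extension `K ⊕ M` twisted by a closed graded map `δ : M → K` of degree `1`, with
predifferential `(k, m) ↦ (d k + δ m, d m)`. -/
def twist : LeftCDGModule D where
  X i := K.X i × M.X i
  act h a x := (K.act h a x.1, M.act h a x.2)
  add_act h a b x := by simp [M.add_act, K.add_act]
  act_add h a x y := by simp [M.act_add, K.act_add]
  one_act h x := by simp [M.one_act, K.one_act]
  mul_act hij hjl h h' a b x := Prod.ext (K.mul_act hij hjl h h' a b x.1)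
    (M.mul_act hij hjl h h' a b x.2)
  d h := AddMonoidHom.mk' (fun x => (K.d h x.1 + δ.f h x.2, M.d h x.2))
    (fun x y => by ext <;> simp; abel)
  leibniz {i j l i' j' l'} h hi hj hl h₁ h₂ a x := by
    simp only [AddMonoidHom.mk'_apply]
    refine Prod.ext ?_ ?_
    · simp only [Prod.fst_add, Prod.smul_fst, K.act_add, smul_add]
      rw [K.leibniz h hi hj hl h₁ h₂, δ.map_act h hj hl h₂, one_mul]
      abel
    · exact M.leibniz h hi hj hl h₁ h₂ a x.2
  d_d {i j l} hi hj h x := by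
    simp only [AddMonoidHom.mk'_apply]
    refine Prod.ext ?_ (M.d_d hi hj h x.2)
    rw [map_add, K.d_d hi hj h, hδ.map_d hi hi hj hj, Int.negOnePow_one]
    simp

/-- The inclusion in a twisted extension. -/
def twistInc : K ⟶ twist hδ :=
  { f := fun i => AddMonoidHom.inl (K.X i) (M.X i)
    map_act := fun {i j l} h a k => Prod.ext rfl (M.act_zero h a).symm
    map_d := fun {i j} h k => Prod.ext
      (by change K.d h k = K.d h k + δ.f h 0; simp)
      (by change (0 : M.X j) = M.d h 0; simp) : Hom K (twist hδ) }

/-- The projection from a twisted extension. -/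
def twistPrj : twist hδ ⟶ M :=
  { f := fun i => AddMonoidHom.snd (K.X i) (M.X i)
    map_act := fun _ _ _ => rfl
    map_d := fun _ _ => rfl : Hom (twist hδ) M }

/-- The graded retraction of the inclusion. -/
def twistRet : GMap (twist hδ) K 0 :=
  ofDegZero (fun i => AddMonoidHom.fst (K.X i) (M.X i)) fun _ _ _ => rfl

/-- The graded section of the projection. -/
def twistSec : GMap M (twist hδ) 0 :=
  ofDegZero (fun i => AddMonoidHom.inr (K.X i) (M.X i)) fun h a _ =>
    Prod.ext (K.act_zero h a).symm rfl

lemma twistInc_prj : (ofHom (twistInc hδ)).comp (ofHom (twistPrj hδ)) (add_zero 0) = 0 :=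
  ext_zero fun i m => by rw [comp_app _ _ _ _ (add_zero i) (add_zero i)]; rfl

lemma twistInc_ret : (ofHom (twistInc hδ)).comp (twistRet hδ) (add_zero 0) = ofHom (𝟙 K) :=
  ext_zero fun i m => by rw [comp_app _ _ _ _ (add_zero i) (add_zero i)]; rfl

lemma twistSec_prj : (twistSec hδ).comp (ofHom (twistPrj hδ)) (add_zero 0) = ofHom (𝟙 M) :=
  ext_zero fun i m => by rw [comp_app _ _ _ _ (add_zero i) (add_zero i)]; rfl

lemma twist_decomp : (twistRet hδ).comp (ofHom (twistInc hδ)) (add_zero 0) +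
    (ofHom (twistPrj hδ)).comp (twistSec hδ) (add_zero 0) = ofHom (𝟙 _) := by
  refine ext_zero fun i m => ?_
  have h : (ofHom (twistInc hδ)).f (add_zero i) ((twistRet hδ).f (add_zero i) m) +
      (twistSec hδ).f (add_zero i) ((ofHom (twistPrj hδ)).f (add_zero i) m) = m :=
    Prod.ext (add_zero m.1) (zero_add m.2)
  rw [add_app, comp_app _ _ _ (add_zero i) (add_zero i) (add_zero i),
    comp_app _ _ _ (add_zero i) (add_zero i) (add_zero i), h]
  rfl

lemma diff_twistRet : (twistRet hδ).diff (zero_add 1) =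
    -(ofHom (twistPrj hδ)).comp δ (zero_add 1) := by
  apply GMap.ext; intro i j e m
  refine (diff_f _ _ e (add_zero i) e e (add_zero j) m).trans ?_
  refine Eq.trans ?_ (congrArg Neg.neg (comp_app _ _ _ e (add_zero i) e m)).symm
  change K.d e m.1 - Int.negOnePow 0 • (K.d e m.1 + δ.f e m.2) = - δ.f e m.2
  simp

lemma diff_twistSec : (twistSec hδ).diff (zero_add 1) =
    δ.comp (ofHom (twistInc hδ)) (add_zero 1) := by
  apply GMap.ext; intro i j e m
  refine (diff_f _ _ e (add_zero i) e e (add_zero j) m).trans ?_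
  refine Eq.trans ?_ (comp_app _ _ _ e e (add_zero j) m).symm
  refine Prod.ext ?_ ?_
  · change K.d e 0 + δ.f e m - Int.negOnePow 0 • (0 : K.X j) = δ.f e m
    simp
  · change M.d e m - Int.negOnePow 0 • M.d e m = 0
    simp

variable {t : R} {m : ℕ} {c' : ℰ 2}

lemma tMap_inc_prj {j : ℤ} (z : TX t m K j) : tMap t m (ofHom (twistPrj hδ)) (add_zero j)
    (tMap t m (ofHom (twistInc hδ)) (add_zero j) z) = 0 := by
  rw [← tMap_comp t m _ _ (add_zero 0) (add_zero j), twistInc_prj, tMap_zero]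

lemma tMap_inc_ret {j : ℤ} (z : TX t m K j) : tMap t m (twistRet hδ) (add_zero j)
    (tMap t m (ofHom (twistInc hδ)) (add_zero j) z) = z := by
  rw [← tMap_comp t m _ _ (add_zero 0) (add_zero j), twistInc_ret, tMap_id]

lemma tMap_sec_prj {j : ℤ} (z : TX t m M j) : tMap t m (ofHom (twistPrj hδ)) (add_zero j)
    (tMap t m (twistSec hδ) (add_zero j) z) = z := by
  rw [← tMap_comp t m _ _ (add_zero 0) (add_zero j), twistSec_prj, tMap_id]

lemma tMap_decomp {j : ℤ} (z : TX t m (twist hδ) j) :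
    tMap t m (ofHom (twistInc hδ)) (add_zero j) (tMap t m (twistRet hδ) (add_zero j) z) +
    tMap t m (twistSec hδ) (add_zero j) (tMap t m (ofHom (twistPrj hδ)) (add_zero j) z) = z := by
  rw [← tMap_comp t m _ _ (add_zero 0) (add_zero j), ← tMap_comp t m _ _ (add_zero 0) (add_zero j),
    ← tMap_add, twist_decomp, tMap_id]

lemma tMap_ofHom_tD (f : M ⟶ N) {i j : ℤ} (h : i + 1 = j) (z : TX t m M i) :
    tMap t m (ofHom f) (add_zero j) (tD t m c' M h z) =
      tD t m c' N h (tMap t m (ofHom f) (add_zero i) z) := by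
  rw [tMap_tD t m c' (ofHom_isClosed f) (add_zero i) h h, Int.negOnePow_zero, one_smul]

lemma tMap_ret_tD {i j : ℤ} (h : i + 1 = j) (z : TX t m (twist hδ) i) :
    tMap t m (twistRet hδ) (add_zero j) (tD t m c' _ h z) =
      tD t m c' K h (tMap t m (twistRet hδ) (add_zero i) z) +
        tMap t m δ h (tMap t m (ofHom (twistPrj hδ)) (add_zero i) z) := by
  have := tMap_diff t m c' (twistRet hδ) (zero_add 1) h (add_zero i) h h (add_zero j) z
  rw [diff_twistRet, tMap_neg, tMap_comp t m _ _ (zero_add 1) h (add_zero i) h,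
    Int.negOnePow_zero, one_smul] at this
  rw [eq_sub_iff_add_eq] at this
  rw [← this]
  abel

lemma tMap_sec_tD {i j : ℤ} (h : i + 1 = j) (z : TX t m M i) :
    tD t m c' _ h (tMap t m (twistSec hδ) (add_zero i) z) =
      tMap t m (twistSec hδ) (add_zero j) (tD t m c' M h z) +
        tMap t m (ofHom (twistInc hδ)) (add_zero j) (tMap t m δ h z) := by
  have := tMap_diff t m c' (twistSec hδ) (zero_add 1) h (add_zero i) h h (add_zero j) z
  rw [diff_twistSec, tMap_comp t m _ _ (add_zero 1) h h (add_zero j),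
    Int.negOnePow_zero, one_smul] at this
  rw [this]
  abel

/-- This and the next lemmas give the long exact sequence of `K → twist hδ → M`, whose connecting
map is induced by `δ` itself. Exactness is checked with the graded splitting `twistRet`, `twistSec`,
whose failure to commute with the differentials is exactly `δ`. -/
lemma exists_of_hMap_inc_eq_zero {i j : ℤ} (h : i + 1 = j) (x : TH t m c' K j)
    (hx : hMap t m c' (ofHom_isClosed (twistInc hδ)) (add_zero j) x = 0) :
    ∃ b : TH t m c' M i, hMap t m c' hδ h b = x := by
  obtain ⟨k, hk, rfl⟩ := hcls_surjective x
  rw [hMap_hcls, hcls_eq_zero h] at hx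
  obtain ⟨w, hw⟩ := hx
  have hb : tD t m c' M h (tMap t m (ofHom (twistPrj hδ)) (add_zero i) w) = 0 := by
    rw [← tMap_ofHom_tD, hw, tMap_inc_prj]
  subst h
  refine ⟨hcls t m c' _ hb, ?_⟩
  rw [hMap_hcls, hcls_eq rfl]
  refine ⟨-tMap t m (twistRet hδ) (add_zero i) w, ?_⟩
  rw [map_neg, neg_eq_iff_add_eq_zero]
  have := tMap_ret_tD (c' := c') hδ rfl w
  rw [hw, tMap_inc_ret] at this
  rw [this]
  abel

lemma exists_of_hMap_delta_eq_zero {i j : ℤ} (h : i + 1 = j) (x : TH t m c' M i)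
    (hx : hMap t m c' hδ h x = 0) : ∃ y : TH t m c' (twist hδ) i,
      hMap t m c' (ofHom_isClosed (twistPrj hδ)) (add_zero i) y = x := by
  obtain ⟨p, hp, rfl⟩ := hcls_surjective x
  rw [hMap_hcls, hcls_eq_zero h] at hx
  obtain ⟨k, hk⟩ := hx
  subst h
  refine ⟨hcls t m c' (tMap t m (twistSec hδ) (add_zero i) p -
    tMap t m (ofHom (twistInc hδ)) (add_zero i) k) ?_, ?_⟩
  · rw [map_sub, tMap_sec_tD, hp, map_zero, zero_add, ← tMap_ofHom_tD, hk, sub_self]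
  · rw [hMap_hcls]
    refine hcls_congr ?_ _
    rw [map_sub, tMap_sec_prj, tMap_inc_prj, sub_zero]

lemma exists_of_hMap_prj_eq_zero {j : ℤ} (x : TH t m c' (twist hδ) j)
    (hx : hMap t m c' (ofHom_isClosed (twistPrj hδ)) (add_zero j) x = 0) :
    ∃ y : TH t m c' K j, hMap t m c' (ofHom_isClosed (twistInc hδ)) (add_zero j) y = x := by
  obtain ⟨z, hz, rfl⟩ := hcls_surjective x
  rw [hMap_hcls, hcls_eq_zero (sub_add_cancel j 1)] at hx
  obtain ⟨w, hw⟩ := hx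
  have h₁ := tMap_decomp hδ z
  have h₂ := tMap_sec_tD (c' := c') hδ (sub_add_cancel j 1) w
  rw [hw] at h₂
  have hy : tD t m c' K rfl (tMap t m (twistRet hδ) (add_zero j) z -
      tMap t m δ (sub_add_cancel j 1) w) = 0 := by
    have := tMap_ret_tD (c' := c') hδ rfl z
    rw [hz, map_zero, ← hw, tMap_tD t m c' hδ (sub_add_cancel j 1) rfl (sub_add_cancel j 1) rfl,
      Int.negOnePow_one, Units.neg_smul, one_smul] at this
    rw [map_sub, sub_eq_add_neg, ← this]
  refine ⟨hcls t m c' _ hy, ?_⟩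
  rw [hMap_hcls, hcls_eq (sub_add_cancel j 1)]
  refine ⟨-tMap t m (twistSec hδ) (add_zero _) w, ?_⟩
  rw [map_neg, h₂, map_sub, eq_sub_iff_add_eq]
  rw [eq_sub_of_add_eq h₁]
  abel

lemma hMap_inc_delta {i j : ℤ} (h : i + 1 = j) (x : TH t m c' M i) :
    hMap t m c' (ofHom_isClosed (twistInc hδ)) (add_zero j) (hMap t m c' hδ h x) = 0 := by
  obtain ⟨p, hp, rfl⟩ := hcls_surjective x
  subst h
  rw [hMap_hcls, hMap_hcls, hcls_eq_zero rfl]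
  refine ⟨tMap t m (twistSec hδ) (add_zero i) p, ?_⟩
  rw [tMap_sec_tD, hp, map_zero, zero_add]

lemma hMap_delta_prj {i j : ℤ} (h : i + 1 = j) (x : TH t m c' (twist hδ) i) :
    hMap t m c' hδ h (hMap t m c' (ofHom_isClosed (twistPrj hδ)) (add_zero i) x) = 0 := by
  obtain ⟨z, hz, rfl⟩ := hcls_surjective x
  subst h
  rw [hMap_hcls, hMap_hcls, hcls_eq_zero rfl]
  refine ⟨-tMap t m (twistRet hδ) (add_zero i) z, ?_⟩
  have := tMap_ret_tD (c' := c') hδ rfl z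
  rw [hz, map_zero] at this
  rw [map_neg, neg_eq_iff_add_eq_zero, this]

/-- By the long exact sequence, an isomorphism as connecting map leaves no cohomology in the middle.
-/
lemma tExact_twist (hinj : ∀ {i j : ℤ} (h : i + 1 = j) (x : TH t m c' M i),
      hMap t m c' hδ h x = 0 → x = 0)
    (hsurj : ∀ {i j : ℤ} (h : i + 1 = j) (y : TH t m c' K j), ∃ x, hMap t m c' hδ h x = y) :
    TExact t m c' (twist hδ) := by
  refine tExact_of_forall_eq_zero fun j x => ?_
  obtain ⟨y, rfl⟩ := exists_of_hMap_prj_eq_zero hδ x (hinj rfl _ (hMap_delta_prj hδ rfl x))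
  obtain ⟨b, rfl⟩ := hsurj (sub_add_cancel j 1) y
  exact hMap_inc_delta hδ _ b

end Twist

/-! ### Twisted extensions and cones -/

/-- An isomorphism of cdg modules. -/
def isoOfBijective (f : M ⟶ N) (g : ∀ i, N.X i →+ M.X i) (h : ∀ i m, g i (Hom.f f i m) = m)
    (h' : ∀ i m, Hom.f f i (g i m) = m) : M ≅ N where
  hom := f
  inv := ⟨g, fun {i j l} e a m => by
      rw [← h l (M.act e a (g j m)), f.map_act, h'], fun {i j} e m => by
      rw [← h j (M.d e (g i m)), f.map_d, h']⟩
  hom_inv_id := hom_ext h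
  inv_hom_id := hom_ext h'

/-- The isomorphism given by mutually inverse closed graded maps of degree `0`. -/
def isoOfGMap {φ : GMap M N 0} {ψ : GMap N M 0} (hφ : φ.IsClosed) (hψ : ψ.IsClosed)
    (h : φ.comp ψ (add_zero 0) = ofHom (𝟙 M)) (h' : ψ.comp φ (add_zero 0) = ofHom (𝟙 N)) :
    M ≅ N where
  hom := hφ.toHom
  inv := hψ.toHom
  hom_inv_id := hom_ext fun i m => by
    refine Eq.trans ?_ (congrArg (fun χ : GMap M M 0 => χ.f (add_zero i) m) h)
    exact (comp_app _ _ _ (add_zero i) (add_zero i) (add_zero i) m).symm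
  inv_hom_id := hom_ext fun i m => by
    refine Eq.trans ?_ (congrArg (fun χ : GMap N N 0 => χ.f (add_zero i) m) h')
    exact (comp_app _ _ _ (add_zero i) (add_zero i) (add_zero i) m).symm

/-- The canonical isomorphism from the double shift `M[1][-1]` to `M`. -/
def shiftShiftIso (M : LeftCDGModule D) : (M.shift 1).shift (-1) ≅ M :=
  isoOfGMap ((unshift_isClosed (M.shift 1) (-1)).comp (unshift_isClosed M 1) (neg_add_cancel 1))
    ((toShift_isClosed M (neg_add_cancel 1)).comp
      (toShift_isClosed (M.shift 1) (add_neg_cancel 1)) (neg_add_cancel 1))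
    (by rw [comp_assoc _ _ _ _ _ (add_zero 1) (neg_add_cancel 1),
          ← comp_assoc _ _ _ (add_neg_cancel 1) (zero_add 1), unshift_toShift, ofHom_id_comp,
          unshift_toShift])
    (by rw [comp_assoc _ _ _ _ _ (add_zero 1) (neg_add_cancel 1),
          ← comp_assoc _ _ _ (add_neg_cancel 1) (zero_add 1), toShift_unshift, ofHom_id_comp,
          toShift_unshift])

/-- The closed morphism to a shift given by a closed graded map of degree `1`. -/
def homToShift {δ : GMap M K 1} (hδ : δ.IsClosed) : M ⟶ K.shift 1 :=
  { f := fun i => δ.f rfl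
    map_act := fun {i j l} h a m => δ.map_act h rfl rfl (by omega) a m
    map_d := fun {i j} h m => hδ.map_d rfl h (by omega) rfl m : Hom M (K.shift 1) }

/-- The cone of a morphism `M → K[1]` is a shift of the twisted extension. -/
def coneIsoTwist {δ : GMap M K 1} (hδ : δ.IsClosed) :
    cone (homToShift hδ.neg) ≅ (twist hδ).shift 1 :=
  isoOfBijective
    { f := fun i => AddMonoidHom.id (K.X (i + 1) × M.X (i + 1))
      map_act := fun {i j l} h a x => by
        refine Prod.ext ?_ ?_
        · rfl
        · change i.negOnePow • M.act _ a x.2 = (1 * i).negOnePow • M.act _ a x.2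
          rw [one_mul]
      map_d := fun {i j} h x => by
        refine Prod.ext ?_ ?_
        -- The shift negates the whole predifferential of the extension, `δ` included, which is why
        -- the cone is that of `-δ`.
        · change Int.negOnePow 1 • K.d _ x.1 + -(δ.f rfl (M.castX h x.2)) =
            Int.negOnePow 1 • (K.d _ x.1 + δ.f _ x.2)
          rw [castX_f, Int.negOnePow_one, Units.neg_smul, Units.neg_smul, one_smul, one_smul,
            neg_add]
        · change - M.d _ x.2 = Int.negOnePow 1 • M.d _ x.2
          rw [Int.negOnePow_one, Units.neg_smul, one_smul] : Hom _ _ }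
    (fun i => AddMonoidHom.id (K.X (i + 1) × M.X (i + 1))) (fun _ _ => rfl) (fun _ _ => rfl)

end LeftCDGModule
end CurvedDG

/-! ### Acyclicity of the graded pieces against acyclicity of `D_i ⊗ M`. -/

namespace CurvedDG

namespace LeftCDGModule

variable {R : Type*} [CommRing R] {E : Type u} [Ring E] [Algebra R E]
  {ℰ : ℤ → Submodule R E} [GradedAlgebra ℰ] {D : CDGStructure ℰ}

variable {M N : LeftCDGModule D} {t : R}

/-- Acyclicity of `t^i M / t^{i+1} M`, in terms of elements. -/
def GrExact (t : R) (i : ℕ) (M : LeftCDGModule D) : Prop :=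
  ∀ {j l s : ℤ} (h : j + 1 = l) (h' : l + 1 = s), ∀ x ∈ M.smulRange (t ^ i) l,
    M.d h' x ∈ M.smulRange (t ^ (i + 1)) s →
      ∃ y ∈ M.smulRange (t ^ i) j, x - M.d h y ∈ M.smulRange (t ^ (i + 1)) l

/-- The curvature is divisible by `t`, so the square of the predifferential raises the `t`-adic
filtration by one. -/
lemma d_d_mem {c' : ℰ 2} (hc : t • (c' : E) = D.curv) (i : ℕ) {j l s : ℤ} (h : j + 1 = l)
    (h' : l + 1 = s) {x : M.X j} (hx : x ∈ M.smulRange (t ^ i) j) :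
    M.d h' (M.d h x) ∈ M.smulRange (t ^ (i + 1)) s := by
  have hc' : D.curvEl = t • c' := Subtype.ext hc.symm
  rw [M.d_d h h' (by omega), hc', smul_act]
  exact M.smulR_mem_pow_succ t i (M.act_mem_smulRange _ _ _ hx)

lemma grD_mk_eq_zero (i : ℕ) {j l : ℤ} (h : j + 1 = l) (x : M.smulRange (t ^ i) j) :
    M.grD t i h (QuotientAddGroup.mk x) = 0 ↔ M.d h x.1 ∈ M.smulRange (t ^ (i + 1)) l :=
  QuotientAddGroup.eq_zero_iff (M.smulRangeD (t ^ i) h x)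

/-- Only one inclusion of exactness survives in `GrExact`; the other, that boundaries are cycles, is
automatic by `d_d_mem`. -/
lemma isNAcyclic_iff {c' : ℰ 2} (hc : t • (c' : E) = D.curv) (n : ℕ) :
    M.IsNAcyclic t n ↔ ∀ i ≤ n, M.GrExact t i := by
  have key : ∀ (i : ℕ) {j l : ℤ} (h : j + 1 = l) (x : M.smulRange (t ^ i) l)
      (y : M.smulRange (t ^ i) j), M.grD t i h (QuotientAddGroup.mk y) = QuotientAddGroup.mk x ↔
        x.1 - M.d h y.1 ∈ M.smulRange (t ^ (i + 1)) l := by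
    intro i j l h x y
    refine (QuotientAddGroup.eq (s := (M.smulRange (t ^ (i + 1)) l).addSubgroupOf _)).trans ?_
    rw [neg_add_eq_sub]
    rfl
  refine forall₂_congr fun i _ => ⟨fun H {j l s} h h' x hx hd => ?_, fun H {j l s} h h' z => ?_⟩
  · obtain ⟨⟨y⟩, hy⟩ := (H h h' (QuotientAddGroup.mk ⟨x, hx⟩)).1 ((grD_mk_eq_zero i h' _).2 hd)
    exact ⟨y.1, y.2, (key i h ⟨x, hx⟩ y).1 hy⟩
  · obtain ⟨z, rfl⟩ := QuotientAddGroup.mk_surjective z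
    rw [grD_mk_eq_zero]
    constructor
    · intro hz
      obtain ⟨y, hy, hyz⟩ := H h h' z.1 z.2 hz
      exact ⟨QuotientAddGroup.mk ⟨y, hy⟩, (key i h z ⟨y, hy⟩).2 hyz⟩
    · rintro ⟨⟨y⟩, hy⟩
      have := M.d_mem_smulRange _ h' ((key i h z y).1 hy)
      rw [map_sub] at this
      have h₂ := d_d_mem hc i h h' y.2
      have := add_mem this h₂
      rwa [sub_add_cancel] at this

lemma smulR_shift (M : LeftCDGModule D) (s : ℤ) (r : R) (j : ℤ) (m : M.X (j + s)) :
    (M.shift s).smulR r j m = M.smulR r (j + s) m := by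
  change (s * 0).negOnePow • M.act _ _ m = _
  rw [mul_zero, Int.negOnePow_zero, one_smul]
  rfl

lemma mem_smulRange_shift (M : LeftCDGModule D) (s : ℤ) (r : R) (j : ℤ) (m : M.X (j + s)) :
    m ∈ (M.shift s).smulRange r j ↔ m ∈ M.smulRange r (j + s) :=
  ⟨fun ⟨y, hy⟩ => ⟨y, (M.smulR_shift s r j y).symm.trans hy⟩,
    fun ⟨y, hy⟩ => ⟨y, (M.smulR_shift s r j y).trans hy⟩⟩

lemma negOnePow_smul_mem_iff {X : Type*} [AddCommGroup X] (S : AddSubgroup X) (s : ℤ) (x : X) :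
    s.negOnePow • x ∈ S ↔ x ∈ S := by
  rcases Int.units_eq_one_or s.negOnePow with h | h <;> rw [h] <;> simp

lemma GrExact.shift {i : ℕ} (h : M.GrExact t i) (s : ℤ) : (M.shift s).GrExact t i := by
  intro j l q e e' x hx hd
  replace hx := (mem_smulRange_shift M s _ _ x).1 hx
  have hd' := (mem_smulRange_shift M s _ _ _).1 hd
  have hd' : M.d (by omega : l + s + 1 = q + s) x ∈ M.smulRange (t ^ (i + 1)) (q + s) :=
    (negOnePow_smul_mem_iff _ s _).1 hd'
  obtain ⟨y, hy, hxy⟩ := h (by omega : j + s + 1 = l + s) _ x hx hd'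
  refine ⟨s.negOnePow • y, (mem_smulRange_shift M s _ _ _).2 ((negOnePow_smul_mem_iff _ s _).2 hy),
    (mem_smulRange_shift M s _ _ _).2 ?_⟩
  have key : ∀ x' : M.X (l + s), x' - M.d (by omega) y ∈ M.smulRange (t ^ (i + 1)) (l + s) →
      x' - s.negOnePow • M.d (by omega) (s.negOnePow • y) ∈
        M.smulRange (t ^ (i + 1)) (l + s) := fun x' h => by
    rwa [map_negOnePow_smul, negOnePow_smul_smul]
  exact key x hxy

lemma Hom.map_mem_smulRange (f : M ⟶ N) (r : R) {j : ℤ} {x : M.X j} (h : x ∈ M.smulRange r j) :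
    Hom.f f j x ∈ N.smulRange r j :=
  LeftCDGModule.map_mem_smulRange (GMap.ofHom f) r (add_zero j) h

lemma GrExact.of_iso {i : ℕ} (h : M.GrExact t i) (e : M ≅ N) : N.GrExact t i := by
  intro j l q e₁ e₂ x hx hd
  obtain ⟨y, hy, hxy⟩ := h e₁ e₂ _ (Hom.map_mem_smulRange e.inv _ hx)
    (by rw [← e.inv.map_d]; exact Hom.map_mem_smulRange e.inv _ hd)
  refine ⟨_, Hom.map_mem_smulRange e.hom _ hy, ?_⟩
  have := Hom.map_mem_smulRange e.hom _ hxy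
  rwa [map_sub, e.hom.map_d, ← comp_f, e.inv_hom_id, id_f] at this

/-- The acyclicity of the complex `(ker t + t^i M) / t^i M`, in terms of elements. -/
def KerExact (t : R) (i : ℕ) (M : LeftCDGModule D) : Prop :=
  ∀ {j l s : ℤ} (h : j + 1 = l) (h' : l + 1 = s) (z : M.X l), M.smulR t l z = 0 →
    M.d h' z ∈ M.smulRange (t ^ i) s →
      ∃ v, M.smulR t j v = 0 ∧ z - M.d h v ∈ M.smulRange (t ^ i) l

variable {c' : ℰ 2}

/-- In particular the curvature acts by zero on the kernel of `t`, which is therefore an honest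
complex. -/
lemma curv_act_eq (hc : t • (c' : E) = D.curv) (M : LeftCDGModule D) {j l : ℤ} (h : 2 + j = l)
    (x : M.X j) : M.act h D.curvEl x = M.act h c' (M.smulR t j x) := by
  have hc' : D.curvEl = t • c' := Subtype.ext hc.symm
  rw [hc', smul_act, act_smulR]

/-- Successive approximation: `z` is pushed, by boundaries of elements killed by `t`, from `t^b M`
down to `t^i M`, one power at a time. The induction is on the number `a = i - b` of remaining steps.
-/
lemma kerExact_aux (hc : t • (c' : E) = D.curv) {i : ℕ} (hM : ∀ i' ≤ i, M.GrExact t i') (a : ℕ) :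
    ∀ b, b + a = i → ∀ {j l s : ℤ} (h : j + 1 = l) (h' : l + 1 = s) (z : M.X l),
      M.smulR t l z = 0 → z ∈ M.smulRange (t ^ b) l → M.d h' z ∈ M.smulRange (t ^ i) s →
      ∃ v, M.smulR t j v = 0 ∧ z - M.d h v ∈ M.smulRange (t ^ i) l := by
  induction a with
  | zero =>
    intro b hb j l s h h' z _ hz' _
    obtain rfl : b = i := by omega
    exact ⟨0, map_zero _, by simpa using hz'⟩
  | succ a ih =>
    intro b hb j l s h h' z hz hzb hd
    -- A first primitive `w` modulo `t^{b+1}`; it need not be killed by `t`.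
    obtain ⟨w, hw, hzw⟩ := hM b (by omega) h h' z hzb (M.smulRange_antitone t (by omega) hd)
    have h₁ : M.d h (M.smulR t j w) ∈ M.smulRange (t ^ (b + 1 + 1)) l := by
      have := M.smulR_mem_pow_succ t _ hzw
      rw [map_sub, hz, zero_sub, ← M.d_smulR] at this
      exact neg_mem_iff.1 this
    -- Since `t z = 0`, the element `t w` is a cycle in the next graded piece, hence a boundary
    -- there. This yields `t w = t (d w₁ + r₂)`, and `v = w - d w₁ - r₂` is killed by `t`.
    obtain ⟨w', hw', hww'⟩ := hM (b + 1) (by omega) (sub_add_cancel j 1) h _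
      (M.smulR_mem_pow_succ t _ hw) h₁
    obtain ⟨w₁, hw₁, rfl⟩ := M.exists_of_mem_pow_succ t b hw'
    obtain ⟨r₂, hr₂, hr⟩ := M.exists_of_mem_pow_succ t (b + 1) hww'
    set v := w - M.d (sub_add_cancel j 1) w₁ - r₂ with hv
    have htv : M.smulR t j v = 0 := by
      rw [hv, map_sub, map_sub, hr, M.d_smulR, sub_self]
    have hzv : z - M.d h v ∈ M.smulRange (t ^ (b + 1)) l := by
      have e : z - M.d h v = (z - M.d h w) + M.d h (M.d (sub_add_cancel j 1) w₁) + M.d h r₂ := by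
        rw [hv, map_sub, map_sub]; abel
      rw [e]
      exact add_mem (add_mem hzw (d_d_mem hc b _ _ hw₁)) (M.d_mem_smulRange _ _ hr₂)
    -- As `t v = 0`, the curvature kills `v`, so subtracting `d v` does not change the differential
    -- of `z` and the induction hypothesis applies.
    have hdd : M.d h' (M.d h v) = 0 := by
      rw [M.d_d h h' (by omega), curv_act_eq hc, htv, M.act_zero]
    obtain ⟨v', hv', hv''⟩ := ih (b + 1) (by omega) h h' (z - M.d h v)
      (by rw [map_sub, hz, ← M.d_smulR, htv, map_zero, sub_zero]) hzv
      (by rwa [map_sub, hdd, sub_zero])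
    refine ⟨v + v', by rw [map_add, htv, hv', add_zero], ?_⟩
    rwa [map_add, ← sub_sub]

lemma kerExact_of_grExact (hc : t • (c' : E) = D.curv) {i : ℕ} (hM : ∀ i' ≤ i, M.GrExact t i') :
    M.KerExact t i := fun {_ l _} h h' z hz hd =>
  kerExact_aux hc hM i 0 (zero_add i) h h' z hz ⟨z, by rw [pow_zero, smulR_one]⟩ hd

lemma mem_pow_zero (M : LeftCDGModule D) {j : ℤ} (x : M.X j) : x ∈ M.smulRange (t ^ 0) j :=
  ⟨x, by rw [pow_zero, smulR_one]⟩

lemma smulR_mem_pow_one (M : LeftCDGModule D) {j : ℤ} (x : M.X j) :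
    M.smulR t j x ∈ M.smulRange (t ^ (0 + 1)) j := by
  rw [zero_add, pow_one]; exact M.smulR_mem t x

/-- A pair `(x, y)` with `d x` divisible by `t` differs by a coboundary from a pair `(0, y')`, if
`M / t M` is acyclic. -/
lemma exists_tmk_zero_sub (h₀ : M.GrExact t 0) (c' : ℰ 2) (i : ℕ) {j : ℤ} (x : M.X (j + 1))
    (y : M.X (j + 1 + 1)) (hx : M.d rfl x ∈ M.smulRange (t ^ (0 + 1)) (j + 1 + 1)) :
    ∃ (w : TX t i M j) (y' : M.X (j + 1 + 1)),
      tmk t i (M := M) (j := j + 1) (x, y) - tD t i c' M rfl w = tmk t i (0, y') := by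
  obtain ⟨u, -, hu⟩ := h₀ rfl rfl x (M.mem_pow_zero x) hx
  rw [zero_add, pow_one] at hu
  obtain ⟨v, hv⟩ := hu
  refine ⟨tmk t i (u, v), y - (-M.d rfl v - M.act (by omega) c' u), ?_⟩
  rw [tD_tmk, ← map_sub]
  refine congrArg _ (Prod.ext ?_ rfl)
  change x - (M.d rfl u + M.smulR t _ v) = 0
  rw [hv]; abel

lemma exists_ker_sub_mem (M : LeftCDGModule D) {i : ℕ} {j : ℤ} {y : M.X j}
    (h : M.smulR t j y ∈ M.smulRange (t ^ (i + 1)) j) :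
    ∃ z, M.smulR t j z = 0 ∧ y - z ∈ M.smulRange (t ^ i) j := by
  obtain ⟨r, hr, e⟩ := M.exists_of_mem_pow_succ t i h
  exact ⟨y - r, by rw [map_sub, e, sub_self], by rwa [sub_sub_cancel]⟩

/-- Acyclicity of `M / tM` reduces a cocycle to the form `(0, y')`. Modulo `t^i`, the element `y'`
is represented by some `z` with `t z = 0`, and `KerExact` provides a primitive. -/
lemma tExact_of_grExact (hc : t • (c' : E) = D.curv) {i : ℕ}
    (hd : ∃ y : ℰ 3, D.d c' = t ^ i • (y : E)) (hM : ∀ i' ≤ i, M.GrExact t i') :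
    TExact t i c' M := by
  intro j l s h h' q hq
  subst h h'
  obtain ⟨⟨x, y⟩, rfl⟩ := tmk_surjective q
  have hx : M.d rfl x ∈ M.smulRange (t ^ (0 + 1)) (j + 1 + 1) := by
    have hq₁ := (tmk_eq_zero t i).1 ((tD_tmk t i c' rfl (x, y)).symm.trans hq)
    have := sub_mem (M.smulRange_antitone t (by omega : 0 + 1 ≤ i + 1) hq₁.1)
      (M.smulR_mem_pow_one (t := t) y)
    rwa [castX_self, add_sub_cancel_right] at this
  obtain ⟨w, y', hw⟩ := exists_tmk_zero_sub (hM 0 (Nat.zero_le i)) c' i x y hx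
  have hq' : tD t i c' M rfl (tmk t i (M := M) (j := j + 1) (0, y')) = 0 := by
    rw [← hw, map_sub, hq, tD_tD t i c' hc hd, sub_zero]
  rw [tD_tmk, tmk_eq_zero, castX_self, map_zero, zero_add, M.act_zero, sub_zero] at hq'
  obtain ⟨z, hz, hyz⟩ := M.exists_ker_sub_mem hq'.1
  have hdz : M.d rfl z ∈ M.smulRange (t ^ i) (j + 1 + 1 + 1) := by
    have := sub_mem (neg_mem hq'.2) (M.d_mem_smulRange _ rfl hyz)
    rwa [neg_neg, map_sub, sub_sub_cancel] at this
  -- The sign of `-v` below matches the `-d` on the second summand, and `t v = 0` keeps the first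
  -- component zero.
  obtain ⟨v, hv, hzv⟩ := kerExact_of_grExact hc hM rfl rfl z hz hdz
  refine ⟨w + tmk t i (0, -v), ?_⟩
  have e : tD t i c' M rfl (tmk t i (M := M) (j := j) (0, -v)) = tmk t i (0, y') := by
    rw [tD_tmk, ← sub_eq_zero, ← map_sub, tmk_eq_zero]
    simp only [castX_self, map_zero, zero_add, M.act_zero, sub_zero, Prod.fst_sub,
      Prod.snd_sub, map_neg, neg_neg, hv, neg_zero]
    refine ⟨zero_mem _, ?_⟩
    convert neg_mem (add_mem hyz hzv) using 1
    change _ = -(y' - z + _)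
    abel
  rw [map_add, e, ← hw]
  abel

lemma kerExact_of_tExact (hc : t • (c' : E) = D.curv) {i : ℕ}
    (hd : ∃ y : ℰ 3, D.d c' = t ^ i • (y : E)) (h₀ : M.GrExact t 0) (hM : TExact t i c' M) :
    M.KerExact t i := by
  intro j l s h h' z hz hdz
  obtain ⟨j, rfl⟩ : ∃ j', j = j' + 1 + 1 := ⟨j - 1 - 1, by omega⟩
  subst h h'
  -- The pair `(0, z)` is a cocycle because `t z = 0`. Its primitive is then moved into the second
  -- summand, where it becomes, modulo `t^i`, an element killed by `t`.
  obtain ⟨w, hw⟩ := hM rfl rfl (tmk t i (M := M) (j := j + 1 + 1) (0, z)) (by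
    rw [tD_tmk, tmk_eq_zero, castX_self, map_zero, zero_add, M.act_zero, sub_zero, hz]
    exact ⟨zero_mem _, neg_mem hdz⟩)
  obtain ⟨⟨u, v⟩, rfl⟩ := tmk_surjective w
  have hu : M.d rfl u ∈ M.smulRange (t ^ (0 + 1)) (j + 1 + 1) := by
    rw [tD_tmk, ← sub_eq_zero, ← map_sub, tmk_eq_zero] at hw
    have := sub_mem (M.smulRange_antitone t (by omega : 0 + 1 ≤ i + 1) hw.1)
      (M.smulR_mem_pow_one (t := t) v)
    rw [castX_self] at this
    simpa using this
  obtain ⟨w', v', hw'⟩ := exists_tmk_zero_sub h₀ c' i u v hu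
  have hv' : tD t i c' M rfl (tmk t i (M := M) (j := j + 1) (0, v')) = tmk t i (0, z) := by
    rw [← hw', map_sub, hw, tD_tD t i c' hc hd, sub_zero]
  rw [tD_tmk, ← sub_eq_zero, ← map_sub, tmk_eq_zero] at hv'
  simp only [castX_self, map_zero, zero_add, M.act_zero, sub_zero, Prod.fst_sub,
    Prod.snd_sub] at hv'
  obtain ⟨v₀, hv₀, hvv⟩ := M.exists_ker_sub_mem hv'.1
  refine ⟨-v₀, by rw [map_neg, hv₀, neg_zero], ?_⟩
  have := sub_mem (neg_mem hv'.2) (M.d_mem_smulRange _ rfl hvv)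
  rw [map_sub] at this
  convert this using 1
  rw [map_neg]
  abel

/-- To solve `x = d y` in `t^{i+1} M / t^{i+2} M`, write `x = t x₁`. Then `x₁` is a cycle in the
previous graded piece only up to elements killed by `t`; it is corrected by such an element, solved
there by induction, and multiplied by `t` again. -/
lemma grExact_of_tExact (hc : t • (c' : E) = D.curv) {n : ℕ}
    (hd : ∀ i ≤ n, ∃ y : ℰ 3, D.d c' = t ^ i • (y : E)) (hM : ∀ i ≤ n, TExact t i c' M) :
    ∀ i ≤ n, M.GrExact t i := by
  intro i
  induction i using Nat.strong_induction_on with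
  | _ i ih =>
  intro hi j l s h h' x hx hdx
  subst h
  cases i with
  | zero =>
    -- For `i = 0` the second summand of the complex is zero and the first is `M / tM`.
    obtain ⟨w, hw⟩ := hM 0 hi rfl h' (tmk t 0 (M := M) (j := j + 1) (x, 0)) (by
      rw [tD_tmk, tmk_eq_zero, map_zero, map_zero, add_zero]
      exact ⟨hdx, M.mem_pow_zero _⟩)
    obtain ⟨⟨u, v⟩, rfl⟩ := tmk_surjective w
    rw [tD_tmk, ← sub_eq_zero, ← map_sub, tmk_eq_zero] at hw
    refine ⟨u, M.mem_pow_zero u, ?_⟩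
    have := add_mem (neg_mem hw.1) (M.smulR_mem_pow_one (t := t) v)
    rw [castX_self] at this
    convert this using 1
    simp only [Prod.fst_sub]
    abel
  | succ i =>
    have hg : ∀ i' ≤ i, M.GrExact t i' := fun i' h => ih i' (by omega) (by omega)
    have h₀ : M.GrExact t 0 := hg 0 (Nat.zero_le i)
    obtain ⟨x₁, hx₁, rfl⟩ := M.exists_of_mem_pow_succ t i hx
    rw [M.d_smulR] at hdx
    obtain ⟨z, hz, hxz⟩ := M.exists_ker_sub_mem hdx
    have hdz : M.d rfl z ∈ M.smulRange (t ^ (i + 1)) (s + 1) := by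
      have := sub_mem (d_d_mem hc i h' rfl hx₁) (M.d_mem_smulRange _ rfl hxz)
      rwa [map_sub, sub_sub_cancel] at this
    -- The obstruction `z` to `x₁` being a cycle is a boundary `d v` modulo `t^{i+1}`, with `t v =
    -- 0`.
    obtain ⟨v, hv, hzv⟩ := kerExact_of_tExact hc (hd _ hi) h₀ (hM _ hi) h' rfl z hz hdz
    have hdv : M.d h' v ∈ M.smulRange (t ^ i) s := by
      have := sub_mem (M.d_mem_smulRange _ h' hx₁)
        (M.smulRange_antitone t (Nat.le_succ i) (add_mem hxz hzv))
      convert this using 1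
      abel
    -- The correction `v` need not lie in `t^i M`. Replacing it by `v - d v₂` achieves this without
    -- changing its differential, since `d (d v₂) = 0`.
    obtain ⟨v₂, hv₂, hvv⟩ := kerExact_of_grExact hc hg rfl h' v hv hdv
    have hdd : M.d h' (M.d rfl v₂) = 0 := by
      rw [M.d_d rfl h' (by omega), curv_act_eq hc, hv₂, M.act_zero]
    obtain ⟨y, hy, hwy⟩ := hg i le_rfl rfl h' (x₁ - (v - M.d rfl v₂)) (sub_mem hx₁ hvv) (by
      rw [map_sub, map_sub, hdd, sub_zero]
      convert add_mem hxz hzv using 1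
      abel)
    refine ⟨_, M.smulR_mem_pow_succ t i hy, ?_⟩
    have := M.smulR_mem_pow_succ t _ hwy
    rwa [map_sub, map_sub, map_sub, ← M.d_smulR, ← M.d_smulR, hv, hv₂, map_zero, sub_zero,
      sub_zero] at this

end LeftCDGModule
end CurvedDG

/-! ### Duality: graded maps to `Γ_m^*` are characters of `D_m ⊗ N`. -/

namespace CurvedDG

variable {R : Type*} [CommRing R] {E : Type u} [Ring E] [Algebra R E]
  {ℰ : ℤ → Submodule R E} [GradedAlgebra ℰ] {D : CDGStructure ℰ}

open LeftCDGModule GMap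

/-- The unit in a degree equal to `0`. -/
def goneEl {l : ℤ} (h : l = 0) : ℰ l := ⟨1, h ▸ SetLike.one_mem_graded ℰ⟩

section Dual

variable {N : LeftCDGModule D} {t : R} {m : ℕ} {c' : ℰ 2}

/-- For an additive map `ψ` on `N^j` vanishing on `r N`, the pairing `(a, x) ↦ ψ (a x)`. -/
def quoEval {A : Type*} [AddCommGroup A] {r : R} {j : ℤ} (ψ : N.X j →+ A)
    (hψ : ∀ x ∈ N.smulRange r j, ψ x = 0) {b i : ℤ} (h : b + i = j) (x : N.X i) :
    quo ℰ r b →+ A :=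
  QuotientAddGroup.lift (LinearMap.range (LinearMap.lsmul R (ℰ b) r)).toAddSubgroup
    (AddMonoidHom.mk' (fun a => ψ (N.act h a x)) fun a a' => by rw [N.add_act, map_add])
    (by
      rintro _ ⟨a, rfl⟩
      refine hψ _ ?_
      change N.act h (r • a) x ∈ _
      rw [smul_act]
      exact N.smulR_mem r _)

variable (hc : t • (c' : E) = D.curv) (hd : ∃ y : ℰ 3, D.d c' = t ^ m • (y : E))

/-- The first generator of `twistedRight`. -/
def gen₀ {l : ℤ} (h : l = 0) : (twistedRight D t c' hc m hd).X l := (quoMk _ (goneEl h), 0)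

/-- The second generator of `twistedRight`. -/
def gen₁ {l : ℤ} (h : l + 1 = 0) : (twistedRight D t c' hc m hd).X l := (0, quoMk _ (goneEl h))

/-- A homogeneous element in the first summand of `twistedRight`. -/
def inFst {l : ℤ} : ℰ l →+ (twistedRight D t c' hc m hd).X l :=
  AddMonoidHom.mk' (fun a => (quoMk _ a, 0)) fun _ _ => Prod.ext rfl (add_zero 0).symm

/-- A homogeneous element in the second summand of `twistedRight`. -/
def inSnd {l : ℤ} : ℰ (l + 1) →+ (twistedRight D t c' hc m hd).X l :=
  AddMonoidHom.mk' (fun a => (0, quoMk _ a)) fun _ _ => Prod.ext (add_zero 0).symm rfl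

variable {hc hd}

lemma exists_inFst_add_inSnd {l : ℤ} (v : (twistedRight D t c' hc m hd).X l) :
    ∃ a b, v = inFst hc hd a + inSnd hc hd b := by
  obtain ⟨⟨a⟩, ⟨b⟩⟩ := v
  exact ⟨a, b, Prod.ext (add_zero _).symm (zero_add _).symm⟩

lemma inFst_act {i j l : ℤ} (h : i + j = l) (a : ℰ i) (b : ℰ j) :
    (twistedRight D t c' hc m hd).act h (inFst hc hd a) b = inFst hc hd (gmul h a b) := by
  refine Prod.ext ?_ (map_zero _)
  change quoMk _ ((1 : R) • rmul h b a) = _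
  rw [one_smul]; rfl

lemma inSnd_act {i j l : ℤ} (h : i + j = l) (h' : i + 1 + j = l + 1) (a : ℰ (i + 1)) (b : ℰ j) :
    (twistedRight D t c' hc m hd).act h (inSnd hc hd a) b = inSnd hc hd (gmul h' a b) := by
  refine Prod.ext (map_zero _) ?_
  change quoMk _ ((1 : R) • rmul h' b a) = _
  rw [one_smul]; rfl

lemma gone_gmul {i j : ℤ} (h : i = 0) (h' : i + j = j) (a : ℰ j) : gmul h' (goneEl h) a = a :=
  Subtype.ext (one_mul _)

/-- The dual of `twistedRight`. -/
abbrev twistedDual (hc : t • (c' : E) = D.curv) (hd : ∃ y : ℰ 3, D.d c' = t ^ m • (y : E)) :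
    LeftCDGModule D := (twistedRight D t c' hc m hd).dual

/-- The evaluation of an element of the dual, with values in `ℚ/ℤ`. -/
def dualEval {l b : ℤ} (h : b = -l) (η : (twistedDual hc hd).X l) :
    (twistedRight D t c' hc m hd).X b →+ AddCircle (1 : ℚ) := by
  subst h; exact η

lemma dualEval_add {l b : ℤ} (h : b = -l) (η η' : (twistedDual hc hd).X l)
    (v : (twistedRight D t c' hc m hd).X b) :
    dualEval h (η + η') v = dualEval h η v + dualEval h η' v := by
  subst h; rfl

/-- The evaluation at an element, as an additive map. -/
def dualEvalHom {l b : ℤ} (h : b = -l) (v : (twistedRight D t c' hc m hd).X b) :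
    (twistedDual hc hd).X l →+ AddCircle (1 : ℚ) :=
  AddMonoidHom.mk' (fun η => dualEval h η v) fun η η' => dualEval_add h η η' v

lemma dualEval_act {i j l b b' : ℤ} (h : i + j = l) (hb : b = -l) (hb' : b' = -j)
    (hbb : b + i = b') (a : ℰ i) (η : (twistedDual hc hd).X j)
    (v : (twistedRight D t c' hc m hd).X b) :
    dualEvalHom hb v ((twistedDual hc hd).act h a η) =
      i.negOnePow • dualEvalHom hb' ((twistedRight D t c' hc m hd).act hbb v a) η := by
  subst hb hb'; rfl

lemma dualEval_d {i j b b' : ℤ} (h : i + 1 = j) (hb : b = -j) (hb' : b' = -i)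
    (hbb : b + 1 = b') (η : (twistedDual hc hd).X i) (v : (twistedRight D t c' hc m hd).X b) :
    dualEvalHom hb v ((twistedDual hc hd).d h η) =
      -(i.negOnePow • dualEvalHom hb' ((twistedRight D t c' hc m hd).d hbb v) η) := by
  subst hb hb'
  exact Units.neg_smul i.negOnePow (dualEval rfl η ((twistedRight D t c' hc m hd).d hbb v))

lemma dualEval_ext {l b : ℤ} (h : b = -l) {η η' : (twistedDual hc hd).X l}
    (h₀ : ∀ a, dualEvalHom h (inFst hc hd a) η = dualEvalHom h (inFst hc hd a) η')
    (h₁ : ∀ a, dualEvalHom h (inSnd hc hd a) η = dualEvalHom h (inSnd hc hd a) η') : η = η' := by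
  subst h
  refine AddMonoidHom.ext fun v => ?_
  obtain ⟨a, b, rfl⟩ := exists_inFst_add_inSnd v
  exact (map_add (dualEval rfl η) _ _).trans
    ((congrArg₂ (· + ·) (h₀ a) (h₁ b)).trans (map_add (dualEval rfl η') _ _).symm)

lemma dualEval_zero_right {l b : ℤ} (h : b = -l) (η : (twistedDual hc hd).X l) :
    dualEvalHom h 0 η = 0 :=
  map_zero (dualEval h η)

lemma dualEval_neg_right {l b : ℤ} (h : b = -l) (v : (twistedRight D t c' hc m hd).X b)
    (η : (twistedDual hc hd).X l) : dualEvalHom h (-v) η = -dualEvalHom h v η :=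
  map_neg (dualEval h η) v

lemma inFst_smul {l : ℤ} (a : ℰ l) : inFst hc hd (t ^ (m + 1) • a) = 0 :=
  Prod.ext ((Submodule.Quotient.mk_eq_zero _).2 ⟨a, rfl⟩) rfl

lemma inSnd_smul {l : ℤ} (a : ℰ (l + 1)) : inSnd hc hd (t ^ m • a) = 0 :=
  Prod.ext rfl ((Submodule.Quotient.mk_eq_zero _).2 ⟨a, rfl⟩)

lemma gmul_scalar {i : ℤ} (h : i + 0 = i) (a : ℰ i) (r : R) : gmul h a (scalar ℰ r) = r • a :=
  Subtype.ext ((Algebra.commutes r (a : E)).symm.trans (Algebra.smul_def r (a : E)).symm)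

lemma dualEval_smulR {l b : ℤ} (h : b = -l) (r : R) (v : (twistedRight D t c' hc m hd).X b)
    (η : (twistedDual hc hd).X l) : dualEvalHom h v ((twistedDual hc hd).smulR r l η) =
      dualEvalHom h ((twistedRight D t c' hc m hd).act (add_zero b) v (scalar ℰ r)) η := by
  refine (dualEval_act (zero_add l) h h (add_zero b) (scalar ℰ r) η v).trans ?_
  rw [Int.negOnePow_zero, one_smul]

lemma dualEval_gen₀_smulR {η : (twistedDual hc hd).X 0}
    (h : η ∈ (twistedDual hc hd).smulRange (t ^ (m + 1)) 0) :
    dualEvalHom (neg_zero.symm) (gen₀ hc hd rfl) η = 0 := by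
  obtain ⟨η, rfl⟩ := h
  rw [dualEval_smulR, show gen₀ hc hd rfl = inFst hc hd (goneEl rfl) from rfl, inFst_act,
    gmul_scalar, inFst_smul, dualEval_zero_right]

lemma dualEval_gen₁_smulR {η : (twistedDual hc hd).X 1}
    (h : η ∈ (twistedDual hc hd).smulRange (t ^ m) 1) :
    dualEvalHom rfl (gen₁ hc hd (neg_add_cancel 1)) η = 0 := by
  obtain ⟨η, rfl⟩ := h
  rw [dualEval_smulR, show gen₁ hc hd (neg_add_cancel 1) = inSnd hc hd (goneEl (neg_add_cancel 1))
    from rfl, inSnd_act _ (by norm_num), gmul_scalar, inSnd_smul, dualEval_zero_right]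

/-- By linearity over the algebra a graded map to the dual is determined by its values at the two
generators; this and `eval_inSnd` make the dependence explicit with signs. -/
lemma eval_inFst {s : ℤ} (φ : GMap N (twistedDual hc hd) s) {i j b l : ℤ} (hj : j + s = 0)
    (e : i + s = l) (hb : b = -l) (hbi : b + i = j) (a : ℰ b) (x : N.X i) :
    dualEvalHom hb (inFst hc hd a) (φ.f e x) = ((1 + s) * b).negOnePow •
      dualEvalHom (neg_zero.symm) (gen₀ hc hd rfl) (φ.f hj (N.act hbi a x)) := by
  rw [φ.map_act hbi e hj (by omega) a x, map_negOnePow_smul,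
    dualEval_act _ _ hb (by omega : (0 : ℤ) + b = b),
    show gen₀ hc hd rfl = inFst hc hd (goneEl rfl) from rfl, inFst_act, gone_gmul, smul_smul,
    smul_smul, add_mul, one_mul, Int.negOnePow_add]
  rcases Int.units_eq_one_or b.negOnePow with h₁ | h₁ <;>
    rcases Int.units_eq_one_or (s * b).negOnePow with h₂ | h₂ <;> simp [h₁, h₂]

lemma eval_inSnd {s : ℤ} (φ : GMap N (twistedDual hc hd) s) {i j b l : ℤ} (hj : j + 1 + s = 1)
    (e : i + s = l) (hb : b = -l) (hbi : b + 1 + i = j + 1) (a : ℰ (b + 1)) (x : N.X i) :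
    dualEvalHom hb (inSnd hc hd a) (φ.f e x) = ((1 + s) * (b + 1)).negOnePow •
      dualEvalHom rfl (gen₁ hc hd (neg_add_cancel 1)) (φ.f hj (N.act hbi a x)) := by
  rw [φ.map_act hbi e hj (by omega) a x, map_negOnePow_smul,
    dualEval_act _ _ hb (by omega : -1 + (b + 1) = b),
    show gen₁ hc hd (neg_add_cancel 1) = inSnd hc hd (goneEl (neg_add_cancel 1)) from rfl,
    inSnd_act _ (by omega : -1 + 1 + (b + 1) = b + 1), gone_gmul, smul_smul,
    smul_smul, add_mul, one_mul, Int.negOnePow_add]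
  rcases Int.units_eq_one_or (b + 1).negOnePow with h₁ | h₁ <;>
    rcases Int.units_eq_one_or (s * (b + 1)).negOnePow with h₂ | h₂ <;> simp [h₁, h₂]

/-- The character of `TX` corresponding to a graded map to the dual of `twistedRight`. -/
def toChar {s : ℤ} (φ : GMap N (twistedDual hc hd) s) {j : ℤ} (hj : j + s = 0) :
    TX t m N j →+ AddCircle (1 : ℚ) :=
  QuotientAddGroup.lift _
    (((dualEvalHom (neg_zero.symm) (gen₀ hc hd rfl)).comp (φ.f hj)).coprod
      (-(s.negOnePow • (dualEvalHom rfl (gen₁ hc hd (neg_add_cancel 1))).comp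
        (φ.f (by omega : j + 1 + s = 1))))) (by
    rintro x ⟨h₀, h₁⟩
    change dualEvalHom _ _ (φ.f hj x.1) + -(s.negOnePow • dualEvalHom _ _ (φ.f _ x.2)) = 0
    rw [dualEval_gen₀_smulR (map_mem_smulRange φ _ hj h₀),
      dualEval_gen₁_smulR (map_mem_smulRange φ _ (by omega : j + 1 + s = 1) h₁)]
    simp)

lemma toChar_tmk {s : ℤ} (φ : GMap N (twistedDual hc hd) s) {j : ℤ} (hj : j + s = 0)
    (x : N.X j × N.X (j + 1)) : toChar φ hj (tmk t m x) =
      dualEvalHom (neg_zero.symm) (gen₀ hc hd rfl) (φ.f hj x.1) -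
      s.negOnePow • dualEvalHom rfl (gen₁ hc hd (neg_add_cancel 1))
        (φ.f (by omega : j + 1 + s = 1) x.2) :=
  (sub_eq_add_neg _ _).symm

/-- The character records exactly the evaluations at the two generators, which determine the map. -/
lemma toChar_injective {s : ℤ} {φ ψ : GMap N (twistedDual hc hd) s} {j : ℤ} (hj : j + s = 0)
    (h : toChar φ hj = toChar ψ hj) : φ = ψ := by
  have h₀ : ∀ x, dualEvalHom (neg_zero.symm) (gen₀ hc hd rfl) (φ.f hj x) =
      dualEvalHom (neg_zero.symm) (gen₀ hc hd rfl) (ψ.f hj x) := fun x => by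
    have := DFunLike.congr_fun h (tmk t m (x, 0))
    simpa [toChar_tmk] using this
  have h₁ : ∀ y, dualEvalHom rfl (gen₁ hc hd (neg_add_cancel 1))
      (φ.f (by omega : j + 1 + s = 1) y) =
      dualEvalHom rfl (gen₁ hc hd (neg_add_cancel 1)) (ψ.f (by omega : j + 1 + s = 1) y) :=
    fun y => by
      have := DFunLike.congr_fun h (tmk t m (0, y))
      simpa [toChar_tmk] using this
  apply GMap.ext
  intro i l e x
  refine dualEval_ext rfl (fun a => ?_) (fun a => ?_)
  · rw [eval_inFst φ hj e rfl (by omega), eval_inFst ψ hj e rfl (by omega), h₀]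
  · rw [eval_inSnd φ (by omega : j + 1 + s = 1) e rfl (by omega),
      eval_inSnd ψ (by omega : j + 1 + s = 1) e rfl (by omega), h₁]

lemma dEl_goneEl {i j : ℤ} (hi : i = 0) (h : i + 1 = j) : D.dEl h (goneEl hi : ℰ i) = 0 := by
  have := D.leibniz 1 (SetLike.one_mem_graded ℰ)
  exact Subtype.ext (by simpa using this : D.d 1 = 0)

lemma d_gen₀ {l : ℤ} (h : (0 : ℤ) + 1 = l) (h' : 2 = l + 1) :
    (twistedRight D t c' hc m hd).d h (gen₀ hc hd rfl) = -inSnd hc hd (castEl h' c') := by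
  refine Prod.ext ?_ ?_
  · change quoMk _ ((1 : R) • D.dEl h (goneEl rfl)) + quoMap t _ (castEl h) 0 = -0
    rw [dEl_goneEl, smul_zero, map_zero, add_zero, neg_zero]
    rfl
  · change -quoMap 1 _ _ 0 - quoMk _ ((1 : R) • lmul (by omega : 2 + 0 = l + 1) c' (goneEl rfl)) =
      -quoMk _ (castEl h' c')
    rw [map_zero, neg_zero, zero_sub, one_smul]
    exact congrArg (fun a => -quoMk _ a) (Subtype.ext (mul_one _))

lemma d_gen₁ {l : ℤ} (h : -1 + 1 = l) (h' : l = 0) :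
    (twistedRight D t c' hc m hd).d h (gen₁ hc hd (neg_add_cancel 1)) =
      inFst hc hd (t • goneEl h') := by
  refine Prod.ext ?_ ?_
  · change quoMap 1 _ (D.dEl h) 0 + quoMk _ (t • castEl h (goneEl (neg_add_cancel 1))) =
      quoMk _ (t • goneEl h')
    rw [map_zero, zero_add]
    rfl
  · change -quoMk _ ((1 : R) • D.dEl _ (goneEl (neg_add_cancel 1))) - quoMap 1 _ _ 0 = 0
    rw [dEl_goneEl, smul_zero, map_zero, sub_zero, neg_eq_zero]
    rfl

lemma act_goneEl {i j : ℤ} (h : i = 0) (h' : i + j = j) (x : N.X j) :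
    N.act h' (goneEl h) x = x := by
  subst h; exact N.one_act _ x

lemma act_castEl {i i' j l : ℤ} (h : i = i') (h' : i' + j = l) (a : ℰ i) (x : N.X j) :
    N.act h' (castEl h a) x = N.act (h ▸ h') a x := by
  subst h; rfl

/-- This comes down to the predifferential of the generators: `gen₁` goes to `t` times `gen₀`, and
`gen₀` to minus the class of `c'`. These are the off-diagonal entries of `tD`. -/
lemma toChar_diff {r s : ℤ} (η : GMap N (twistedDual hc hd) r) (h : r + 1 = s) {j l : ℤ}
    (hj : j + s = 0) (hl : l + r = 0) (hjl : j + 1 = l) (z : TX t m N j) :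
    toChar (η.diff h) hj z = -(r.negOnePow • toChar η hl (tD t m c' N hjl z)) := by
  subst h hjl
  obtain ⟨⟨x, y⟩, rfl⟩ := tmk_surjective z
  rw [toChar_tmk, tD_tmk, toChar_tmk,
    diff_f _ _ _ (by omega : j + r = -1) (neg_add_cancel 1) rfl (by omega),
    diff_f _ _ _ (by omega : j + 1 + r = 0) (zero_add 1) rfl (by omega), map_sub, map_sub,
    dualEval_d _ _ (by norm_num : (1 : ℤ) = -(-1)) (by norm_num),
    dualEval_d _ _ (by norm_num : (0 : ℤ) = -0) (by norm_num),
    d_gen₀ _ (by norm_num), d_gen₁ _ rfl, dualEval_neg_right,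
    eval_inFst η (by omega) _ _ (by omega),
    eval_inSnd η (by omega : j + 1 + 1 + r = 1) _ _ (by omega), castX_self]
  simp only [act_castEl, smul_act, act_goneEl, map_add, map_sub, map_neg, map_negOnePow_smul,
    mul_zero, Int.negOnePow_zero, Int.negOnePow_succ, mul_add, mul_one]
  rcases Int.units_eq_one_or r.negOnePow with h | h <;> simp [h, Int.negOnePow_add] <;> abel

/-- The surjective half of the tensor-hom adjunction; the inverse is dictated by `eval_inFst` and
`eval_inSnd`. -/
lemma exists_toChar_eq {s j : ℤ} (hj : j + s = 0) (χ : TX t m N j →+ AddCircle (1 : ℚ)) :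
    ∃ φ : GMap N (twistedDual hc hd) s, toChar φ hj = χ := by
  let χ₀ : N.X j →+ AddCircle (1 : ℚ) := (χ.comp (tmk t m)).comp (AddMonoidHom.inl _ _)
  let χ₁ : N.X (j + 1) →+ AddCircle (1 : ℚ) := (χ.comp (tmk t m)).comp (AddMonoidHom.inr _ _)
  have h₀ : ∀ x ∈ N.smulRange (t ^ (m + 1)) j, χ₀ x = 0 := fun x hx => by
    change χ (tmk t m (x, 0)) = 0
    rw [(tmk_eq_zero t m).2 ⟨hx, zero_mem _⟩, map_zero]
  have h₁ : ∀ y ∈ N.smulRange (t ^ m) (j + 1), χ₁ y = 0 := fun y hy => by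
    change χ (tmk t m (0, y)) = 0
    rw [(tmk_eq_zero t m).2 ⟨zero_mem _, hy⟩, map_zero]
  -- The signs are those of `eval_inFst` and `eval_inSnd`, the second one multiplied by the sign
  -- `-(-1)^s` with which `gen₁` enters `toChar`.
  let F : ∀ {i l : ℤ} (e : i + s = l) (x : N.X i), (twistedDual hc hd).X l := fun {i l} e x =>
    AddMonoidHom.coprod
      (((1 + s) * -l).negOnePow • quoEval χ₀ h₀ (by omega : -l + i = j) x)
      (-(s.negOnePow • ((1 + s) * (-l + 1)).negOnePow •
        quoEval χ₁ h₁ (by omega : -l + 1 + i = j + 1) x))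
  have F₀ : ∀ {i l b : ℤ} (e : i + s = l) (hb : b = -l) (hbi : b + i = j) (x : N.X i) (a : ℰ b),
      dualEvalHom hb (inFst hc hd a) (F e x) = ((1 + s) * b).negOnePow • χ₀ (N.act hbi a x) := by
    intro i l b e hb hbi x a
    subst hb
    change ((1 + s) * -l).negOnePow • χ₀ (N.act hbi a x) +
      -(s.negOnePow • ((1 + s) * (-l + 1)).negOnePow • quoEval χ₁ h₁ _ x 0) = _
    rw [map_zero]
    simp
  have F₁ : ∀ {i l b : ℤ} (e : i + s = l) (hb : b = -l) (hbi : b + 1 + i = j + 1) (x : N.X i)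
      (a : ℰ (b + 1)), dualEvalHom hb (inSnd hc hd a) (F e x) =
        -(s.negOnePow • ((1 + s) * (b + 1)).negOnePow • χ₁ (N.act hbi a x)) := by
    intro i l b e hb hbi x a
    subst hb
    change ((1 + s) * -l).negOnePow • quoEval χ₀ h₀ _ x 0 +
      -(s.negOnePow • ((1 + s) * (-l + 1)).negOnePow • χ₁ (N.act hbi a x)) = _
    rw [map_zero]
    simp
  let φ : GMap N (twistedDual hc hd) s :=
    { f := fun {i l} e => AddMonoidHom.mk' (F e) fun x y => by
        refine dualEval_ext rfl (fun a => ?_) (fun a => ?_)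
        · rw [map_add, F₀ e rfl (by omega), F₀ e rfl (by omega), F₀ e rfl (by omega), N.act_add,
            map_add, smul_add]
        · rw [map_add, F₁ e rfl (by omega), F₁ e rfl (by omega), F₁ e rfl (by omega), N.act_add,
            map_add, smul_add, smul_add, neg_add]
      map_act := fun {i i' l i'' l'} hl hj hl' e a x => by
        refine dualEval_ext rfl (fun b => ?_) (fun b => ?_)
        · rw [map_negOnePow_smul, dualEval_act e rfl rfl (by omega), inFst_act]
          refine (F₀ hl' rfl (by omega) _ b).trans ?_
          refine Eq.trans ?_ (congrArg _ (congrArg _ (F₀ hj rfl (by omega) x _).symm))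
          rw [N.mul_act (by omega) hl (by omega) (by omega)]
          simp only [smul_smul, ← Int.negOnePow_add]
          -- The two exponents differ by the even number `2 (1 + s) i`, up to sign.
          rw [show ((1 + s) * -l').negOnePow = (s * i + (i + (1 + s) * -i'')).negOnePow from
            (Int.negOnePow_eq_iff _ _).2 ⟨-(1 + s) * i, by rw [← e]; ring⟩]
        · rw [map_negOnePow_smul, dualEval_act e rfl rfl (by omega),
            inSnd_act _ (by omega : -l' + 1 + i = -i'' + 1)]
          refine (F₁ hl' rfl (by omega) _ b).trans ?_
          refine Eq.trans ?_ (congrArg _ (congrArg _ (F₁ hj rfl (by omega) x _).symm))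
          rw [N.mul_act (by omega) hl (by omega) (by omega)]
          simp only [smul_smul, ← Int.negOnePow_add, smul_neg]
          rw [show (s + (1 + s) * (-l' + 1)).negOnePow =
            (s * i + (i + (s + (1 + s) * (-i'' + 1)))).negOnePow from
            (Int.negOnePow_eq_iff _ _).2 ⟨-(1 + s) * i, by rw [← e]; ring⟩] }
  refine ⟨φ, ?_⟩
  refine AddMonoidHom.ext fun z => ?_
  obtain ⟨⟨x, y⟩, rfl⟩ := tmk_surjective z
  rw [toChar_tmk]
  have e₀ := F₀ hj (neg_zero.symm) (zero_add j) x (goneEl rfl)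
  have e₁ := F₁ (by omega : j + 1 + s = 1) rfl (by omega) y (goneEl (neg_add_cancel 1))
  rw [act_goneEl] at e₀ e₁
  refine (congrArg₂ (fun a b => a - s.negOnePow • b) e₀ e₁).trans ?_
  have : ((x, y) : N.X j × N.X (j + 1)) = (x, 0) + (0, y) := by simp
  rw [this, map_add, map_add]
  change _ = χ₀ x + χ₁ y
  simp [smul_smul]

end Dual
end CurvedDG

/-! ### Consequences of `ℚ/ℤ` being an injective cogenerator. -/

namespace CurvedDG

/-- The character descends to the image of `f`, and extends from there because `ℚ/ℤ` is injective.
-/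
lemma exists_char_comp_eq {A B : Type*} [AddCommGroup A] [AddCommGroup B] (f : A →+ B)
    (χ : A →+ AddCircle (1 : ℚ)) (h : ∀ a, f a = 0 → χ a = 0) :
    ∃ ψ : B →+ AddCircle (1 : ℚ), ∀ a, ψ (f a) = χ a := by
  obtain ⟨ψ, hψ⟩ := CharacterModule.dual_surjective_of_injective
    (QuotientAddGroup.kerLift f).toIntLinearMap (QuotientAddGroup.kerLift_injective f)
    (QuotientAddGroup.lift f.ker χ fun a ha => h a ha)
  exact ⟨ψ, fun a => DFunLike.congr_fun hψ (QuotientAddGroup.mk a)⟩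

lemma exists_char_ne_zero {A : Type*} [AddCommGroup A] (S : AddSubgroup A) {a : A} (ha : a ∉ S) :
    ∃ χ : A →+ AddCircle (1 : ℚ), (∀ b ∈ S, χ b = 0) ∧ χ a ≠ 0 := by
  obtain ⟨χ, hχ⟩ := CharacterModule.exists_character_apply_ne_zero_of_ne_zero (A := A ⧸ S)
    (a := QuotientAddGroup.mk a) (fun h => ha ((QuotientAddGroup.eq_zero_iff a).1 h))
  refine ⟨AddMonoidHom.comp χ (QuotientAddGroup.mk' S), fun b hb => ?_, hχ⟩
  change χ (QuotientAddGroup.mk b) = 0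
  rw [(QuotientAddGroup.eq_zero_iff b).2 hb]
  exact map_zero χ

variable {R : Type*} [CommRing R] {E : Type u} [Ring E] [Algebra R E]
  {ℰ : ℤ → Submodule R E} [GradedAlgebra ℰ] {D : CDGStructure ℰ}

open LeftCDGModule GMap

variable {M N : LeftCDGModule D} {t : R} {m : ℕ} {c' : ℰ 2}
  {hc : t • (c' : E) = D.curv} {hd : ∃ y : ℰ 3, D.d c' = t ^ m • (y : E)}

lemma toChar_comp (f : M ⟶ N) {s : ℤ} (φ : GMap N (twistedDual hc hd) s) {j : ℤ} (hj : j + s = 0)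
    (z : TX t m M j) : toChar ((ofHom f).comp φ (zero_add s)) hj z =
      toChar φ hj (tMap t m (ofHom f) (add_zero j) z) := by
  obtain ⟨x, rfl⟩ := tmk_surjective z
  rw [tMap_tmk, toChar_tmk, toChar_tmk, comp_app _ _ _ hj (add_zero j) hj,
    comp_app _ _ _ _ (add_zero (j + 1)) (by omega : j + 1 + s = 1), Int.negOnePow_zero, one_smul]

/-- A character that vanishes on cocycles factors through the differential and extends to the next
degree; the extension is the character of a null-homotopy. -/
lemma isNull_of_toChar_eq_zero {s : ℤ} (φ : GMap N (twistedDual hc hd) s) {j l : ℤ}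
    (hj : j + s = 0) (hl : j + 1 = l)
    (h : ∀ z, tD t m c' N hl z = 0 → toChar φ hj z = 0) : φ.IsNull := by
  obtain ⟨ψ, hψ⟩ := exists_char_comp_eq (tD t m c' N hl) (toChar φ hj) h
  -- The sign cancels the one in `toChar_diff`.
  obtain ⟨η, hη⟩ := exists_toChar_eq (hc := hc) (hd := hd) (by omega : l + (s - 1) = 0)
    (-((s - 1).negOnePow • ψ))
  refine ⟨s - 1, by omega, η, toChar_injective hj (AddMonoidHom.ext fun z => ?_)⟩
  rw [toChar_diff η _ hj (by omega) hl, hη, ← hψ]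
  change -((s - 1).negOnePow • -((s - 1).negOnePow • ψ _)) = _
  rw [smul_neg, neg_neg, negOnePow_smul_smul]

lemma toChar_eq_zero_of_isNull {s : ℤ} {φ : GMap N (twistedDual hc hd) s} (h : φ.IsNull) {j l : ℤ}
    (hj : j + s = 0) (hl : j + 1 = l) {z : TX t m N j} (hz : tD t m c' N hl z = 0) :
    toChar φ hj z = 0 := by
  obtain ⟨r, hr, η, rfl⟩ := h
  rw [toChar_diff η _ hj (by omega) hl, hz, map_zero, smul_zero, neg_zero]

lemma toChar_zero {s j : ℤ} (hj : j + s = 0) (z : TX t m N j) :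
    toChar (0 : GMap N (twistedDual hc hd) s) hj z = 0 := by
  obtain ⟨x, rfl⟩ := tmk_surjective z
  rw [toChar_tmk, zero_app, zero_app, map_zero, map_zero, smul_zero, sub_zero]

lemma isClosed_iff_toChar {s : ℤ} (φ : GMap N (twistedDual hc hd) s) {i j : ℤ} (hj : j + s = 0)
    (h : i + 1 = j) : φ.IsClosed ↔ ∀ w, toChar φ hj (tD t m c' N h w) = 0 := by
  have key := toChar_diff φ rfl (by omega : i + (s + 1) = 0) hj h
  constructor
  · intro hφ w
    have := (key w).symm
    rw [hφ, neg_eq_iff_eq_neg] at this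
    rw [toChar_zero, neg_zero] at this
    rw [← negOnePow_smul_smul s (toChar φ hj _), this, smul_zero]
  · intro hφ
    refine toChar_injective (by omega : i + (s + 1) = 0) (AddMonoidHom.ext fun w => ?_)
    rw [key, hφ, toChar_zero, smul_zero, neg_zero]

/-- The character of a closed map kills coboundaries, hence all cocycles when the complex is
acyclic. -/
lemma isNull_of_tExact (hN : TExact t m c' N) {s : ℤ} {φ : GMap N (twistedDual hc hd) s}
    (hφ : φ.IsClosed) : φ.IsNull := by
  refine isNull_of_toChar_eq_zero φ (neg_add_cancel s) rfl fun z hz => ?_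
  obtain ⟨w, rfl⟩ := hN (sub_add_cancel (-s) 1) rfl z hz
  exact (isClosed_iff_toChar φ _ _).1 hφ w

/-- If a class had nonzero image, some character would vanish on coboundaries but not on that image.
It would give a closed map to the dual whose pullback along `f` is null-homotopic and yet has a
nonzero value on a cocycle. -/
lemma hMap_eq_zero_of_isNull (hc : t • (c' : E) = D.curv)
    (hd : ∃ y : ℰ 3, D.d c' = t ^ m • (y : E)) (f : M ⟶ N)
    (h : ∀ (s : ℤ) (φ : GMap N (twistedDual hc hd) s), φ.IsClosed →
      ((ofHom f).comp φ (zero_add s)).IsNull) {j : ℤ} (x : TH t m c' M j) :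
    hMap t m c' (ofHom_isClosed f) (add_zero j) x = 0 := by
  obtain ⟨z, hz, rfl⟩ := hcls_surjective x
  rw [hMap_hcls, hcls_eq_zero (sub_add_cancel j 1)]
  by_contra hw
  -- Vanishing on coboundaries makes the corresponding graded map closed.
  obtain ⟨χ, h₁, h₂⟩ := exists_char_ne_zero (tD t m c' N (sub_add_cancel j 1)).range hw
  obtain ⟨φ, hφ⟩ := exists_toChar_eq (hc := hc) (hd := hd) (add_neg_cancel j) χ
  have hφ' : φ.IsClosed := (isClosed_iff_toChar φ (add_neg_cancel j) (sub_add_cancel j 1)).2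
    fun w => by rw [hφ]; exact h₁ _ ⟨w, rfl⟩
  apply h₂
  rw [← hφ, ← toChar_comp]
  exact toChar_eq_zero_of_isNull (h _ φ hφ') _ rfl hz

end CurvedDG

/-! ### One step of the tower. -/

namespace CurvedDG

namespace LeftCDGModule

variable {R : Type*} [CommRing R] {E : Type u} [Ring E] [Algebra R E]
  {ℰ : ℤ → Submodule R E} [GradedAlgebra ℰ] {D : CDGStructure ℰ}

variable {M N P K J : LeftCDGModule D}

open GMap

/-! ### Killing maps to a family of modules -/

section Eval

variable {ι : Type} (G : ι → LeftCDGModule D) (F : LeftCDGModule D)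

/-- The set of all closed graded maps from `F` to the members of a family. -/
abbrev EvalIdx : Type u := Σ (i : ι) (s : ℤ), {φ : GMap F (G i) s // φ.IsClosed}

/-- The product of shifts of members of the family that receives the universal closed graded map
of degree `1`. -/
abbrev evalTarget : LeftCDGModule D :=
  prod fun k : EvalIdx G F => (G k.1).shift (k.2.1 - 1)

/-- The universal closed graded map of degree `1` to a product of shifts of members of the family. -/
def evalMap : GMap F (evalTarget G F) 1 :=
  prodLift fun k => k.2.2.1.comp (toShift (G k.1) (k.2.1 - 1) (by omega : 1 - k.2.1 + (k.2.1 - 1) = 0))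
    (add_sub_cancel k.2.1 1)

lemma evalMap_isClosed : (evalMap G F).IsClosed :=
  prodLift_isClosed fun k => k.2.2.2.comp (toShift_isClosed _ _) _

variable {G F}

/-- Each closed map is one of the components of `evalMap`, up to the shift that brings it to degree
`1`. -/
lemma exists_evalMap_comp {i : ι} {s : ℤ} {φ : GMap F (G i) s} (hφ : φ.IsClosed) :
    ∃ ψ : GMap (evalTarget G F) (G i) (s - 1), ψ.IsClosed ∧
      (evalMap G F).comp ψ (add_sub_cancel 1 s) = φ := by
  refine ⟨(ofHom (prodProj _ (⟨i, s, φ, hφ⟩ : EvalIdx G F))).comp (unshift (G i) (s - 1))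
    (zero_add _), (ofHom_isClosed _).comp (unshift_isClosed _ _) _, ?_⟩
  rw [← comp_assoc _ _ _ (add_zero 1) (add_sub_cancel 1 s), evalMap, prodLift_proj]
  exact comp_toShift_unshift_of_eq _ _ _ _

lemma isNull_comp_of_isNull_evalMap {f : N ⟶ F}
    (h : ((ofHom f).comp (evalMap G F) (zero_add 1)).IsNull) {i : ι} {s : ℤ} {φ : GMap F (G i) s}
    (hφ : φ.IsClosed) : ((ofHom f).comp φ (zero_add s)).IsNull := by
  obtain ⟨ψ, hψ, rfl⟩ := exists_evalMap_comp hφ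
  rw [← comp_assoc _ _ _ (zero_add 1) (add_sub_cancel 1 s)]
  exact h.comp_right hψ _

end Eval

/-! ### Composite twisted extensions -/

section Step

variable {δ : GMap M K 1} (hδ : δ.IsClosed) {ε : GMap (twist hδ) J 1} (hε : ε.IsClosed)

/-- The extension of `K` by `J` obtained by restriction of a closed map `twist hδ → J` to `K`. -/
abbrev stepObj : LeftCDGModule D := twist ((ofHom_isClosed (twistInc hδ)).comp hε (zero_add 1))

/-- The closed map of degree `1` from `M` such that the extension twisted by it is an extension of
`twist hδ` by `J`. -/
def stepMap : GMap M (stepObj hδ hε) 1 where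
  f {i j} e := AddMonoidHom.mk' (fun m => (ε.f e ((0, m) : K.X i × M.X i), δ.f e m)) fun m m' => by
    refine Prod.ext ?_ (map_add _ _ _)
    refine Eq.trans (congrArg (ε.f e) ?_) (map_add (ε.f e) ((0, m) : K.X i × M.X i) (0, m'))
    exact Prod.ext (add_zero 0).symm rfl
  map_act {i j l j' l'} hl hj hl' e a m := by
    refine Prod.ext ?_ (δ.map_act hl hj hl' e a m)
    refine Eq.trans (congrArg (ε.f hl') ?_) (ε.map_act hl hj hl' e a ((0, m) : K.X j × M.X j))
    exact Prod.ext (K.act_zero hl a).symm rfl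

lemma inc_comp_app (ε : GMap (twist hδ) J 1) {i j : ℤ} (e : i + 1 = j) (k : K.X i) :
    ((ofHom (twistInc hδ)).comp ε (zero_add 1)).f e k = ε.f e ((k, 0) : K.X i × M.X i) :=
  comp_app _ _ _ e (add_zero i) e k

/-- The first component is the closedness of `ε` evaluated at `(0, m)`: in the twisted extension the
differential of `(0, m)` is `(δ m, d m)`, and the part `δ m` accounts for the twist in the target.
-/
lemma stepMap_isClosed : (stepMap hδ hε).IsClosed := by
  rw [isClosed_iff]
  intro i i' j j' e e₁ e₂ e₃ m
  subst e e₁ e₂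
  rw [Int.negOnePow_one, Units.neg_smul, one_smul]
  have h₁ := hδ.map_d rfl rfl rfl rfl m
  have h₂ := hε.map_d rfl rfl rfl rfl ((0, m) : K.X i × M.X i)
  rw [Int.negOnePow_one, Units.neg_smul, one_smul] at h₁ h₂
  refine Prod.ext ?_ h₁
  change ε.f rfl ((0, M.d rfl m) : K.X (i + 1) × M.X (i + 1)) =
    -(J.d rfl (ε.f rfl ((0, m) : K.X i × M.X i)) +
      ((ofHom (twistInc hδ)).comp ε (zero_add 1)).f rfl (δ.f rfl m))
  rw [inc_comp_app]
  rw [neg_add, ← h₂, ← sub_eq_add_neg]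
  refine Eq.trans (congrArg (ε.f rfl) (Prod.ext ?_ (sub_zero _).symm))
    (map_sub (ε.f rfl) ((twist hδ).d rfl ((0, m) : K.X i × M.X i)) (δ.f rfl m, 0))
  change 0 = K.d rfl 0 + δ.f rfl m - δ.f rfl m
  rw [map_zero, zero_add, sub_self]

lemma stepMap_prj : (stepMap hδ hε).comp (ofHom (twistPrj _)) (add_zero 1) = δ := by
  apply GMap.ext; intro i j e m
  rw [comp_app _ _ _ e e (add_zero j)]
  rfl

/-- The projection of the extension twisted by `stepMap` to the extension twisted by `δ`. -/
def stepPrj : twist (stepMap_isClosed hδ hε) ⟶ twist hδ :=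
  { f := fun i => (AddMonoidHom.snd (J.X i) (K.X i)).prodMap (AddMonoidHom.id (M.X i))
    map_act := fun _ _ _ => rfl
    map_d := fun _ _ => rfl : Hom _ (twist hδ) }

/-- The total space is `J ⊕ K ⊕ M`, the extension of `twist hδ` by `J` along `ε`; minus the graded
projection to `J` is the null-homotopy. -/
lemma isNull_stepPrj_comp : ((ofHom (stepPrj hδ hε)).comp ε (zero_add 1)).IsNull := by
  refine ⟨0, zero_add 1, -(twistRet (stepMap_isClosed hδ hε)).comp (twistRet _) (add_zero 0), ?_⟩
  apply GMap.ext; intro i j e m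
  subst e
  rw [diff_neg, neg_app, diff_f _ _ _ (add_zero i) rfl rfl (add_zero (i + 1)),
    comp_app _ _ _ rfl (add_zero i) rfl, Int.negOnePow_zero, one_smul,
    comp_app _ _ _ (add_zero i) (add_zero i) (add_zero i),
    comp_app _ _ _ (add_zero (i + 1)) (add_zero (i + 1)) (add_zero (i + 1))]
  change -(J.d rfl m.1.1 - (J.d rfl m.1.1 + ((ofHom (twistInc hδ)).comp ε (zero_add 1)).f rfl m.1.2 +
    ε.f rfl ((0, m.2) : K.X i × M.X i))) = ε.f rfl ((m.1.2, m.2) : K.X i × M.X i)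
  rw [inc_comp_app]
  have : ((m.1.2, m.2) : K.X i × M.X i) = (m.1.2, 0) + (0, m.2) := by simp
  rw [this]
  refine Eq.trans ?_ (map_add (ε.f rfl) ((m.1.2, 0) : K.X i × M.X i) (0, m.2)).symm
  abel

variable {t : R} {m : ℕ} {c' : ℰ 2}

lemma hMap_comp_hom (f : M ⟶ N) (g : N ⟶ P) {j : ℤ} (x : TH t m c' M j) :
    hMap t m c' (ofHom_isClosed (f ≫ g)) (add_zero j) x =
      hMap t m c' (ofHom_isClosed g) (add_zero j) (hMap t m c' (ofHom_isClosed f) (add_zero j) x) :=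
  (hMap_congr (ofHom_comp f g) _ ((ofHom_isClosed f).comp (ofHom_isClosed g) (add_zero 0)) _ x).trans
    (hMap_comp _ _ _ _ _ _ x)

/-- A class killed by `stepMap` lifts to the new extension, and the projection to `M` from there
factors through `stepPrj`, which is zero on cohomology. -/
lemma eq_zero_of_hMap_stepMap (h₀ : ∀ (j : ℤ) (x : TH t m c' _ j),
      hMap t m c' (ofHom_isClosed (stepPrj hδ hε)) (add_zero j) x = 0) {i j : ℤ} (h : i + 1 = j)
    (x : TH t m c' M i) (hx : hMap t m c' (stepMap_isClosed hδ hε) h x = 0) : x = 0 := by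
  obtain ⟨y, rfl⟩ := exists_of_hMap_delta_eq_zero _ h x hx
  refine (hMap_comp_hom (stepPrj hδ hε) (twistPrj hδ) y).trans ?_
  rw [h₀, map_zero]

/-- The map from the new `K` to the old extension factors through `stepPrj`. So classes of the old
`K` coming from the new one die in the old extension, that is, they come from `M`. -/
lemma exists_hMap_eq_hMap_prj (h₀ : ∀ (j : ℤ) (x : TH t m c' _ j),
      hMap t m c' (ofHom_isClosed (stepPrj hδ hε)) (add_zero j) x = 0) {i j : ℤ} (h : i + 1 = j)
    (x : TH t m c' (stepObj hδ hε) j) : ∃ b : TH t m c' M i, hMap t m c' hδ h b =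
      hMap t m c' (ofHom_isClosed (twistPrj _)) (add_zero j) x := by
  refine exists_of_hMap_inc_eq_zero hδ h _ ?_
  rw [← hMap_comp_hom]
  exact (hMap_comp_hom (twistInc (stepMap_isClosed hδ hε)) (stepPrj hδ hε) x).trans (h₀ _ _)

end Step

end LeftCDGModule
end CurvedDG

/-! ### Cohomology of the homotopy limit of the tower. -/

namespace CurvedDG

namespace LeftCDGModule

variable {R : Type*} [CommRing R] {E : Type u} [Ring E] [Algebra R E]
  {ℰ : ℤ → Submodule R E} [GradedAlgebra ℰ] {D : CDGStructure ℰ}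

open GMap

/-! ### Homotopy limits of towers -/

variable {M : LeftCDGModule D} {K : ℕ → LeftCDGModule D} (π : ∀ p, K (p + 1) ⟶ K p)

/-- The product of a sequence. -/
abbrev seqProd (K : ℕ → LeftCDGModule D) : LeftCDGModule D := prod fun k : ULift.{u} ℕ => K k.down

/-- The projections of the product of a sequence. -/
abbrev seqProj (K : ℕ → LeftCDGModule D) (p : ℕ) : seqProd K ⟶ K p :=
  prodProj (fun k : ULift.{u} ℕ => K k.down) ⟨p⟩

/-- The endomorphism `(y_p) ↦ (y_p - π y_{p+1})` of the product of a tower. -/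
def oneSubShift : seqProd K ⟶ seqProd K :=
  { f := fun i => AddMonoidHom.mk'
      (fun y k => y k - Hom.f (π k.down) i (y ⟨k.down + 1⟩)) fun y y' => by
        funext k
        change y k + y' k - Hom.f (π k.down) i (y ⟨k.down + 1⟩ + y' ⟨k.down + 1⟩) =
          y k - Hom.f (π k.down) i (y ⟨k.down + 1⟩) + (y' k - Hom.f (π k.down) i (y' ⟨k.down + 1⟩))
        rw [map_add, add_sub_add_comm]
    map_act := fun {i j l} h a y => by
      funext k
      refine Eq.trans ?_ ((K k.down).act_sub h a _ _).symm
      exact congrArg (_ - ·) ((π k.down).map_act h a _)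
    map_d := fun {i j} h y => by
      funext k
      refine Eq.trans ?_ (map_sub ((K k.down).d h) _ _).symm
      exact congrArg (_ - ·) ((π k.down).map_d h _) : Hom (seqProd K) (seqProd K) }

lemma oneSubShift_proj (p : ℕ) : (ofHom (oneSubShift π)).comp (ofHom (seqProj K p)) (add_zero 0) =
    ofHom (seqProj K p) -
      (ofHom (seqProj K (p + 1))).comp (ofHom (π p)) (add_zero 0) := by
  refine ext_zero fun i y => ?_
  rw [sub_app, comp_app _ _ _ (add_zero i) (add_zero i) (add_zero i),
    comp_app _ _ _ (add_zero i) (add_zero i) (add_zero i)]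
  rfl

/-- The map `1 - π`, as a closed graded map of degree `1` to the desuspension. -/
def towerMap : GMap (seqProd K) ((seqProd K).shift (-1)) 1 :=
  (ofHom (oneSubShift π)).comp (toShift (seqProd K) (-1) (add_neg_cancel 1)) (zero_add 1)

lemma towerMap_isClosed : (towerMap π).IsClosed :=
  (ofHom_isClosed _).comp (toShift_isClosed _ _) _

/-- The homotopy limit of a tower. -/
abbrev towerLim : LeftCDGModule D := twist (towerMap_isClosed π)

variable {π} {δ : ∀ p, GMap M (K p) 1} (hδ : ∀ p, (δ p).IsClosed)
  (hπ : ∀ p, (δ (p + 1)).comp (ofHom (π p)) (add_zero 1) = δ p)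

/-- The map to the homotopy limit given by a compatible family of maps. -/
def towerLift (π : ∀ p, K (p + 1) ⟶ K p) (δ : ∀ p, GMap M (K p) 1) : GMap M (towerLim π) 1 :=
  (prodLift fun k : ULift.{u} ℕ => δ k.down).comp (twistSec _) (add_zero 1)

include hπ in
lemma prodLift_oneSubShift : (prodLift fun k : ULift.{u} ℕ => δ k.down).comp
    (ofHom (oneSubShift π)) (add_zero 1) = 0 := by
  apply GMap.ext; intro i j e m
  rw [comp_app _ _ _ e e (add_zero j)]
  funext k
  change (δ k.down).f e m - Hom.f (π k.down) j ((δ (k.down + 1)).f e m) = 0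
  rw [sub_eq_zero]
  refine (congrArg (fun φ : GMap M (K k.down) 1 => φ.f e m) (hπ k.down)).symm.trans ?_
  exact comp_app _ _ _ e e (add_zero j) m

include hδ hπ in
-- The compatible family is killed on the nose by `1 - π`, so its composite with the non-closed
-- section of the twisted extension is closed.
lemma towerLift_isClosed : (towerLift π δ).IsClosed := by
  have h₀ : (prodLift fun k : ULift.{u} ℕ => δ k.down).comp (towerMap π) rfl = 0 := by
    refine (comp_assoc _ _ _ (add_zero 1) rfl (zero_add 1) rfl).symm.trans ?_
    rw [prodLift_oneSubShift hπ, zero_comp]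
  have h := prodLift_isClosed (φ := fun k : ULift.{u} ℕ => δ k.down) fun k => hδ k.down
  rw [GMap.IsClosed, towerLift, diff_comp _ _ _ rfl (zero_add 1), h.diff_eq_zero, zero_comp,
    diff_twistSec, ← comp_assoc _ _ _ rfl (add_zero _), h₀, zero_comp]
  simp

lemma towerLift_proj (p : ℕ) : (towerLift π δ).comp
    (ofHom (twistPrj (towerMap_isClosed π) ≫ seqProj K p)) (add_zero 1) = δ p := by
  apply GMap.ext; intro i j e m
  rw [comp_app _ _ _ e e (add_zero j), towerLift, comp_app _ _ _ e e (add_zero j)]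
  rfl

variable {t : R} {m : ℕ} {c' : ℰ 2}

lemma hMap_towerLift_proj {i j : ℤ} (h : i + 1 = j) (b : TH t m c' M i) (p : ℕ) :
    hMap t m c' (ofHom_isClosed (seqProj K p)) (add_zero j)
      (hMap t m c' (ofHom_isClosed (twistPrj (towerMap_isClosed π))) (add_zero j)
        (hMap t m c' (towerLift_isClosed hδ hπ) h b)) = hMap t m c' (hδ p) h b := by
  rw [← hMap_comp_hom, ← hMap_comp _ _
    ((towerLift_isClosed hδ hπ).comp (ofHom_isClosed _) (add_zero 1)) h]
  exact hMap_congr (towerLift_proj p) _ _ _ _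

lemma hMap_oneSubShift_proj {j : ℤ} (y : TH t m c' (seqProd K) j) (p : ℕ) :
    hMap t m c' (ofHom_isClosed (seqProj K p)) (add_zero j)
      (hMap t m c' (ofHom_isClosed (oneSubShift π)) (add_zero j) y) =
    hMap t m c' (ofHom_isClosed (seqProj K p)) (add_zero j) y -
      hMap t m c' (ofHom_isClosed (π p)) (add_zero j)
        (hMap t m c' (ofHom_isClosed (seqProj K (p + 1))) (add_zero j) y) := by
  have h₁ := (ofHom_isClosed (seqProj K (p + 1))).comp (ofHom_isClosed (π p)) (add_zero 0)
  rw [← hMap_comp _ _ h₁ (add_zero j), ← hMap_comp _ _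
    ((ofHom_isClosed (oneSubShift π)).comp (ofHom_isClosed (seqProj K p)) (add_zero 0)) (add_zero j),
    ← hMap_sub _ _ ((ofHom_isClosed _).sub h₁)]
  exact hMap_congr (oneSubShift_proj π p) _ _ _ _

lemma hMap_toShift_unshift {j l : ℤ} (h : j + -1 = l) (N : LeftCDGModule D)
    (x : TH t m c' (N.shift (-1)) j) :
    hMap t m c' (toShift_isClosed N (add_neg_cancel 1)) (h ▸ by omega : l + 1 = j)
      (hMap t m c' (unshift_isClosed N (-1)) h x) = x := by
  rw [← hMap_comp _ _ ((unshift_isClosed N (-1)).comp (toShift_isClosed N (add_neg_cancel 1))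
    (neg_add_cancel 1)) (add_zero j)]
  exact (hMap_congr (unshift_toShift (add_neg_cancel 1) (neg_add_cancel 1)) _
    (ofHom_isClosed _) _ x).trans (hMap_id _ x)

lemma hMap_unshift_toShift {j l : ℤ} (h : j + 1 = l) (N : LeftCDGModule D) (x : TH t m c' N j) :
    hMap t m c' (unshift_isClosed N (-1)) (h ▸ by omega : l + -1 = j)
      (hMap t m c' (toShift_isClosed N (add_neg_cancel 1)) h x) = x := by
  rw [← hMap_comp _ _ ((toShift_isClosed N (add_neg_cancel 1)).comp (unshift_isClosed N (-1))
    (add_neg_cancel 1)) (add_zero j)]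
  exact (hMap_congr (toShift_unshift (add_neg_cancel 1)) _
    (ofHom_isClosed _) _ x).trans (hMap_id _ x)

lemma hMap_towerMap {i j : ℤ} (h : i + 1 = j) (y : TH t m c' (seqProd K) i) :
    hMap t m c' (towerMap_isClosed π) h y = hMap t m c' (toShift_isClosed _ (add_neg_cancel 1)) h
      (hMap t m c' (ofHom_isClosed (oneSubShift π)) (add_zero i) y) :=
  hMap_comp _ _ _ _ _ _ y

section

variable (hinj : ∀ (p : ℕ) {i j : ℤ} (h : i + 1 = j) (x : TH t m c' M i),
    hMap t m c' (hδ p) h x = 0 → x = 0)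
  (hsurj : ∀ (p : ℕ) {i j : ℤ} (h : i + 1 = j) (x : TH t m c' (K (p + 1)) j),
    ∃ b, hMap t m c' (hδ p) h b = hMap t m c' (ofHom_isClosed (π p)) (add_zero j) x)

include hsurj in
/-- The first derived limit of the cohomology of the tower vanishes. -/
lemma exists_hMap_oneSubShift_eq (hπ' : ∀ (p : ℕ) {i j : ℤ} (h : i + 1 = j) (x : TH t m c' M i),
      hMap t m c' (ofHom_isClosed (π p)) (add_zero j) (hMap t m c' (hδ (p + 1)) h x) =
        hMap t m c' (hδ p) h x) {j : ℤ} (y : TH t m c' (seqProd K) j) :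
    ∃ z, hMap t m c' (ofHom_isClosed (oneSubShift π)) (add_zero j) z = y := by
  choose c hc using fun p => hsurj p (sub_add_cancel j 1)
    (hMap t m c' (ofHom_isClosed (seqProj K (p + 1))) (add_zero j) y)
  -- Solving `z_p - π z_{p+1} = y_p` with `z_p = y_p + δ_p e_p`: since `π y_{p+1} = δ_p c_p`, the
  -- equation holds as soon as `e_{p+1} = e_p - c_p`, so any start value will do.
  let e : ℕ → TH t m c' M (j - 1) := fun p => Nat.rec 0 (fun q x => x - c q) p
  obtain ⟨z, hz⟩ := exists_hMap_proj (M := fun k : ULift.{u} ℕ => K k.down) (j := j) fun k =>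
    hMap t m c' (ofHom_isClosed (seqProj K k.down)) (add_zero j) y +
      hMap t m c' (hδ k.down) (sub_add_cancel j 1) (e k.down)
  refine ⟨z, sub_eq_zero.1 (eq_zero_of_hMap_proj _ fun k => ?_)⟩
  have h₁ := hz k
  have h₂ := hz ⟨k.down + 1⟩
  have h₃ := hMap_oneSubShift_proj (π := π) z k.down
  have h₄ : e (k.down + 1) = e k.down - c k.down := rfl
  rw [map_sub, sub_eq_zero]
  refine h₃.trans ?_
  rw [h₁, h₂, map_add, hπ', h₄, map_sub, hc]
  abel

include hinj hsurj in
-- The cohomology of `M` embeds in every stage, and each transition map has its image inside that of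
-- `M`. Hence the limit of the cohomologies is that of `M`, the derived limit is zero, and the lift
-- to the homotopy limit is an isomorphism on cohomology.
lemma tExact_twist_towerLift : TExact t m c' (twist (towerLift_isClosed hδ hπ)) := by
  have hπ' : ∀ (p : ℕ) {i j : ℤ} (h : i + 1 = j) (x : TH t m c' M i),
      hMap t m c' (ofHom_isClosed (π p)) (add_zero j) (hMap t m c' (hδ (p + 1)) h x) =
        hMap t m c' (hδ p) h x := fun p i j h x => by
    rw [← hMap_comp _ _ ((hδ (p + 1)).comp (ofHom_isClosed _) (add_zero 1)) h]
    exact hMap_congr (hπ p) _ _ _ _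
  apply tExact_twist
  · intro i j h x hx
    refine hinj 0 h x ?_
    rw [← hMap_towerLift_proj hδ hπ h x 0, hx, map_zero, map_zero]
  · intro i j h y
    set X := hMap t m c' (ofHom_isClosed (twistPrj (towerMap_isClosed π))) (add_zero j) y with hX
    have h₁ : hMap t m c' (ofHom_isClosed (oneSubShift π)) (add_zero j) X = 0 := by
      have := hMap_delta_prj (towerMap_isClosed π) rfl y
      rw [hMap_towerMap] at this
      have := congrArg (hMap t m c' (unshift_isClosed (seqProd K) (-1))
        (by omega : j + 1 + -1 = j)) this
      rwa [hMap_unshift_toShift, map_zero] at this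
    have h₂ : ∀ p, hMap t m c' (ofHom_isClosed (seqProj K p)) (add_zero j) X =
        hMap t m c' (ofHom_isClosed (π p)) (add_zero j)
          (hMap t m c' (ofHom_isClosed (seqProj K (p + 1))) (add_zero j) X) := fun p => by
      rw [← sub_eq_zero, ← hMap_oneSubShift_proj, h₁, map_zero]
    choose b hb using fun p => hsurj p h
      (hMap t m c' (ofHom_isClosed (seqProj K (p + 1))) (add_zero j) X)
    -- Injectivity at each stage forces the classes of `M` found at different stages to coincide.
    have h₃ : ∀ p, b p = b 0 := fun p => by
      induction p with
      | zero => rfl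
      | succ p ih =>
        rw [← ih, ← sub_eq_zero]
        refine hinj p h _ ?_
        rw [map_sub, ← hπ', hb, ← h₂, ← h₂, hb, ← h₂, sub_self]
    have h₄ : ∀ p, hMap t m c' (hδ p) h (b 0) =
        hMap t m c' (ofHom_isClosed (seqProj K p)) (add_zero j) X := fun p => by
      rw [← h₃ p, hb, ← h₂]
    have h₅ : hMap t m c' (ofHom_isClosed (twistPrj (towerMap_isClosed π))) (add_zero j)
        (y - hMap t m c' (towerLift_isClosed hδ hπ) h (b 0)) = 0 := by
      refine eq_zero_of_hMap_proj _ fun k => ?_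
      rw [map_sub, map_sub]
      have := hMap_towerLift_proj hδ hπ h (b 0) k.down
      rw [h₄] at this
      exact sub_eq_zero.2 this.symm
    obtain ⟨y', hy'⟩ := exists_of_hMap_prj_eq_zero _ _ h₅
    -- The remaining difference comes from the desuspended product, where `1 - π` is surjective on
    -- cohomology, so it vanishes in the homotopy limit.
    obtain ⟨z, hz⟩ := exists_hMap_oneSubShift_eq hδ hsurj hπ'
      (hMap t m c' (unshift_isClosed (seqProd K) (-1)) (by omega : j + -1 = i) y')
    refine ⟨b 0, (sub_eq_zero.1 ?_).symm⟩
    rw [← hy', ← hMap_inc_delta (towerMap_isClosed π) h z, hMap_towerMap, hz, hMap_toShift_unshift]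

end

end LeftCDGModule
end CurvedDG

/-! ### Assembling the tower, and orthogonal subcategories. -/

namespace CurvedDG

namespace LeftCDGModule

variable {R : Type*} [CommRing R] {E : Type u} [Ring E] [Algebra R E]
  {ℰ : ℤ → Submodule R E} [GradedAlgebra ℰ] {D : CDGStructure ℰ}

open GMap

/-! ### Construction of resolutions -/

/-- A closed graded map of degree `1` out of `M`. -/
structure Stage (M : LeftCDGModule D) where
  K : LeftCDGModule D
  δ : GMap M K 1
  closed : δ.IsClosed

variable {M : LeftCDGModule D} {ι : Type} (G : ι → LeftCDGModule D)

/-- The next stage of the tower, in which all closed graded maps to the family `G` are killed. -/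
def Stage.next (S : Stage M) : Stage M :=
  ⟨_, stepMap S.closed (evalMap_isClosed G (twist S.closed)), stepMap_isClosed _ _⟩

/-- The zero module. -/
abbrev zeroObj (D : CDGStructure ℰ) : LeftCDGModule D := prod (PEmpty.elim : PEmpty.{u + 1} → _)

variable (M) in
/-- The stages of the tower. -/
def stage (p : ℕ) : Stage M := Nat.rec ⟨zeroObj D, 0, isClosed_zero⟩ (fun _ => Stage.next G) p

/-- The projection from the next stage of the tower. -/
def Stage.prj (S : Stage M) : (S.next G).K ⟶ S.K :=
  twistPrj ((ofHom_isClosed (twistInc S.closed)).comp (evalMap_isClosed G _) (zero_add 1))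

lemma Stage.next_δ_prj (S : Stage M) :
    (S.next G).δ.comp (ofHom (S.prj G)) (add_zero 1) = S.δ :=
  stepMap_prj S.closed (evalMap_isClosed G _)

variable {G}

lemma stage_mem {Q : LeftCDGModule D → Prop} (hshift : ∀ N s, Q N → Q (shift N s))
    (hprod : ∀ {κ : Type u} (N : κ → LeftCDGModule D), (∀ k, Q (N k)) → Q (prod N))
    (htwist : ∀ {N K : LeftCDGModule D} {δ : GMap N K 1} (hδ : δ.IsClosed), Q N → Q K →
      Q (twist hδ)) (hG : ∀ i, Q (G i)) (p : ℕ) : Q (stage M G p).K := by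
  induction p with
  -- The zero module is an empty product.
  | zero => exact hprod _ fun k => k.elim
  | succ p ih => exact htwist ((ofHom_isClosed (twistInc (stage M G p).closed)).comp
    (evalMap_isClosed G _) (zero_add 1)) ih (hprod _ fun k => hshift _ _ (hG _))

variable {t : R} {m : ℕ} {c' : ℰ 2}

lemma hMap_stepPrj_eq_zero (hc : t • (c' : E) = D.curv) (hd : ∃ y : ℰ 3, D.d c' = t ^ m • (y : E))
    {i : ι} (hi : G i = twistedDual hc hd) (S : Stage M) {j : ℤ}
    (x : TH t m c' (twist (stepMap_isClosed S.closed (evalMap_isClosed G (twist S.closed)))) j) :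
    hMap t m c' (ofHom_isClosed (stepPrj S.closed (evalMap_isClosed G _))) (add_zero j) x = 0 := by
  refine hMap_eq_zero_of_isNull hc hd _ (fun s φ hφ => ?_) x
  -- The equality of modules can only be substituted once the dual is a variable.
  generalize twistedDual hc hd = L at hi φ
  subst hi
  exact isNull_comp_of_isNull_evalMap (isNull_stepPrj_comp _ _) hφ

lemma Stage.eq_zero_of_hMap_next (hc : t • (c' : E) = D.curv)
    (hd : ∃ y : ℰ 3, D.d c' = t ^ m • (y : E)) {i : ι} (hi : G i = twistedDual hc hd) (S : Stage M)
    {j l : ℤ} (h : j + 1 = l) (x : TH t m c' M j) (hx : hMap t m c' (S.next G).closed h x = 0) :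
    x = 0 :=
  eq_zero_of_hMap_stepMap S.closed (evalMap_isClosed G _)
    (fun _ x => hMap_stepPrj_eq_zero hc hd hi _ x) h x hx

lemma Stage.exists_hMap_eq (hc : t • (c' : E) = D.curv)
    (hd : ∃ y : ℰ 3, D.d c' = t ^ m • (y : E)) {i : ι} (hi : G i = twistedDual hc hd) (S : Stage M)
    {j l : ℤ} (h : j + 1 = l) (x : TH t m c' (S.next G).K l) :
    ∃ b : TH t m c' M j, hMap t m c' S.closed h b =
      hMap t m c' (ofHom_isClosed (S.prj G)) (add_zero l) x :=
  exists_hMap_eq_hMap_prj S.closed (evalMap_isClosed G _)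
    (fun _ x => hMap_stepPrj_eq_zero hc hd hi _ x) h x

/-- One tower serves all members of the family at once, because every step kills the maps to all of
them. The predicate `Q` stands for membership in the cocell class. -/
lemma exists_tExact_twist (M : LeftCDGModule D) (G : ι → LeftCDGModule D)
    {Q : LeftCDGModule D → Prop} (hshift : ∀ N s, Q N → Q (shift N s))
    (hprod : ∀ {κ : Type u} (N : κ → LeftCDGModule D), (∀ k, Q (N k)) → Q (prod N))
    (htwist : ∀ {N K : LeftCDGModule D} {δ : GMap N K 1} (hδ : δ.IsClosed), Q N → Q K →
      Q (twist hδ)) (hG : ∀ i, Q (G i)) :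
    ∃ (K : LeftCDGModule D) (δ : GMap M K 1) (hδ : δ.IsClosed), Q K ∧
      ∀ (t : R) (m : ℕ) (c' : ℰ 2) (hc : t • (c' : E) = D.curv)
        (hd : ∃ y : ℰ 3, D.d c' = t ^ m • (y : E)), (∃ i, G i = twistedDual hc hd) →
        TExact t m c' (twist hδ) := by
  -- The tower is taken from stage `1` on: at stage `0` the module is zero and the map from `M` is
  -- not injective on cohomology in general.
  have hY : Q (seqProd fun p => (stage M G (p + 1)).K) :=
    hprod _ fun k => stage_mem hshift hprod htwist hG _
  have hδ : ∀ p, (stage M G (p + 1)).δ.IsClosed := fun p => (stage M G (p + 1)).closed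
  have hπ : ∀ p, (stage M G (p + 2)).δ.comp (ofHom ((stage M G (p + 1)).prj G)) (add_zero 1) =
    (stage M G (p + 1)).δ := fun p => (stage M G (p + 1)).next_δ_prj G
  refine ⟨_, _, towerLift_isClosed hδ hπ, htwist _ hY (hshift _ _ hY), ?_⟩
  rintro t m c' hc hd ⟨i, hi⟩
  apply tExact_twist_towerLift hδ hπ
  · exact fun p {j l} h x hx => (stage M G p).eq_zero_of_hMap_next hc hd hi h x hx
  · exact fun p {j l} h x => (stage M G (p + 1)).exists_hMap_eq hc hd hi h x

/-! ### Triangulated subcategories of the homotopy category -/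

variable {P : ObjectProperty (Hot D)}

lemma IsTriangulatedSubcategory.of_iso (hP : IsTriangulatedSubcategory P) {M N : LeftCDGModule D}
    (e : M ≅ N) (h : P (toHot M)) : P (toHot N) :=
  hP.iso ((Quotient.functor (homotopyRel D)).mapIso e) h

/-- A twisted extension is, up to isomorphism, a desuspended cone. -/
lemma IsTriangulatedSubcategory.twist (hP : IsTriangulatedSubcategory P) {M K : LeftCDGModule D}
    {δ : GMap M K 1} (hδ : δ.IsClosed) (hM : P (toHot M)) (hK : P (toHot K)) :
    P (toHot (twist hδ)) :=
  hP.of_iso (shiftShiftIso _) (hP.shift _ _ (hP.of_iso (coneIsoTwist hδ)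
    (hP.cone _ hM (hP.shift _ _ hK))))

/-- Shift stability makes vanishing in degree `0` equivalent to vanishing in all degrees, and the
latter form is the one stable under cones. -/
lemma rightOrthogonal_iff {S : ObjectProperty (Hot D)}
    (hS : ∀ (N : LeftCDGModule D) (s : ℤ), S (toHot N) → S (toHot (N.shift s)))
    {I : LeftCDGModule D} : S.rightOrthogonal (toHot I) ↔ Orth (fun N => S (toHot N)) I :=
  ⟨fun h => isNull_of_toHot hS fun _ hN f => h f hN, fun h _ f hN => h.eq_zero hN f⟩

lemma isTriangulatedSubcategory_rightOrthogonal {S : ObjectProperty (Hot D)}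
    (hS : ∀ (N : LeftCDGModule D) (s : ℤ), S (toHot N) → S (toHot (N.shift s))) :
    IsTriangulatedSubcategory S.rightOrthogonal where
  zero M hM N f _ := hM.eq_of_tgt f 0
  iso e hM N f hN := by
    rw [← cancel_mono e.inv, Limits.zero_comp]
    exact hM _ hN
  shift M s hM := (rightOrthogonal_iff hS).2 (((rightOrthogonal_iff hS).1 hM).shift s)
  cone f hM hN := (rightOrthogonal_iff hS).2
    (((rightOrthogonal_iff hS).1 hM).cone ((rightOrthogonal_iff hS).1 hN) f)

lemma isClosedUnderProd_rightOrthogonal {S : ObjectProperty (Hot D)}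
    (hS : ∀ (N : LeftCDGModule D) (s : ℤ), S (toHot N) → S (toHot (N.shift s))) :
    IsClosedUnderProd S.rightOrthogonal :=
  fun _ _ h => (rightOrthogonal_iff hS).2 (Orth.prod fun k => (rightOrthogonal_iff hS).1 (h k))

end LeftCDGModule

/-! ### Cocell resolutions and homotopy injectivity over a deformation. -/

namespace CDGDeformation

open LeftCDGModule GMap

variable {k : Type w} [CommRing k] {A : Type v} [Ring A] [Algebra k A]
    {𝒜 : ℤ → Submodule k A} [GradedAlgebra 𝒜] {DA : CDGStructure 𝒜} {n : ℕ}
    {E : Type u} [Ring E] [Algebra (TruncPoly k n) E] {ℰ : ℤ → Submodule (TruncPoly k n) E}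
    [GradedAlgebra ℰ] {DE : CDGStructure ℰ} (B : CDGDeformation DA n DE) (hA : DA.curv = 0)

include B hA

lemma acyclic_shift (N : LeftCDGModule DE) (s : ℤ) (h : acyclic DE (tt k n) n (toHot N)) :
    acyclic DE (tt k n) n (toHot (N.shift s)) := by
  have hc := B.smul_curvDiv hA
  exact (isNAcyclic_iff hc n).2 fun i hi => GrExact.shift ((isNAcyclic_iff hc n).1 h i hi) s

lemma isNAcyclic_of_iso {M N : LeftCDGModule DE} (e : M ≅ N) (h : M.IsNAcyclic (tt k n) n) :
    N.IsNAcyclic (tt k n) n := by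
  have hc := B.smul_curvDiv hA
  exact (isNAcyclic_iff hc n).2 fun i hi => GrExact.of_iso ((isNAcyclic_iff hc n).1 h i hi) e

lemma isNAcyclic_of_tExact {M : LeftCDGModule DE}
    (h : ∀ i : Fin (n + 1), TExact (tt k n) i (B.curvDiv hA) M) : M.IsNAcyclic (tt k n) n := by
  have hc := B.smul_curvDiv hA
  exact (isNAcyclic_iff hc n).2 (grExact_of_tExact hc
    (fun i hi => B.exists_d_curvDiv hA ⟨i, Nat.lt_succ_of_le hi⟩)
    fun i hi => h ⟨i, Nat.lt_succ_of_le hi⟩)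

lemma exists_cocell_resolution (M : LeftCDGModule DE) :
    ∃ (I : LeftCDGModule DE) (f : M ⟶ I), B.IsNCocell hA I ∧ (cone f).IsNAcyclic (tt k n) n := by
  obtain ⟨K, δ, hδ, hK, h⟩ := exists_tExact_twist M (B.cogen hA) (Q := B.IsNCocell hA)
    (fun N s hN P hP hP' hG => hP.shift N s (hN P hP hP' hG))
    (fun N hN P hP hP' hG => hP' _ N fun k => hN k P hP hP' hG)
    (fun hδ hN hK P hP hP' hG => hP.twist hδ (hN P hP hP' hG) (hK P hP hP' hG))
    (fun i P _ _ hG => hG i)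
  -- The degree one map `-δ` is read as a morphism `M → K[1]`; its cone is the shifted acyclic
  -- extension.
  refine ⟨K.shift 1, homToShift hδ.neg, fun P hP hP' hG => hP.shift K 1 (hK P hP hP' hG), ?_⟩
  refine B.isNAcyclic_of_iso hA (coneIsoTwist hδ).symm (B.acyclic_shift hA (twist hδ) 1 ?_)
  exact B.isNAcyclic_of_tExact hA fun i =>
    h _ _ _ (B.smul_curvDiv hA) (B.exists_d_curvDiv hA i) ⟨i, rfl⟩

/-- Maps to `Γ_i^*` are governed by `D_i ⊗ N`, whose acyclicity uses only the graded pieces of index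
at most `i`. -/
lemma nHomotopyInjective_cogen (i : Fin (n + 1)) :
    nHomotopyInjective DE (toHot (B.cogen hA i)) := by
  refine (rightOrthogonal_iff (B.acyclic_shift hA)).2 fun N hN s φ hφ => ?_
  have hc := B.smul_curvDiv hA
  exact isNull_of_tExact (tExact_of_grExact hc (B.exists_d_curvDiv hA i) fun i' hi' =>
    (isNAcyclic_iff hc n).1 hN i' (hi'.trans (Nat.lt_succ_iff.1 i.2))) hφ

/-- Homotopy injective modules form a triangulated subcategory closed under products and containing
the `Γ_i^*`, hence containing the smallest one. -/
lemma IsNCocell.nHomotopyInjective {I : LeftCDGModule DE} (hI : B.IsNCocell hA I) :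
    nHomotopyInjective DE (toHot I) :=
  hI _ (isTriangulatedSubcategory_rightOrthogonal (B.acyclic_shift hA))
    (isClosedUnderProd_rightOrthogonal (B.acyclic_shift hA)) (B.nHomotopyInjective_cogen hA)

end CDGDeformation
end CurvedDG

/-! ### The right adjoint of the localization functor. -/

namespace CurvedDG

/-- If every object admits a morphism in `W` to an object in `P`, and the objects in `P` are
`W`-local, then the localization at `W` is equivalent to `P`. -/
lemma exists_rightAdjoint_of_resolutions {C : Type*} [Category* C] (W : MorphismProperty C)
    (P : ObjectProperty C) [P.IsClosedUnderIsomorphisms] (hW : W ≤ P.isLocal)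
    (hP : ∀ X, ∃ (I : C) (f : X ⟶ I), P I ∧ W f) :
    ∃ i : W.Localization ⥤ C, Nonempty (W.Q ⊣ i) ∧ i.Full ∧ i.Faithful ∧ i.essImage = P := by
  choose I f hI hf using hP
  -- Locality of the objects of `P` makes composition with the resolution `f X` bijective, so
  -- resolutions define a left adjoint to the inclusion of `P`.
  let e : ∀ (X : C) (Y : P.FullSubcategory), ((⟨I X, hI X⟩ : P.FullSubcategory) ⟶ Y) ≃
      (X ⟶ P.ι.obj Y) := fun X Y => P.fullyFaithfulι.homEquiv.trans
    (Equiv.ofBijective _ (hW (f X) (hf X) Y.obj Y.property))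
  have he : ∀ X Y Y' (g : Y ⟶ Y') h, e X Y' (h ≫ g) = e X Y h ≫ P.ι.map g := fun X Y Y' g h =>
    (Category.assoc _ _ _).symm
  let adj := Adjunction.adjunctionOfEquivLeft e he
  have hunit : (W.functorCategory C) adj.unit := fun X => by
    have : adj.unit.app X = f X :=
      (Adjunction.adjunctionOfEquivLeft_unit_app e he X).trans (Category.comp_id (f X))
    rw [this]
    exact hf X
  -- The reflector inverts every morphism that all objects of `P` see as an isomorphism. As its
  -- units lie in `W`, it is itself a localization at `W`.
  have hinv : W.IsInvertedBy (Adjunction.leftAdjointOfEquiv e he) := fun X Y g hg =>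
    (ObjectProperty.isLocal_iff_isIso_map adj g).1 (by
      rintro _ ⟨Z, rfl⟩
      exact hW g hg Z.obj Z.property)
  have := adj.isLocalization_leftAdjoint W hinv hunit
  let F := Localization.equivalenceFromModel (Adjunction.leftAdjointOfEquiv e he) W
  -- Transporting the adjunction along the equivalence between the localization and `P` identifies
  -- the reflector with the quotient functor.
  refine ⟨F.functor ⋙ P.ι, ⟨(adj.comp F.symm.toAdjunction).ofNatIsoLeft
    (Localization.compEquivalenceFromModelInverseIso _ W)⟩, inferInstance, inferInstance, ?_⟩
  ext X
  constructor
  · rintro ⟨Y, ⟨φ⟩⟩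
    exact P.prop_of_iso φ (F.functor.obj Y).property
  · intro hX
    exact ⟨F.inverse.obj ⟨X, hX⟩, ⟨P.ι.mapIso (F.counitIso.app ⟨X, hX⟩)⟩⟩

open LeftCDGModule GMap

variable {k : Type w} [CommRing k] {A : Type v} [Ring A] [Algebra k A]
    {𝒜 : ℤ → Submodule k A} [GradedAlgebra 𝒜] {DA : CDGStructure 𝒜} {n : ℕ}
    {E : Type u} [Ring E] [Algebra (TruncPoly k n) E] {ℰ : ℤ → Submodule (TruncPoly k n) E}
    [GradedAlgebra ℰ] {DE : CDGStructure ℰ}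

/-- Precomposition with a morphism is bijective on maps to an object orthogonal to its cone;
injectivity is tested on differences, as the homotopy category is preadditive. -/
lemma CDGDeformation.quasiIso_le_isLocal (B : CDGDeformation DA n DE) (hA : DA.curv = 0) :
    quasiIso DE (tt k n) n ≤ (nHomotopyInjective DE).isLocal := by
  rintro X Y _ ⟨φ, rfl, hφ⟩ I hI
  have hI' : Orth (fun N => acyclic DE (tt k n) n (toHot N)) I.as :=
    (rightOrthogonal_iff (B.acyclic_shift hA)).1 hI
  constructor
  · intro g g' h
    obtain ⟨g₀, hg⟩ := (Quotient.functor (homotopyRel DE)).map_surjective (X := Y.as) (Y := I.as)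
      (g - g')
    rw [← sub_eq_zero]
    refine hg.symm.trans ((LeftCDGModule.map_eq_zero_iff g₀).2 (hI'.precomp_injective φ hφ g₀ ?_))
    rw [← LeftCDGModule.map_eq_zero_iff, Functor.map_comp, hg]
    exact (Preadditive.comp_sub _ _ _).trans (sub_eq_zero.2 h)
  · intro g
    obtain ⟨g₀, rfl⟩ := (Quotient.functor (homotopyRel DE)).map_surjective (X := X.as) (Y := I.as) g
    obtain ⟨k, hk⟩ := hI'.precomp_surjective φ hφ g₀
    exact ⟨(Quotient.functor (homotopyRel DE)).map k, CategoryTheory.Quotient.sound (homotopyRel DE) hk⟩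

end CurvedDG

theorem mainTheorem10 {k : Type w} [CommRing k] {A : Type v} [Ring A] [Algebra k A]
    (𝒜 : ℤ → Submodule k A) [GradedAlgebra 𝒜] (DA : CurvedDG.CDGStructure 𝒜)
    (hA : DA.curv = 0) (n : ℕ) {E : Type u} [Ring E] [Algebra (CurvedDG.TruncPoly k n) E]
    (ℰ : ℤ → Submodule (CurvedDG.TruncPoly k n) E) [GradedAlgebra ℰ]
    (DE : CurvedDG.CDGStructure ℰ) (B : CurvedDG.CDGDeformation DA n DE) :
    (∀ M : CurvedDG.LeftCDGModule DE, ∃ (I : CurvedDG.LeftCDGModule DE) (f : M ⟶ I),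
      B.IsNCocell hA I ∧ (CurvedDG.LeftCDGModule.cone f).IsNAcyclic (CurvedDG.tt k n) n) ∧
    ∃ i : CurvedDG.NDerived DE ⥤ CurvedDG.LeftCDGModule.Hot DE,
      Nonempty (CurvedDG.NDerived.quotientFunctor DE ⊣ i) ∧ i.Full ∧ i.Faithful ∧
      i.essImage = CurvedDG.nHomotopyInjective DE := by
  refine ⟨B.exists_cocell_resolution hA, CurvedDG.exists_rightAdjoint_of_resolutions _ _
    (B.quasiIso_le_isLocal hA) fun X => ?_⟩
  obtain ⟨I, f, hI, hf⟩ := B.exists_cocell_resolution hA X.as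
  exact ⟨_, (Quotient.functor _).map f, hI.nHomotopyInjective B hA, f, rfl, hf⟩
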